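/- Let $S^1=\mathbb{R}/\mathbb{Z}$. The \emph{Basilica lamination} consists of the arcs joining $\frac{6k-1}{3\cdot 2^n}$ to $\frac{6k+1}{3\cdot 2^n}$ $(k\in\mathbb{Z},\ n\ge 0)$, drawn as hyperbolic geodesics in the open unit disk. Its \emph{gaps} are the connected components of the complement of these geodesics in the open disk; they correspond to the components of the Basilica (the bounded complementary regions of the Julia set of $z^2-1$, which is the quotient of $S^1$ obtained by identifying the endpoints of each arc), adjacent components corresponding to distinct gaps whose closures share a common arc. The gaps have a two-coloring in which adjacent gaps have different colors, and it is unique up to exchanging the two colors. An \emph{arc diagram} is a finite collection of arcs obtained from $\{1/3,2/3\}$ and $\{1/6,5/6\}$ by repeatedly choosing one of the intervals into which the endpoints of the current arcs divide $S^1$ and adding its primary arc, i.e. the arc whose endpoints subdivide that interval in the ratios $1:2:1$. Let $T_B$ be the group, under composition, of \emph{dyadic rearrangements of the Basilica}: the orientation-preserving piecewise-linear homeomorphisms $f$ of $S^1$ for which there are two arc diagrams $\mathcal D$ and $\mathcal R$ such that $f$ maps each interval of $\mathcal D$ linearly onto an interval of $\mathcal R$ and maps the arcs of $\mathcal D$ onto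 the arcs of $\mathcal R$. Such an $f$ preserves the lamination, and hence permutes the gaps: $f$ carries $G$ to $H$ if $f(\overline{G}\cap S^1)=\overline{H}\cap S^1$. Let $\alpha,\beta,\gamma,\delta\in T_B$ be the following elements. $\alpha$ is piecewise linear with breakpoints $1/3,\,2/3$, mapped to $1/6,\,5/6$. $\beta$ is piecewise linear with breakpoints $1/6,\,2/3,\,17/24,\,5/6$, mapped to $1/6,\,7/24,\,1/3,\,5/6$. $\gamma$ is piecewise linear with breakpoints $1/6,\,7/24,\,29/96,\,1/3$, mapped to $1/6,\,19/96,\,5/24,\,1/3$. $\delta$ is the rotation $\theta\mapsto\theta+1/2$. Write $g^{\alpha}=\alpha^{-1}\circ g\circ\alpha$. \textbf{Theorem.} The commutator subgroup $[T_B,T_B]$ is the subgroup of $T_B$ consisting of all elements that preserve the two-coloring of the gaps (equivalently, of the components of the Basilica); it has index two in $T_B$, and it is generated by the six elements $\beta,\gamma,\delta,\beta^{\alpha},\gamma^{\alpha},\delta^{\alpha}$. -/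

import Mathlib

noncomputable section

namespace Basilica

/-! ### The Basilica lamination, its gaps and their two-coloring

Angles are points of `UnitAddCircle = ℝ / ℤ`; an arc (leaf) is the unordered pair of its endpoints. -/

/-- The set of arcs of the Basilica lamination:
the pairs `{(6k - 1) / (3 * 2 ^ n), (6k + 1) / (3 * 2 ^ n)}` for `k ∈ ℤ`, `n ≥ 0`. -/
def lamination : Set (Sym2 UnitAddCircle) :=
  {s | ∃ (k : ℤ) (n : ℕ),
    s = s((((6 * k - 1) / (3 * 2 ^ n) : ℝ) : UnitAddCircle),
      (((6 * k + 1) / (3 * 2 ^ n) : ℝ) : UnitAddCircle))}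

/-- The point `exp (2 π i x)` of the unit circle in `ℂ` that corresponds to the angle `x`. -/
def circlePoint (x : UnitAddCircle) : ℂ := (AddCircle.toCircle x : ℂ)

/-- The hyperbolic geodesic (in the projective disk model, i.e. the open chord) in the open unit
disk that joins the two endpoints of an arc. -/
def leaf (s : Sym2 UnitAddCircle) : Set ℂ :=
  Sym2.lift ⟨fun a b => openSegment ℝ (circlePoint a) (circlePoint b),
    fun a b => openSegment_symm ℝ (circlePoint a) (circlePoint b)⟩ s

/-- The open unit disk with all leaves of the Basilica lamination removed. -/
def cutDisk : Set ℂ := Metric.ball 0 1 \ ⋃ s ∈ lamination, leaf s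

/-- A gap of the Basilica lamination is a connected component of the complement of the leaves
in the open unit disk.  The gaps correspond to the components of the Basilica. -/
def Gap : Type := {G : Set ℂ // ∃ z ∈ cutDisk, G = connectedComponentIn cutDisk z}

/-- The boundary of a gap on the circle. -/
def Gap.idealBoundary (G : Gap) : Set UnitAddCircle := {x | circlePoint x ∈ closure G.1}

/-- Two distinct gaps are adjacent if their closures meet along a leaf of the lamination. -/
def gapGraph : SimpleGraph Gap where
  Adj G H := G ≠ H ∧ ∃ s ∈ lamination, leaf s ⊆ closure G.1 ∩ closure H.1
  symm := ⟨fun _ _ h => ⟨h.1.symm, by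
    obtain ⟨s, hs, hl⟩ := h.2
    exact ⟨s, hs, by rwa [Set.inter_comm]⟩⟩⟩
  loopless := ⟨fun _ h => h.1 rfl⟩

/-- The homeomorphism `f` of the circle carries the gap `G` to the gap `H`: it maps the boundary
of `G` on the circle onto that of `H` (so the induced map of the Basilica maps the boundary of the
component of `G` onto the boundary of the component of `H`). -/
def CarriesGap (f : UnitAddCircle ≃ₜ UnitAddCircle) (G H : Gap) : Prop :=
  f '' G.idealBoundary = H.idealBoundary

/-- `f` preserves the coloring `c` of the gaps. -/
def PreservesColoring (f : UnitAddCircle ≃ₜ UnitAddCircle) (c : gapGraph.Coloring Bool) : Prop :=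
  ∀ G H : Gap, CarriesGap f G H → c G = c H

/-! ### Arc diagrams -/

/-- The interval `{left + t * length | 0 ≤ t ≤ 1}` on the circle, traversed counterclockwise. -/
structure Interval where
  left : UnitAddCircle
  length : ℝ

/-- The point of the interval at the fraction `t` of the way from its left endpoint. -/
def Interval.point (I : Interval) (t : ℝ) : UnitAddCircle :=
  I.left + ((t * I.length : ℝ) : UnitAddCircle)

/-- The primary arc of an interval, which subdivides it with ratios `1 : 2 : 1`. -/
def Interval.primaryArc (I : Interval) : Sym2 UnitAddCircle := s(I.point (1 / 4), I.point (3 / 4))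

/-- The three pieces into which the primary arc subdivides an interval. -/
def Interval.children (I : Interval) : Multiset Interval :=
  {⟨I.left, I.length / 4⟩, ⟨I.point (1 / 4), I.length / 2⟩, ⟨I.point (3 / 4), I.length / 4⟩}

/-- A collection of arcs, together with the intervals into which they divide the circle.
(In an arc diagram as defined below all intervals are distinct; a multiset is merely the most
convenient kind of finite collection.) -/
structure Diagram where
  intervals : Multiset Interval
  arcs : Set (Sym2 UnitAddCircle)

/-- The diagram consisting of the two arcs `{1/3, 2/3}` and `{1/6, 5/6}`; the circle is divided
into `[-1/6, 1/6]`, `[1/6, 1/3]`, `[1/3, 2/3]` and `[2/3, 5/6]`. -/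
def Diagram.base : Diagram where
  intervals := {⟨((-1 / 6 : ℝ) : UnitAddCircle), 1 / 3⟩, ⟨((1 / 6 : ℝ) : UnitAddCircle), 1 / 6⟩,
    ⟨((1 / 3 : ℝ) : UnitAddCircle), 1 / 3⟩, ⟨((2 / 3 : ℝ) : UnitAddCircle), 1 / 6⟩}
  arcs := {s(((1 / 3 : ℝ) : UnitAddCircle), ((2 / 3 : ℝ) : UnitAddCircle)),
    s(((1 / 6 : ℝ) : UnitAddCircle), ((5 / 6 : ℝ) : UnitAddCircle))}

/-- Adding to a diagram the primary arc of one of its intervals. -/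
inductive Diagram.Step : Diagram → Diagram → Prop
  | mk (I : Interval) (s : Multiset Interval) (A : Set (Sym2 UnitAddCircle)) :
      Diagram.Step ⟨I ::ₘ s, A⟩ ⟨I.children + s, insert I.primaryArc A⟩

/-- Arc diagrams are obtained from the two basic arcs by adding finitely many primary arcs. -/
def IsArcDiagram (D : Diagram) : Prop := Relation.ReflTransGen Diagram.Step Diagram.base D

/-- `f` maps the interval `I` linearly, preserving the orientation, onto the interval `J`. -/
def MapsLinearly (f : UnitAddCircle → UnitAddCircle) (I J : Interval) : Prop :=
  ∀ t ∈ Set.Icc (0 : ℝ) 1, f (I.point t) = J.point t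

/-- `f` maps the intervals of `D` bijectively and linearly onto the intervals of `R`, and the arcs
of `D` onto the arcs of `R`: the homeomorphism `f` is induced by an isomorphism `D → R`. -/
def IsInducedBy (f : UnitAddCircle ≃ₜ UnitAddCircle) (D R : Diagram) : Prop :=
  Multiset.Rel (MapsLinearly f) D.intervals R.intervals ∧ Sym2.map f '' D.arcs = R.arcs

/-- A dyadic rearrangement of the Basilica: a homeomorphism of the circle that is induced by an
isomorphism between two arc diagrams. -/
def IsDyadicRearrangement (f : UnitAddCircle ≃ₜ UnitAddCircle) : Prop :=
  ∃ D R : Diagram, IsArcDiagram D ∧ IsArcDiagram R ∧ IsInducedBy f D R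

/-! ### The dyadic rearrangements form a group -/

lemma MapsLinearly.symm {f : UnitAddCircle ≃ₜ UnitAddCircle} {I J : Interval}
    (h : MapsLinearly f I J) : MapsLinearly (f⁻¹ : UnitAddCircle ≃ₜ UnitAddCircle) J I := by
  intro t ht
  rw [← h t ht]
  exact f.symm_apply_apply _

lemma IsInducedBy.symm {f : UnitAddCircle ≃ₜ UnitAddCircle} {D R : Diagram}
    (h : IsInducedBy f D R) : IsInducedBy f⁻¹ R D := by
  refine ⟨Multiset.rel_flip.1 (h.1.mono fun I _ J _ hIJ => hIJ.symm), ?_⟩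
  rw [← h.2, Set.image_image]
  conv_rhs => rw [← Set.image_id D.arcs]
  refine Set.image_congr fun s _ => ?_
  rw [Sym2.map_map]
  have : (⇑(f⁻¹ : UnitAddCircle ≃ₜ UnitAddCircle) ∘ ⇑f) = id := by
    funext x
    exact f.symm_apply_apply x
  rw [this, Sym2.map_id]

lemma MapsLinearly.children {f : UnitAddCircle ≃ₜ UnitAddCircle} {I J : Interval}
    (h : MapsLinearly f I J) : Multiset.Rel (MapsLinearly f) I.children J.children := by
  have key : ∀ K : Interval, ∀ a b t : ℝ,
      K.point a + ((t * (K.length * b) : ℝ) : UnitAddCircle) = K.point (a + t * b) := by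
    intro K a b t
    simp only [Interval.point, add_assoc, ← AddCircle.coe_add]
    congr 2
    ring
  have h0 : ∀ K : Interval, K.left = K.point 0 := by
    intro K
    simp [Interval.point]
  have main : ∀ a b : ℝ, 0 ≤ a → 0 ≤ b → a + b ≤ 1 →
      MapsLinearly f ⟨I.point a, I.length * b⟩ ⟨J.point a, J.length * b⟩ := by
    intro a b ha hb hab t ht
    change f (I.point a + _) = J.point a + _
    rw [key, key]
    refine h _ ⟨by nlinarith [mul_nonneg ht.1 hb], by nlinarith [ht.2]⟩
  unfold Interval.children
  refine Multiset.Rel.cons ?_ (Multiset.Rel.cons ?_ (Multiset.Rel.cons ?_ Multiset.Rel.zero))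
  · rw [h0 I, h0 J]
    simpa [div_eq_mul_inv] using main 0 4⁻¹ (by norm_num) (by norm_num) (by norm_num)
  · simpa [div_eq_mul_inv] using main (1 / 4) 2⁻¹ (by norm_num) (by norm_num) (by norm_num)
  · simpa [div_eq_mul_inv] using main (3 / 4) 4⁻¹ (by norm_num) (by norm_num) (by norm_num)

lemma IsInducedBy.step {f : UnitAddCircle ≃ₜ UnitAddCircle} {D R D' : Diagram}
    (h : IsInducedBy f D R) (hD : Diagram.Step D D') :
    ∃ R', Diagram.Step R R' ∧ IsInducedBy f D' R' := by
  obtain ⟨I, s, A⟩ := hD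
  obtain ⟨ri, ra⟩ := R
  obtain ⟨h1, h2⟩ := h
  simp only at h1 h2
  obtain ⟨J, s', hIJ, hs, rfl⟩ := Multiset.rel_cons_left.1 h1
  subst h2
  refine ⟨_, Diagram.Step.mk J s' _, hIJ.children.add hs, ?_⟩
  simp only [Set.image_insert_eq, Interval.primaryArc, Sym2.map_mk]
  rw [hIJ (1 / 4) (by norm_num), hIJ (3 / 4) (by norm_num)]

lemma IsInducedBy.expand {f : UnitAddCircle ≃ₜ UnitAddCircle} {D R D' : Diagram}
    (h : IsInducedBy f D R) (hD : Relation.ReflTransGen Diagram.Step D D') :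
    ∃ R', Relation.ReflTransGen Diagram.Step R R' ∧ IsInducedBy f D' R' := by
  induction hD with
  | refl => exact ⟨R, .refl, h⟩
  | tail _ hs ih =>
    obtain ⟨R1, hR1, h1⟩ := ih
    obtain ⟨R2, hR2, h2⟩ := h1.step hs
    exact ⟨R2, hR1.tail hR2, h2⟩

lemma Diagram.Step.diamond (D D₁ D₂ : Diagram) (h₁ : Diagram.Step D D₁)
    (h₂ : Diagram.Step D D₂) :
    ∃ E, Relation.ReflGen Diagram.Step D₁ E ∧ Relation.ReflTransGen Diagram.Step D₂ E := by
  obtain ⟨I, s, A⟩ := h₁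
  generalize hD : (⟨I ::ₘ s, A⟩ : Diagram) = D at h₂
  obtain ⟨J, t, B⟩ := h₂
  simp only [Diagram.mk.injEq] at hD
  obtain ⟨hst, rfl⟩ := hD
  rcases Multiset.cons_eq_cons.1 hst with ⟨rfl, rfl⟩ | ⟨_, u, rfl, rfl⟩
  · exact ⟨_, .refl, .refl⟩
  · refine ⟨⟨J.children + (I.children + u), insert J.primaryArc (insert I.primaryArc A)⟩,
      .single ?_, .single ?_⟩
    · rw [Multiset.add_cons]
      exact Diagram.Step.mk _ _ _
    · rw [Multiset.add_cons, Set.insert_comm, add_left_comm]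
      exact Diagram.Step.mk _ _ _

lemma IsInducedBy.trans {f g : UnitAddCircle ≃ₜ UnitAddCircle} {D E R : Diagram}
    (hg : IsInducedBy g D E) (hf : IsInducedBy f E R) : IsInducedBy (f * g) D R := by
  refine ⟨?_, ?_⟩
  · have key : ∀ (s t : Multiset Interval), Multiset.Rel (MapsLinearly g) s t →
        ∀ u, Multiset.Rel (MapsLinearly f) t u →
          Multiset.Rel (MapsLinearly (f * g : UnitAddCircle ≃ₜ UnitAddCircle)) s u := by
      intro s t h
      induction h with
      | zero =>
        intro u hu
        rw [Multiset.rel_zero_left] at hu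
        rw [hu]
        exact .zero
      | cons hab _ ih =>
        intro u hu
        obtain ⟨c, u', hbc, hu', rfl⟩ := Multiset.rel_cons_left.1 hu
        refine .cons (fun x hx => ?_) (ih _ hu')
        rw [← hbc x hx, ← hab x hx]
        rfl
    exact key _ _ hg.1 _ hf.1
  · rw [← hf.2, ← hg.2, Set.image_image]
    refine Set.image_congr fun s _ => ?_
    rw [Sym2.map_map]
    rfl

/-- The group `T_B` of all dyadic rearrangements of the Basilica; the product is composition. -/
def TB : Subgroup (UnitAddCircle ≃ₜ UnitAddCircle) where
  carrier := {f | IsDyadicRearrangement f}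
  one_mem' := by
    refine ⟨Diagram.base, Diagram.base, .refl, .refl, ?_, ?_⟩
    · exact Multiset.rel_refl_of_refl_on fun I _ t _ => rfl
    · conv_rhs => rw [← Set.image_id Diagram.base.arcs]
      refine Set.image_congr fun s _ => ?_
      exact congrFun Sym2.map_id s
  mul_mem' := by
    rintro f g ⟨D, R, hD, hR, h⟩ ⟨D', R', hD', hR', h'⟩
    obtain ⟨E, hRE, hDE⟩ := Relation.church_rosser Diagram.Step.diamond hR' hD
    obtain ⟨D₁, hD₁, h₁⟩ := h'.symm.expand hRE
    obtain ⟨R₁, hR₁, h₂⟩ := h.expand hDE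
    have h₃ := h₁.symm
    rw [inv_inv] at h₃
    exact ⟨D₁, R₁, hD'.trans hD₁, hR.trans hR₁, h₃.trans h₂⟩
  inv_mem' := by
    rintro f ⟨D, R, hD, hR, h⟩
    exact ⟨R, D, hR, hD, h.symm⟩

/-! ### The four generators -/

/-- The homeomorphism of `ℝ / ℤ` that fixes `0` and is given on `[0, 1)` by the function `P`,
whose inverse on `[0, 1)` is `Q`. -/
def homeoOfUnit (P Q : ℝ → ℝ) (hP : Continuous P) (hQ : Continuous Q)
    (P0 : P 0 = 0) (P1 : P 1 = 1) (Q0 : Q 0 = 0) (Q1 : Q 1 = 1)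
    (hPm : ∀ x ∈ Set.Ico (0 : ℝ) 1, P x ∈ Set.Ico (0 : ℝ) 1)
    (hQm : ∀ x ∈ Set.Ico (0 : ℝ) 1, Q x ∈ Set.Ico (0 : ℝ) 1)
    (hQP : ∀ x, Q (P x) = x) (hPQ : ∀ x, P (Q x) = x) :
    UnitAddCircle ≃ₜ UnitAddCircle where
  toFun := AddCircle.liftIco 1 0 fun x => ((P x : ℝ) : UnitAddCircle)
  invFun := AddCircle.liftIco 1 0 fun x => ((Q x : ℝ) : UnitAddCircle)
  left_inv x := by
    obtain ⟨y, hy, rfl⟩ := AddCircle.eq_coe_Ico x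
    rw [AddCircle.liftIco_zero_coe_apply hy, AddCircle.liftIco_zero_coe_apply (hPm y hy), hQP]
  right_inv x := by
    obtain ⟨y, hy, rfl⟩ := AddCircle.eq_coe_Ico x
    rw [AddCircle.liftIco_zero_coe_apply hy, AddCircle.liftIco_zero_coe_apply (hQm y hy), hPQ]
  continuous_toFun := by
    refine AddCircle.liftIco_zero_continuous ?_ ?_
    · rw [P0, P1, AddCircle.coe_period 1]
      rfl
    · exact ((AddCircle.continuous_mk' 1).comp hP).continuousOn
  continuous_invFun := by
    refine AddCircle.liftIco_zero_continuous ?_ ?_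
    · rw [Q0, Q1, AddCircle.coe_period 1]
      rfl
    · exact ((AddCircle.continuous_mk' 1).comp hQ).continuousOn

/-- Breakpoints `1/3, 2/3`, which are mapped to `1/6, 5/6`. -/
def alphaFun (x : ℝ) : ℝ :=
  if x ≤ 1 / 3 then x / 2 else if x ≤ 2 / 3 then 2 * x - 1 / 2 else (x + 1) / 2

def alphaInv (x : ℝ) : ℝ :=
  if x ≤ 1 / 6 then 2 * x else if x ≤ 5 / 6 then x / 2 + 1 / 4 else 2 * x - 1

/-- Breakpoints `1/6, 2/3, 17/24, 5/6`, which are mapped to `1/6, 7/24, 1/3, 5/6`. -/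
def betaFun (x : ℝ) : ℝ :=
  if x ≤ 1 / 6 then x else if x ≤ 2 / 3 then x / 4 + 1 / 8 else
    if x ≤ 17 / 24 then x - 3 / 8 else if x ≤ 5 / 6 then 4 * x - 5 / 2 else x

def betaInv (x : ℝ) : ℝ :=
  if x ≤ 1 / 6 then x else if x ≤ 7 / 24 then 4 * x - 1 / 2 else
    if x ≤ 1 / 3 then x + 3 / 8 else if x ≤ 5 / 6 then x / 4 + 5 / 8 else x

/-- Breakpoints `1/6, 7/24, 29/96, 1/3`, which are mapped to `1/6, 19/96, 5/24, 1/3`. -/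
def gammaFun (x : ℝ) : ℝ :=
  if x ≤ 1 / 6 then x else if x ≤ 7 / 24 then x / 4 + 1 / 8 else
    if x ≤ 29 / 96 then x - 3 / 32 else if x ≤ 1 / 3 then 4 * x - 1 else x

def gammaInv (x : ℝ) : ℝ :=
  if x ≤ 1 / 6 then x else if x ≤ 19 / 96 then 4 * x - 1 / 2 else
    if x ≤ 5 / 24 then x + 3 / 32 else if x ≤ 1 / 3 then x / 4 + 1 / 4 else x

lemma continuous_ite_le {f g : ℝ → ℝ} {a : ℝ} (hf : Continuous f) (hg : Continuous g)
    (h : f a = g a) : Continuous fun x => if x ≤ a then f x else g x :=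
  Continuous.if_le hf hg continuous_id continuous_const (by rintro x rfl; exact h)

def alphaHomeo : UnitAddCircle ≃ₜ UnitAddCircle :=
  homeoOfUnit alphaFun alphaInv
    (by
      unfold alphaFun
      exact continuous_ite_le (by fun_prop)
        (continuous_ite_le (by fun_prop) (by fun_prop) (by norm_num)) (by norm_num))
    (by
      unfold alphaInv
      exact continuous_ite_le (by fun_prop)
        (continuous_ite_le (by fun_prop) (by fun_prop) (by norm_num)) (by norm_num))
    (by norm_num [alphaFun]) (by norm_num [alphaFun])
    (by norm_num [alphaInv]) (by norm_num [alphaInv])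
    (by
      rintro x ⟨h0, h1⟩
      unfold alphaFun
      split_ifs <;> constructor <;> linarith)
    (by
      rintro x ⟨h0, h1⟩
      unfold alphaInv
      split_ifs <;> constructor <;> linarith)
    (by intro x; unfold alphaFun alphaInv; split_ifs <;> linarith)
    (by intro x; unfold alphaFun alphaInv; split_ifs <;> linarith)

def betaHomeo : UnitAddCircle ≃ₜ UnitAddCircle :=
  homeoOfUnit betaFun betaInv
    (by
      unfold betaFun
      exact continuous_ite_le (by fun_prop) (continuous_ite_le (by fun_prop)
        (continuous_ite_le (by fun_prop) (continuous_ite_le (by fun_prop) (by fun_prop)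
          (by norm_num)) (by norm_num)) (by norm_num)) (by norm_num))
    (by
      unfold betaInv
      exact continuous_ite_le (by fun_prop) (continuous_ite_le (by fun_prop)
        (continuous_ite_le (by fun_prop) (continuous_ite_le (by fun_prop) (by fun_prop)
          (by norm_num)) (by norm_num)) (by norm_num)) (by norm_num))
    (by norm_num [betaFun]) (by norm_num [betaFun])
    (by norm_num [betaInv]) (by norm_num [betaInv])
    (by
      rintro x ⟨h0, h1⟩
      unfold betaFun
      split_ifs <;> constructor <;> linarith)
    (by
      rintro x ⟨h0, h1⟩
      unfold betaInv
      split_ifs <;> constructor <;> linarith)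
    (by intro x; unfold betaFun betaInv; split_ifs <;> linarith)
    (by intro x; unfold betaFun betaInv; split_ifs <;> linarith)

def gammaHomeo : UnitAddCircle ≃ₜ UnitAddCircle :=
  homeoOfUnit gammaFun gammaInv
    (by
      unfold gammaFun
      exact continuous_ite_le (by fun_prop) (continuous_ite_le (by fun_prop)
        (continuous_ite_le (by fun_prop) (continuous_ite_le (by fun_prop) (by fun_prop)
          (by norm_num)) (by norm_num)) (by norm_num)) (by norm_num))
    (by
      unfold gammaInv
      exact continuous_ite_le (by fun_prop) (continuous_ite_le (by fun_prop)
        (continuous_ite_le (by fun_prop) (continuous_ite_le (by fun_prop) (by fun_prop)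
          (by norm_num)) (by norm_num)) (by norm_num)) (by norm_num))
    (by norm_num [gammaFun]) (by norm_num [gammaFun])
    (by norm_num [gammaInv]) (by norm_num [gammaInv])
    (by
      rintro x ⟨h0, h1⟩
      unfold gammaFun
      split_ifs <;> constructor <;> linarith)
    (by
      rintro x ⟨h0, h1⟩
      unfold gammaInv
      split_ifs <;> constructor <;> linarith)
    (by intro x; unfold gammaFun gammaInv; split_ifs <;> linarith)
    (by intro x; unfold gammaFun gammaInv; split_ifs <;> linarith)

/-- The rotation `x ↦ x + 1/2`. -/
def deltaHomeo : UnitAddCircle ≃ₜ UnitAddCircle :=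
  Homeomorph.addRight ((1 / 2 : ℝ) : UnitAddCircle)

/-! ### The generators are dyadic rearrangements -/

/-- The interval `[a, a + l]`, for a real number `a`. -/
def iv (a l : ℝ) : Interval := ⟨(a : UnitAddCircle), l⟩

lemma iv_point (a l t : ℝ) : (iv a l).point t = ((a + t * l : ℝ) : UnitAddCircle) := by
  simp only [iv, Interval.point, ← AddCircle.coe_add]

lemma coe_sub_one (x y : ℝ) (h : y = x - 1) : (x : UnitAddCircle) = (y : UnitAddCircle) := by
  rw [h, AddCircle.coe_sub, AddCircle.coe_period 1, sub_zero]

lemma step_iv {s A} (a l b c d m e : ℝ) (hb : b = a + l / 4) (hc : c = a + 3 * l / 4)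
    (hd : d = l / 4) (he : e = l / 2) (hm : m = l)
    (h : IsArcDiagram ⟨{iv a m} + s, A⟩) :
    IsArcDiagram ⟨{iv a d} + ({iv b e} + ({iv c d} + s)),
      insert s((b : UnitAddCircle), (c : UnitAddCircle)) A⟩ := by
  subst hb hc hd he hm
  refine Relation.ReflTransGen.tail h ?_
  have := Diagram.Step.mk (iv a m) s A
  have h1 : (iv a m).children + s =
      {iv a (m / 4)} + ({iv (a + m / 4) (m / 2)} + ({iv (a + 3 * m / 4) (m / 4)} + s)) := by
    simp only [Interval.children, iv_point, Multiset.insert_eq_cons, ← Multiset.singleton_add,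
      add_assoc]
    congr 2
    · simp only [iv]; congr 3; ring
    · congr 1; simp only [iv]; congr 3; ring
  have h2 : (iv a m).primaryArc = s(((a + m / 4 : ℝ) : UnitAddCircle),
      ((a + 3 * m / 4 : ℝ) : UnitAddCircle)) := by
    simp only [Interval.primaryArc, iv_point]
    congr 3 <;> ring
  rw [h1, h2] at this
  exact this

/-- The arc with endpoints `a` and `b`. -/
def ar (a b : ℝ) : Sym2 UnitAddCircle := s((a : UnitAddCircle), (b : UnitAddCircle))

lemma isArcDiagram_base : IsArcDiagram ⟨{iv (-1 / 6) (1 / 3)} + ({iv (1 / 6) (1 / 6)} +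
    ({iv (1 / 3) (1 / 3)} + {iv (2 / 3) (1 / 6)})), {ar (1 / 3) (2 / 3), ar (1 / 6) (5 / 6)}⟩ :=
  .refl

lemma isArcDiagram_of_eq {i j A} (h : IsArcDiagram ⟨i, A⟩) (e : i = j) :
    IsArcDiagram ⟨j, A⟩ := e ▸ h

lemma homeoOfUnit_apply (P Q hP hQ P0 P1 Q0 Q1 hPm hQm hQP hPQ) (x : ℝ)
    (hx : x ∈ Set.Icc (0 : ℝ) 1) :
    homeoOfUnit P Q hP hQ P0 P1 Q0 Q1 hPm hQm hQP hPQ (x : UnitAddCircle)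
      = ((P x : ℝ) : UnitAddCircle) := by
  change AddCircle.liftIco 1 0 (fun x => ((P x : ℝ) : UnitAddCircle)) _ = _
  rcases eq_or_lt_of_le hx.2 with h | h
  · subst h
    rw [coe_sub_one 1 0 (by norm_num), AddCircle.liftIco_zero_coe_apply (by norm_num), P0, P1]
    exact (coe_sub_one 1 0 (by norm_num)).symm
  · rw [AddCircle.liftIco_zero_coe_apply ⟨hx.1, h⟩]

lemma mapsLinearly_iv {f : UnitAddCircle → UnitAddCircle} {P : ℝ → ℝ}
    (hf : ∀ x ∈ Set.Icc (0 : ℝ) 1, f (x : UnitAddCircle) = ((P x : ℝ) : UnitAddCircle))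
    {a l b m : ℝ} (ha : 0 ≤ a) (hl : 0 ≤ l) (hal : a + l ≤ 1)
    (h : ∀ t, 0 ≤ t → t ≤ 1 → P (a + t * l) = b + t * m) :
    MapsLinearly f (iv a l) (iv b m) := by
  rintro t ⟨h0, h1⟩
  rw [iv_point, iv_point, hf _ ⟨by positivity, by nlinarith⟩, h t h0 h1]

lemma mapsLinearly_center {f : UnitAddCircle → UnitAddCircle} {P : ℝ → ℝ}
    (hf : ∀ x ∈ Set.Icc (0 : ℝ) 1, f (x : UnitAddCircle) = ((P x : ℝ) : UnitAddCircle))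
    {b m k : ℝ} (h : ∀ x, 0 ≤ x → x ≤ 1 / 6 → P x = k * x)
    (h' : ∀ x, 5 / 6 ≤ x → x ≤ 1 → P x = k * (x - 1) + 1) (hb : b = -k / 6) (hm : m = k / 3) :
    MapsLinearly f (iv (-1 / 6) (1 / 3)) (iv b m) := by
  subst hb hm
  rintro t ⟨h0, h1⟩
  rw [iv_point, iv_point]
  rcases le_total t (1 / 2) with ht | ht
  · rw [← coe_sub_one (-1 / 6 + t * (1 / 3) + 1) _ (by ring), hf _ ⟨by linarith, by linarith⟩,
      h' _ (by linarith) (by linarith)]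
    exact coe_sub_one _ _ (by ring)
  · rw [hf _ ⟨by linarith, by linarith⟩, h _ (by linarith) (by linarith)]
    congr 1
    ring

lemma rel_single {f : UnitAddCircle → UnitAddCircle} {I J : Interval} (h : MapsLinearly f I J) :
    Multiset.Rel (MapsLinearly f) {I} {J} := .cons h .zero

lemma alpha_apply : ∀ x ∈ Set.Icc (0 : ℝ) 1, alphaHomeo (x : UnitAddCircle)
    = ((alphaFun x : ℝ) : UnitAddCircle) :=
  fun x hx => homeoOfUnit_apply _ _ _ _ _ _ _ _ _ _ _ _ x hx

lemma beta_apply : ∀ x ∈ Set.Icc (0 : ℝ) 1, betaHomeo (x : UnitAddCircle)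
    = ((betaFun x : ℝ) : UnitAddCircle) :=
  fun x hx => homeoOfUnit_apply _ _ _ _ _ _ _ _ _ _ _ _ x hx

lemma gamma_apply : ∀ x ∈ Set.Icc (0 : ℝ) 1, gammaHomeo (x : UnitAddCircle)
    = ((gammaFun x : ℝ) : UnitAddCircle) :=
  fun x hx => homeoOfUnit_apply _ _ _ _ _ _ _ _ _ _ _ _ x hx

lemma isArcDiagram_left : IsArcDiagram ⟨{iv (1 / 3) (1 / 12)} + ({iv (5 / 12) (1 / 6)} + ({iv (7 / 12) (1 / 12)} + ({iv (-1 / 6) (1 / 3)} + ({iv (1 / 6) (1 / 6)} + {iv (2 / 3) (1 / 6)})))),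
    {ar (5 / 12) (7 / 12), ar (1 / 3) (2 / 3), ar (1 / 6) (5 / 6)}⟩ :=
  step_iv (1 / 3) (1 / 3) (5 / 12) (7 / 12) (1 / 12) (1 / 3) (1 / 6) (by norm_num) (by norm_num)
    (by norm_num) (by norm_num) rfl (isArcDiagram_of_eq isArcDiagram_base (by abel))

lemma isArcDiagram_center : IsArcDiagram ⟨{iv (-1 / 6) (1 / 12)} + ({iv (-1 / 12) (1 / 6)} + ({iv (1 / 12) (1 / 12)} + ({iv (1 / 6) (1 / 6)} + ({iv (1 / 3) (1 / 3)} + {iv (2 / 3) (1 / 6)})))),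
    {ar (-1 / 12) (1 / 12), ar (1 / 3) (2 / 3), ar (1 / 6) (5 / 6)}⟩ :=
  step_iv (-1 / 6) (1 / 3) (-1 / 12) (1 / 12) (1 / 12) (1 / 3) (1 / 6) (by norm_num) (by norm_num)
    (by norm_num) (by norm_num) rfl (isArcDiagram_of_eq isArcDiagram_base (by abel))

lemma isArcDiagram_bottom : IsArcDiagram ⟨{iv (2 / 3) (1 / 24)} + ({iv (17 / 24) (1 / 12)} + ({iv (19 / 24) (1 / 24)} + ({iv (-1 / 6) (1 / 3)} + ({iv (1 / 6) (1 / 6)} + {iv (1 / 3) (1 / 3)})))),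
    {ar (17 / 24) (19 / 24), ar (1 / 3) (2 / 3), ar (1 / 6) (5 / 6)}⟩ :=
  step_iv (2 / 3) (1 / 6) (17 / 24) (19 / 24) (1 / 24) (1 / 6) (1 / 12) (by norm_num) (by norm_num)
    (by norm_num) (by norm_num) rfl (isArcDiagram_of_eq isArcDiagram_base (by abel))

lemma isArcDiagram_top : IsArcDiagram ⟨{iv (1 / 6) (1 / 24)} + ({iv (5 / 24) (1 / 12)} + ({iv (7 / 24) (1 / 24)} + ({iv (-1 / 6) (1 / 3)} + ({iv (1 / 3) (1 / 3)} + {iv (2 / 3) (1 / 6)})))),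
    {ar (5 / 24) (7 / 24), ar (1 / 3) (2 / 3), ar (1 / 6) (5 / 6)}⟩ :=
  step_iv (1 / 6) (1 / 6) (5 / 24) (7 / 24) (1 / 24) (1 / 6) (1 / 12) (by norm_num) (by norm_num)
    (by norm_num) (by norm_num) rfl (isArcDiagram_of_eq isArcDiagram_base (by abel))

lemma isArcDiagram_top_last : IsArcDiagram ⟨{iv (7 / 24) (1 / 96)} + ({iv (29 / 96) (1 / 48)} + ({iv (31 / 96) (1 / 96)} + ({iv (1 / 6) (1 / 24)} + ({iv (5 / 24) (1 / 12)} + ({iv (-1 / 6) (1 / 3)} + ({iv (1 / 3) (1 / 3)} + {iv (2 / 3) (1 / 6)})))))),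
    {ar (29 / 96) (31 / 96), ar (5 / 24) (7 / 24), ar (1 / 3) (2 / 3), ar (1 / 6) (5 / 6)}⟩ :=
  step_iv (7 / 24) (1 / 24) (29 / 96) (31 / 96) (1 / 96) (1 / 24) (1 / 48) (by norm_num) (by norm_num)
    (by norm_num) (by norm_num) rfl (isArcDiagram_of_eq isArcDiagram_top (by abel))

lemma isArcDiagram_top_first : IsArcDiagram ⟨{iv (1 / 6) (1 / 96)} + ({iv (17 / 96) (1 / 48)} + ({iv (19 / 96) (1 / 96)} + ({iv (5 / 24) (1 / 12)} + ({iv (7 / 24) (1 / 24)} + ({iv (-1 / 6) (1 / 3)} + ({iv (1 / 3) (1 / 3)} + {iv (2 / 3) (1 / 6)})))))),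
    {ar (17 / 96) (19 / 96), ar (5 / 24) (7 / 24), ar (1 / 3) (2 / 3), ar (1 / 6) (5 / 6)}⟩ :=
  step_iv (1 / 6) (1 / 24) (17 / 96) (19 / 96) (1 / 96) (1 / 24) (1 / 48) (by norm_num) (by norm_num)
    (by norm_num) (by norm_num) rfl (isArcDiagram_of_eq isArcDiagram_top (by abel))

lemma alpha_aux (x : ℝ) (_h0 : 0 ≤ x) (h1 : x ≤ 1 / 6) : alphaFun x = (1 / 2) * x := by
  unfold alphaFun
  split_ifs <;> linarith

lemma alpha_aux' (x : ℝ) (h0 : 5 / 6 ≤ x) (_h1 : x ≤ 1) : alphaFun x = (1 / 2) * (x - 1) + 1 := by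
  unfold alphaFun
  split_ifs <;> linarith

lemma alpha_mem : alphaHomeo ∈ TB := by
  refine ⟨_, _, isArcDiagram_left, isArcDiagram_center, ?_, ?_⟩
  · have h : Multiset.Rel (MapsLinearly alphaHomeo) ({iv (1 / 3) (1 / 12)} + ({iv (5 / 12) (1 / 6)} + ({iv (7 / 12) (1 / 12)} + ({iv (-1 / 6) (1 / 3)} + ({iv (1 / 6) (1 / 6)} + {iv (2 / 3) (1 / 6)})))))
        ({iv (1 / 6) (1 / 6)} + ({iv (1 / 3) (1 / 3)} + ({iv (2 / 3) (1 / 6)} + ({iv (-1 / 12) (1 / 6)} + ({iv (1 / 12) (1 / 12)} + {iv (5 / 6) (1 / 12)}))))) :=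
      .add (rel_single (mapsLinearly_iv alpha_apply (by norm_num) (by norm_num) (by norm_num) (by
          intro t h0 h1; unfold alphaFun; split_ifs <;> linarith)))
        (.add (rel_single (mapsLinearly_iv alpha_apply (by norm_num) (by norm_num) (by norm_num) (by
          intro t h0 h1; unfold alphaFun; split_ifs <;> linarith)))
        (.add (rel_single (mapsLinearly_iv alpha_apply (by norm_num) (by norm_num) (by norm_num) (by
          intro t h0 h1; unfold alphaFun; split_ifs <;> linarith)))
        (.add (rel_single (mapsLinearly_center (k := (1 / 2)) alpha_apply alpha_aux alpha_aux' (by norm_num) (by norm_num)))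
        (.add (rel_single (mapsLinearly_iv alpha_apply (by norm_num) (by norm_num) (by norm_num) (by
          intro t h0 h1; unfold alphaFun; split_ifs <;> linarith)))
        ((rel_single (mapsLinearly_iv alpha_apply (by norm_num) (by norm_num) (by norm_num) (by
          intro t h0 h1; unfold alphaFun; split_ifs <;> linarith))))))))
    have h0 : iv (5 / 6) (1 / 12) = iv (-1 / 6) (1 / 12) := by
      simp only [iv]
      rw [coe_sub_one (5 / 6) (-1 / 6) (by norm_num)]
    have e : ({iv (1 / 6) (1 / 6)} + ({iv (1 / 3) (1 / 3)} + ({iv (2 / 3) (1 / 6)} + ({iv (-1 / 12) (1 / 6)} + ({iv (1 / 12) (1 / 12)} + {iv (5 / 6) (1 / 12)})))) : Multiset Interval) =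
        {iv (-1 / 6) (1 / 12)} + ({iv (-1 / 12) (1 / 6)} + ({iv (1 / 12) (1 / 12)} + ({iv (1 / 6) (1 / 6)} + ({iv (1 / 3) (1 / 3)} + {iv (2 / 3) (1 / 6)})))) := by
      rw [h0]; abel
    rw [e] at h
    exact h
  · simp only [Set.image_insert_eq, Set.image_singleton]
    have e0 : Sym2.map alphaHomeo (ar (5 / 12) (7 / 12)) = ar (1 / 3) (2 / 3) := by
      rw [ar, Sym2.map_mk, alpha_apply _ (by norm_num), alpha_apply _ (by norm_num),
        show alphaFun (5 / 12) = (1 / 3) by norm_num [alphaFun],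
        show alphaFun (7 / 12) = (2 / 3) by norm_num [alphaFun], ar]
    have e1 : Sym2.map alphaHomeo (ar (1 / 3) (2 / 3)) = ar (1 / 6) (5 / 6) := by
      rw [ar, Sym2.map_mk, alpha_apply _ (by norm_num), alpha_apply _ (by norm_num),
        show alphaFun (1 / 3) = (1 / 6) by norm_num [alphaFun],
        show alphaFun (2 / 3) = (5 / 6) by norm_num [alphaFun], ar]
    have e2 : Sym2.map alphaHomeo (ar (1 / 6) (5 / 6)) = ar (-1 / 12) (1 / 12) := by
      rw [ar, Sym2.map_mk, alpha_apply _ (by norm_num), alpha_apply _ (by norm_num),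
        show alphaFun (1 / 6) = (1 / 12) by norm_num [alphaFun],
        show alphaFun (5 / 6) = (11 / 12) by norm_num [alphaFun], Sym2.eq_swap,
        coe_sub_one (11 / 12) (-1 / 12) (by norm_num), ar]
    rw [e0, e1, e2]
    ext x
    simp only [Set.mem_insert_iff, Set.mem_singleton_iff]
    tauto

lemma beta_aux (x : ℝ) (_h0 : 0 ≤ x) (h1 : x ≤ 1 / 6) : betaFun x = (1 / 1) * x := by
  unfold betaFun
  split_ifs <;> linarith

lemma beta_aux' (x : ℝ) (h0 : 5 / 6 ≤ x) (_h1 : x ≤ 1) : betaFun x = (1 / 1) * (x - 1) + 1 := by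
  unfold betaFun
  split_ifs <;> linarith

lemma beta_mem : betaHomeo ∈ TB := by
  refine ⟨_, _, isArcDiagram_bottom, isArcDiagram_top, ?_, ?_⟩
  · have h : Multiset.Rel (MapsLinearly betaHomeo) ({iv (2 / 3) (1 / 24)} + ({iv (17 / 24) (1 / 12)} + ({iv (19 / 24) (1 / 24)} + ({iv (-1 / 6) (1 / 3)} + ({iv (1 / 6) (1 / 6)} + {iv (1 / 3) (1 / 3)})))))
        ({iv (7 / 24) (1 / 24)} + ({iv (1 / 3) (1 / 3)} + ({iv (2 / 3) (1 / 6)} + ({iv (-1 / 6) (1 / 3)} + ({iv (1 / 6) (1 / 24)} + {iv (5 / 24) (1 / 12)}))))) :=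
      .add (rel_single (mapsLinearly_iv beta_apply (by norm_num) (by norm_num) (by norm_num) (by
          intro t h0 h1; unfold betaFun; split_ifs <;> linarith)))
        (.add (rel_single (mapsLinearly_iv beta_apply (by norm_num) (by norm_num) (by norm_num) (by
          intro t h0 h1; unfold betaFun; split_ifs <;> linarith)))
        (.add (rel_single (mapsLinearly_iv beta_apply (by norm_num) (by norm_num) (by norm_num) (by
          intro t h0 h1; unfold betaFun; split_ifs <;> linarith)))
        (.add (rel_single (mapsLinearly_center (k := (1 / 1)) beta_apply beta_aux beta_aux' (by norm_num) (by norm_num)))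
        (.add (rel_single (mapsLinearly_iv beta_apply (by norm_num) (by norm_num) (by norm_num) (by
          intro t h0 h1; unfold betaFun; split_ifs <;> linarith)))
        ((rel_single (mapsLinearly_iv beta_apply (by norm_num) (by norm_num) (by norm_num) (by
          intro t h0 h1; unfold betaFun; split_ifs <;> linarith))))))))
    have e : ({iv (7 / 24) (1 / 24)} + ({iv (1 / 3) (1 / 3)} + ({iv (2 / 3) (1 / 6)} + ({iv (-1 / 6) (1 / 3)} + ({iv (1 / 6) (1 / 24)} + {iv (5 / 24) (1 / 12)})))) : Multiset Interval) =
        {iv (1 / 6) (1 / 24)} + ({iv (5 / 24) (1 / 12)} + ({iv (7 / 24) (1 / 24)} + ({iv (-1 / 6) (1 / 3)} + ({iv (1 / 3) (1 / 3)} + {iv (2 / 3) (1 / 6)})))) := by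
      abel
    rw [e] at h
    exact h
  · simp only [Set.image_insert_eq, Set.image_singleton]
    have e0 : Sym2.map betaHomeo (ar (17 / 24) (19 / 24)) = ar (1 / 3) (2 / 3) := by
      rw [ar, Sym2.map_mk, beta_apply _ (by norm_num), beta_apply _ (by norm_num),
        show betaFun (17 / 24) = (1 / 3) by norm_num [betaFun],
        show betaFun (19 / 24) = (2 / 3) by norm_num [betaFun], ar]
    have e1 : Sym2.map betaHomeo (ar (1 / 3) (2 / 3)) = ar (5 / 24) (7 / 24) := by
      rw [ar, Sym2.map_mk, beta_apply _ (by norm_num), beta_apply _ (by norm_num),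
        show betaFun (1 / 3) = (5 / 24) by norm_num [betaFun],
        show betaFun (2 / 3) = (7 / 24) by norm_num [betaFun], ar]
    have e2 : Sym2.map betaHomeo (ar (1 / 6) (5 / 6)) = ar (1 / 6) (5 / 6) := by
      rw [ar, Sym2.map_mk, beta_apply _ (by norm_num), beta_apply _ (by norm_num),
        show betaFun (1 / 6) = (1 / 6) by norm_num [betaFun],
        show betaFun (5 / 6) = (5 / 6) by norm_num [betaFun]]
    rw [e0, e1, e2]
    ext x
    simp only [Set.mem_insert_iff, Set.mem_singleton_iff]
    tauto

lemma gamma_aux (x : ℝ) (_h0 : 0 ≤ x) (h1 : x ≤ 1 / 6) : gammaFun x = (1 / 1) * x := by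
  unfold gammaFun
  split_ifs <;> linarith

lemma gamma_aux' (x : ℝ) (h0 : 5 / 6 ≤ x) (_h1 : x ≤ 1) : gammaFun x = (1 / 1) * (x - 1) + 1 := by
  unfold gammaFun
  split_ifs <;> linarith

lemma gamma_mem : gammaHomeo ∈ TB := by
  refine ⟨_, _, isArcDiagram_top_last, isArcDiagram_top_first, ?_, ?_⟩
  · have h : Multiset.Rel (MapsLinearly gammaHomeo) ({iv (7 / 24) (1 / 96)} + ({iv (29 / 96) (1 / 48)} + ({iv (31 / 96) (1 / 96)} + ({iv (1 / 6) (1 / 24)} + ({iv (5 / 24) (1 / 12)} + ({iv (-1 / 6) (1 / 3)} + ({iv (1 / 3) (1 / 3)} + {iv (2 / 3) (1 / 6)})))))))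
        ({iv (19 / 96) (1 / 96)} + ({iv (5 / 24) (1 / 12)} + ({iv (7 / 24) (1 / 24)} + ({iv (1 / 6) (1 / 96)} + ({iv (17 / 96) (1 / 48)} + ({iv (-1 / 6) (1 / 3)} + ({iv (1 / 3) (1 / 3)} + {iv (2 / 3) (1 / 6)}))))))) :=
      .add (rel_single (mapsLinearly_iv gamma_apply (by norm_num) (by norm_num) (by norm_num) (by
          intro t h0 h1; unfold gammaFun; split_ifs <;> linarith)))
        (.add (rel_single (mapsLinearly_iv gamma_apply (by norm_num) (by norm_num) (by norm_num) (by
          intro t h0 h1; unfold gammaFun; split_ifs <;> linarith)))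
        (.add (rel_single (mapsLinearly_iv gamma_apply (by norm_num) (by norm_num) (by norm_num) (by
          intro t h0 h1; unfold gammaFun; split_ifs <;> linarith)))
        (.add (rel_single (mapsLinearly_iv gamma_apply (by norm_num) (by norm_num) (by norm_num) (by
          intro t h0 h1; unfold gammaFun; split_ifs <;> linarith)))
        (.add (rel_single (mapsLinearly_iv gamma_apply (by norm_num) (by norm_num) (by norm_num) (by
          intro t h0 h1; unfold gammaFun; split_ifs <;> linarith)))
        (.add (rel_single (mapsLinearly_center (k := (1 / 1)) gamma_apply gamma_aux gamma_aux' (by norm_num) (by norm_num)))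
        (.add (rel_single (mapsLinearly_iv gamma_apply (by norm_num) (by norm_num) (by norm_num) (by
          intro t h0 h1; unfold gammaFun; split_ifs <;> linarith)))
        ((rel_single (mapsLinearly_iv gamma_apply (by norm_num) (by norm_num) (by norm_num) (by
          intro t h0 h1; unfold gammaFun; split_ifs <;> linarith))))))))))
    have e : ({iv (19 / 96) (1 / 96)} + ({iv (5 / 24) (1 / 12)} + ({iv (7 / 24) (1 / 24)} + ({iv (1 / 6) (1 / 96)} + ({iv (17 / 96) (1 / 48)} + ({iv (-1 / 6) (1 / 3)} + ({iv (1 / 3) (1 / 3)} + {iv (2 / 3) (1 / 6)})))))) : Multiset Interval) =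
        {iv (1 / 6) (1 / 96)} + ({iv (17 / 96) (1 / 48)} + ({iv (19 / 96) (1 / 96)} + ({iv (5 / 24) (1 / 12)} + ({iv (7 / 24) (1 / 24)} + ({iv (-1 / 6) (1 / 3)} + ({iv (1 / 3) (1 / 3)} + {iv (2 / 3) (1 / 6)})))))) := by
      abel
    rw [e] at h
    exact h
  · simp only [Set.image_insert_eq, Set.image_singleton]
    have e0 : Sym2.map gammaHomeo (ar (29 / 96) (31 / 96)) = ar (5 / 24) (7 / 24) := by
      rw [ar, Sym2.map_mk, gamma_apply _ (by norm_num), gamma_apply _ (by norm_num),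
        show gammaFun (29 / 96) = (5 / 24) by norm_num [gammaFun],
        show gammaFun (31 / 96) = (7 / 24) by norm_num [gammaFun], ar]
    have e1 : Sym2.map gammaHomeo (ar (5 / 24) (7 / 24)) = ar (17 / 96) (19 / 96) := by
      rw [ar, Sym2.map_mk, gamma_apply _ (by norm_num), gamma_apply _ (by norm_num),
        show gammaFun (5 / 24) = (17 / 96) by norm_num [gammaFun],
        show gammaFun (7 / 24) = (19 / 96) by norm_num [gammaFun], ar]
    have e2 : Sym2.map gammaHomeo (ar (1 / 3) (2 / 3)) = ar (1 / 3) (2 / 3) := by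
      rw [ar, Sym2.map_mk, gamma_apply _ (by norm_num), gamma_apply _ (by norm_num),
        show gammaFun (1 / 3) = (1 / 3) by norm_num [gammaFun],
        show gammaFun (2 / 3) = (2 / 3) by norm_num [gammaFun]]
    have e3 : Sym2.map gammaHomeo (ar (1 / 6) (5 / 6)) = ar (1 / 6) (5 / 6) := by
      rw [ar, Sym2.map_mk, gamma_apply _ (by norm_num), gamma_apply _ (by norm_num),
        show gammaFun (1 / 6) = (1 / 6) by norm_num [gammaFun],
        show gammaFun (5 / 6) = (5 / 6) by norm_num [gammaFun]]
    rw [e0, e1, e2, e3]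
    ext x
    simp only [Set.mem_insert_iff, Set.mem_singleton_iff]
    tauto

lemma mapsLinearly_delta {a b l : ℝ} (h : b = a + 1 / 2) :
    MapsLinearly deltaHomeo (iv a l) (iv b l) := by
  subst h
  intro t _
  rw [iv_point, iv_point]
  change ((a + t * l : ℝ) : UnitAddCircle) + ((1 / 2 : ℝ) : UnitAddCircle) = _
  rw [← AddCircle.coe_add]
  congr 1
  ring

lemma delta_mem : deltaHomeo ∈ TB := by
  refine ⟨_, _, isArcDiagram_base, isArcDiagram_base, ?_, ?_⟩
  · have h : Multiset.Rel (MapsLinearly deltaHomeo)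
        ({iv (-1 / 6) (1 / 3)} + ({iv (1 / 6) (1 / 6)} +
          ({iv (1 / 3) (1 / 3)} + {iv (2 / 3) (1 / 6)})))
        ({iv (1 / 3) (1 / 3)} + ({iv (2 / 3) (1 / 6)} +
          ({iv (5 / 6) (1 / 3)} + {iv (7 / 6) (1 / 6)}))) :=
      .add (rel_single (mapsLinearly_delta (by norm_num)))
        (.add (rel_single (mapsLinearly_delta (by norm_num)))
        (.add (rel_single (mapsLinearly_delta (by norm_num)))
        (rel_single (mapsLinearly_delta (by norm_num)))))
    have h1 : iv (5 / 6) (1 / 3) = iv (-1 / 6) (1 / 3) := by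
      simp only [iv]
      rw [coe_sub_one (5 / 6) (-1 / 6) (by norm_num)]
    have h2 : iv (7 / 6) (1 / 6) = iv (1 / 6) (1 / 6) := by
      simp only [iv]
      rw [coe_sub_one (7 / 6) (1 / 6) (by norm_num)]
    have e : ({iv (1 / 3) (1 / 3)} + ({iv (2 / 3) (1 / 6)} +
          ({iv (5 / 6) (1 / 3)} + {iv (7 / 6) (1 / 6)})) : Multiset Interval) =
        {iv (-1 / 6) (1 / 3)} + ({iv (1 / 6) (1 / 6)} +
          ({iv (1 / 3) (1 / 3)} + {iv (2 / 3) (1 / 6)})) := by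
      rw [h1, h2]; abel
    rw [e] at h
    exact h
  · simp only [Set.image_insert_eq, Set.image_singleton]
    have key : ∀ a b c d : ℝ, c = a + 1 / 2 → d = b + 1 / 2 →
        Sym2.map deltaHomeo (ar a b) = ar c d := by
      rintro a b _ _ rfl rfl
      simp only [ar, AddCircle.coe_add]
      rfl
    rw [key _ _ (5 / 6) (7 / 6) (by norm_num) (by norm_num),
      key _ _ (2 / 3) (4 / 3) (by norm_num) (by norm_num)]
    have e1 : ar (5 / 6) (7 / 6) = ar (1 / 6) (5 / 6) := by
      rw [ar, coe_sub_one (7 / 6) (1 / 6) (by norm_num), Sym2.eq_swap, ar]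
    have e2 : ar (2 / 3) (4 / 3) = ar (1 / 3) (2 / 3) := by
      rw [ar, coe_sub_one (4 / 3) (1 / 3) (by norm_num), Sym2.eq_swap, ar]
    rw [e1, e2, Set.pair_comm]

/-- The generator `α`, with breakpoints `1/3, 2/3 ↦ 1/6, 5/6`. -/
def α : TB := ⟨alphaHomeo, alpha_mem⟩

/-- The generator `β`, with breakpoints `1/6, 2/3, 17/24, 5/6 ↦ 1/6, 7/24, 1/3, 5/6`. -/
def β : TB := ⟨betaHomeo, beta_mem⟩

/-- The generator `γ`, with breakpoints `1/6, 7/24, 29/96, 1/3 ↦ 1/6, 19/96, 5/24, 1/3`. -/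
def γ : TB := ⟨gammaHomeo, gamma_mem⟩

/-- The generator `δ`, the rotation `x ↦ x + 1/2`. -/
def δ : TB := ⟨deltaHomeo, delta_mem⟩

end Basilica

end

noncomputable section

namespace Basilica

open Set

/-! ### Intervals and their children -/

/-- The left child of an interval. -/
def Interval.lft (I : Interval) : Interval := ⟨I.left, I.length / 4⟩

/-- The middle child of an interval. -/
def Interval.mid (I : Interval) : Interval := ⟨I.point (1 / 4), I.length / 2⟩

/-- The right child of an interval. -/
def Interval.rgt (I : Interval) : Interval := ⟨I.point (3 / 4), I.length / 4⟩

lemma Interval.children_eq (I : Interval) : I.children = I.lft ::ₘ I.mid ::ₘ {I.rgt} := rfl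

lemma Interval.point_zero (I : Interval) : I.point 0 = I.left := by simp [Interval.point]

lemma Interval.lft_point (I : Interval) (t : ℝ) : I.lft.point t = I.point (t / 4) := by
  simp only [Interval.lft, Interval.point]
  congr 2
  ring

lemma Interval.mid_point (I : Interval) (t : ℝ) : I.mid.point t = I.point (1 / 4 + t / 2) := by
  simp only [Interval.mid, Interval.point, add_assoc, ← AddCircle.coe_add]
  congr 2
  ring

lemma Interval.rgt_point (I : Interval) (t : ℝ) : I.rgt.point t = I.point (3 / 4 + t / 4) := by
  simp only [Interval.rgt, Interval.point, add_assoc, ← AddCircle.coe_add]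
  congr 2
  ring

lemma MapsLinearly.lft {f : UnitAddCircle → UnitAddCircle} {I J : Interval}
    (h : MapsLinearly f I J) : MapsLinearly f I.lft J.lft := by
  rintro t ⟨h0, h1⟩
  rw [Interval.lft_point, Interval.lft_point]
  exact h _ ⟨by linarith, by linarith⟩

lemma MapsLinearly.mid {f : UnitAddCircle → UnitAddCircle} {I J : Interval}
    (h : MapsLinearly f I J) : MapsLinearly f I.mid J.mid := by
  rintro t ⟨h0, h1⟩
  rw [Interval.mid_point, Interval.mid_point]
  exact h _ ⟨by linarith, by linarith⟩

lemma MapsLinearly.rgt {f : UnitAddCircle → UnitAddCircle} {I J : Interval}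
    (h : MapsLinearly f I J) : MapsLinearly f I.rgt J.rgt := by
  rintro t ⟨h0, h1⟩
  rw [Interval.rgt_point, Interval.rgt_point]
  exact h _ ⟨by linarith, by linarith⟩

/-- A point of an interval lies in one of its children. -/
lemma unit_cases {p : ℝ → Prop} (hl : ∀ t ∈ Icc (0 : ℝ) 1, p (t / 4))
    (hm : ∀ t ∈ Icc (0 : ℝ) 1, p (1 / 4 + t / 2)) (hr : ∀ t ∈ Icc (0 : ℝ) 1, p (3 / 4 + t / 4)) :
    ∀ t ∈ Icc (0 : ℝ) 1, p t := by
  rintro t ⟨h0, h1⟩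
  rcases le_total t (1 / 4) with h | h
  · have := hl (4 * t) ⟨by linarith, by linarith⟩
    rwa [show 4 * t / 4 = t by ring] at this
  rcases le_total t (3 / 4) with h' | h'
  · have := hm (2 * t - 1 / 2) ⟨by linarith, by linarith⟩
    rwa [show 1 / 4 + (2 * t - 1 / 2) / 2 = t by ring] at this
  · have := hr (4 * t - 3) ⟨by linarith, by linarith⟩
    rwa [show 3 / 4 + (4 * t - 3) / 4 = t by ring] at this

lemma MapsLinearly.glue {f : UnitAddCircle → UnitAddCircle} {I J : Interval}
    (hl : MapsLinearly f I.lft J.lft) (hm : MapsLinearly f I.mid J.mid)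
    (hr : MapsLinearly f I.rgt J.rgt) : MapsLinearly f I J := by
  refine unit_cases (fun t ht => ?_) (fun t ht => ?_) (fun t ht => ?_)
  · simpa only [Interval.lft_point] using hl t ht
  · simpa only [Interval.mid_point] using hm t ht
  · simpa only [Interval.rgt_point] using hr t ht

lemma MapsLinearly.comp {f g : UnitAddCircle ≃ₜ UnitAddCircle} {I J K : Interval}
    (hf : MapsLinearly f J K) (hg : MapsLinearly g I J) :
    MapsLinearly (f * g : UnitAddCircle ≃ₜ UnitAddCircle) I K := by
  intro t ht
  rw [← hf t ht, ← hg t ht]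
  rfl

lemma coe_inj {x y : ℝ} (h : (x : UnitAddCircle) = y) (h1 : |x - y| < 1) : x = y := by
  rw [← sub_eq_zero, ← AddCircle.coe_sub, AddCircle.coe_eq_zero_iff] at h
  obtain ⟨n, hn⟩ := h
  simp only [zsmul_eq_mul, mul_one] at hn
  rw [← hn] at h1
  have h2 : |n| < 1 := by exact_mod_cast h1
  rw [Int.abs_lt_one_iff.1 h2] at hn
  push_cast at hn
  linarith

lemma coe_eq_coe_iff {x y : ℝ} : (x : UnitAddCircle) = y ↔ ∃ n : ℤ, x = y + n := by
  rw [← sub_eq_zero, ← AddCircle.coe_sub, AddCircle.coe_eq_zero_iff]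
  refine exists_congr fun n => ?_
  simp only [zsmul_eq_mul, mul_one]
  constructor <;> intro h <;> linarith

lemma Interval.point_inj {I : Interval} (h0 : 0 < I.length) (h1 : I.length < 1) {s t : ℝ}
    (hs : s ∈ Icc (0 : ℝ) 1) (ht : t ∈ Icc (0 : ℝ) 1) (h : I.point s = I.point t) : s = t := by
  simp only [Interval.point, add_right_inj] at h
  have := coe_inj h (by
    rw [← sub_mul, abs_mul, abs_of_pos h0]
    have : |s - t| ≤ 1 := by rw [abs_le]; constructor <;> linarith [hs.1, hs.2, ht.1, ht.2]
    nlinarith)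
  exact mul_right_cancel₀ h0.ne' this

/-! ### Standard intervals -/

/-- The interval `[-1/6, 1/6]`. -/
def O₀ : Interval := iv (-1 / 6) (1 / 3)

/-- The interval `[1/6, 1/3]`. -/
def S₀ : Interval := iv (1 / 6) (1 / 6)

/-- The interval `[1/3, 2/3]`. -/
def O₁ : Interval := iv (1 / 3) (1 / 3)

/-- The interval `[2/3, 5/6]`. -/
def S₁ : Interval := iv (2 / 3) (1 / 6)

lemma base_intervals : Diagram.base.intervals = O₀ ::ₘ S₀ ::ₘ O₁ ::ₘ {S₁} := rfl

/-- The standard intervals are those that can occur in an arc diagram. -/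
inductive Std : Interval → Prop
  | o₀ : Std O₀
  | s₀ : Std S₀
  | o₁ : Std O₁
  | s₁ : Std S₁
  | lft {I} : Std I → Std I.lft
  | mid {I} : Std I → Std I.mid
  | rgt {I} : Std I → Std I.rgt

lemma Std.length_pos {I : Interval} (h : Std I) : 0 < I.length := by
  induction h with
  | o₀ => norm_num [O₀, iv]
  | s₀ => norm_num [S₀, iv]
  | o₁ => norm_num [O₁, iv]
  | s₁ => norm_num [S₁, iv]
  | lft _ ih => exact div_pos ih (by norm_num)
  | mid _ ih => exact div_pos ih (by norm_num)
  | rgt _ ih => exact div_pos ih (by norm_num)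

lemma Std.length_lt_one {I : Interval} (h : Std I) : I.length < 1 := by
  induction h with
  | o₀ => norm_num [O₀, iv]
  | s₀ => norm_num [S₀, iv]
  | o₁ => norm_num [O₁, iv]
  | s₁ => norm_num [S₁, iv]
  | lft h ih => exact lt_trans (div_lt_self h.length_pos (by norm_num)) ih
  | mid h ih => exact lt_trans (div_lt_self h.length_pos (by norm_num)) ih
  | rgt h ih => exact lt_trans (div_lt_self h.length_pos (by norm_num)) ih

lemma Std.point_inj {I : Interval} (h : Std I) {s t : ℝ}
    (hs : s ∈ Icc (0 : ℝ) 1) (ht : t ∈ Icc (0 : ℝ) 1) (e : I.point s = I.point t) : s = t :=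
  Interval.point_inj h.length_pos h.length_lt_one hs ht e

/-- The interval behind the arc of center `k / 2 ^ n` and radius `1 / (3 * 2 ^ (n + 1))`. -/
def outer (k : ℤ) (n : ℕ) : Interval := iv ((6 * k - 1) / (3 * 2 ^ (n + 1))) (2 / (3 * 2 ^ (n + 1)))

/-- The interval from `(3 j + 1) / (3 * 2 ^ (m + 1))` to `(3 j + 2) / (3 * 2 ^ (m + 1))`. -/
def side (j : ℤ) (m : ℕ) : Interval := iv ((3 * j + 1) / (3 * 2 ^ (m + 1))) (1 / (3 * 2 ^ (m + 1)))

lemma iv_lft (a l : ℝ) : (iv a l).lft = iv a (l / 4) := rfl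

lemma iv_mid (a l : ℝ) : (iv a l).mid = iv (a + l / 4) (l / 2) := by
  simp only [Interval.mid, iv_point]
  simp only [iv]
  congr 3
  ring

lemma iv_rgt (a l : ℝ) : (iv a l).rgt = iv (a + 3 * l / 4) (l / 4) := by
  simp only [Interval.rgt, iv_point]
  simp only [iv]
  congr 3
  ring

lemma outer_lft (k : ℤ) (n : ℕ) : (outer k n).lft = side (4 * k - 1) (n + 1) := by
  rw [outer, iv_lft, side]
  congr 1 <;> push_cast <;> field_simp <;> ring

lemma outer_mid (k : ℤ) (n : ℕ) : (outer k n).mid = outer (2 * k) (n + 1) := by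
  rw [outer, iv_mid, outer]
  congr 1 <;> push_cast <;> field_simp <;> ring

lemma outer_rgt (k : ℤ) (n : ℕ) : (outer k n).rgt = side (4 * k) (n + 1) := by
  rw [outer, iv_rgt, side]
  congr 1 <;> push_cast <;> field_simp <;> ring

lemma side_lft (j : ℤ) (m : ℕ) : (side j m).lft = side (4 * j + 1) (m + 2) := by
  rw [side, iv_lft, side]
  congr 1 <;> push_cast <;> field_simp <;> ring

lemma side_mid (j : ℤ) (m : ℕ) : (side j m).mid = outer (2 * j + 1) (m + 2) := by
  rw [side, iv_mid, outer]
  congr 1 <;> push_cast <;> field_simp <;> ring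

lemma side_rgt (j : ℤ) (m : ℕ) : (side j m).rgt = side (4 * j + 2) (m + 2) := by
  rw [side, iv_rgt, side]
  congr 1 <;> push_cast <;> field_simp <;> ring

lemma o₁_lft : O₁.lft = side 1 1 := by
  rw [O₁, iv_lft, side]; congr 1 <;> norm_num

lemma o₁_mid : O₁.mid = outer 1 1 := by
  rw [O₁, iv_mid, outer]; congr 1 <;> norm_num

lemma o₁_rgt : O₁.rgt = side 2 1 := by
  rw [O₁, iv_rgt, side]; congr 1 <;> norm_num

lemma o₀_eq : O₀ = outer 0 0 := by
  rw [O₀, outer]; congr 1 <;> norm_num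

lemma s₀_eq : S₀ = side 0 0 := by
  rw [S₀, side]; congr 1 <;> norm_num

lemma s₁_eq : S₁ = side 1 0 := by
  rw [S₁, side]; congr 1 <;> norm_num

lemma Std.form {I : Interval} (h : Std I) :
    I = O₁ ∨ (∃ k n, I = outer k n) ∨ ∃ j m, I = side j m := by
  induction h with
  | o₀ => exact .inr (.inl ⟨_, _, o₀_eq⟩)
  | s₀ => exact .inr (.inr ⟨_, _, s₀_eq⟩)
  | o₁ => exact .inl rfl
  | s₁ => exact .inr (.inr ⟨_, _, s₁_eq⟩)
  | lft _ ih =>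
    rcases ih with rfl | ⟨k, n, rfl⟩ | ⟨j, m, rfl⟩
    · exact .inr (.inr ⟨_, _, o₁_lft⟩)
    · exact .inr (.inr ⟨_, _, outer_lft _ _⟩)
    · exact .inr (.inr ⟨_, _, side_lft _ _⟩)
  | mid _ ih =>
    rcases ih with rfl | ⟨k, n, rfl⟩ | ⟨j, m, rfl⟩
    · exact .inr (.inl ⟨_, _, o₁_mid⟩)
    · exact .inr (.inl ⟨_, _, outer_mid _ _⟩)
    · exact .inr (.inl ⟨_, _, side_mid _ _⟩)
  | rgt _ ih =>
    rcases ih with rfl | ⟨k, n, rfl⟩ | ⟨j, m, rfl⟩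
    · exact .inr (.inr ⟨_, _, o₁_rgt⟩)
    · exact .inr (.inr ⟨_, _, outer_rgt _ _⟩)
    · exact .inr (.inr ⟨_, _, side_rgt _ _⟩)

/-- The two endpoints of an interval. -/
def Interval.ends (I : Interval) : Sym2 UnitAddCircle := s(I.point 0, I.point 1)

/-- Side intervals: children that are not behind an arc. -/
def IsSide (I : Interval) : Prop := ∃ j m, I = side j m

lemma Std.isSide_lft {I : Interval} (h : Std I) : IsSide I.lft := by
  rcases h.form with rfl | ⟨k, n, rfl⟩ | ⟨j, m, rfl⟩
  exacts [⟨_, _, o₁_lft⟩, ⟨_, _, outer_lft _ _⟩, ⟨_, _, side_lft _ _⟩]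

lemma Std.isSide_rgt {I : Interval} (h : Std I) : IsSide I.rgt := by
  rcases h.form with rfl | ⟨k, n, rfl⟩ | ⟨j, m, rfl⟩
  exacts [⟨_, _, o₁_rgt⟩, ⟨_, _, outer_rgt _ _⟩, ⟨_, _, side_rgt _ _⟩]

lemma primaryArc_eq (I : Interval) : I.primaryArc = I.mid.ends := by
  rw [Interval.ends, Interval.mid_point, Interval.mid_point, Interval.primaryArc]
  norm_num

lemma outer_ends (k : ℤ) (n : ℕ) : (outer k n).ends =
    s((((6 * k - 1) / (3 * 2 ^ (n + 1)) : ℝ) : UnitAddCircle),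
      (((6 * k + 1) / (3 * 2 ^ (n + 1)) : ℝ) : UnitAddCircle)) := by
  simp only [Interval.ends, outer, iv_point]
  congr 3 <;> ring_nf

lemma outer_ends_mem (k : ℤ) (n : ℕ) : (outer k n).ends ∈ lamination := by
  rw [outer_ends]
  exact ⟨k, n + 1, rfl⟩

lemma Std.mid_ends_mem {I : Interval} (h : Std I) : I.mid.ends ∈ lamination := by
  rcases h.form with rfl | ⟨k, n, rfl⟩ | ⟨j, m, rfl⟩
  · rw [o₁_mid]; exact outer_ends_mem _ _
  · rw [outer_mid]; exact outer_ends_mem _ _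
  · rw [side_mid]; exact outer_ends_mem _ _

lemma outer_add (k z : ℤ) (n : ℕ) : outer (k + z * 2 ^ n) n = outer k n := by
  simp only [outer, iv]
  congr 1
  rw [coe_eq_coe_iff]
  refine ⟨z, ?_⟩
  push_cast
  field_simp
  ring

lemma side_add (j z : ℤ) (m : ℕ) : side (j + z * 2 ^ (m + 1)) m = side j m := by
  simp only [side, iv]
  congr 1
  rw [coe_eq_coe_iff]
  refine ⟨z, ?_⟩
  push_cast
  field_simp
  ring

lemma std_outer_side (n : ℕ) : (∀ k, Std (outer k n)) ∧ ∀ j, Std (side j n) := by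
  induction n using Nat.strong_induction_on with
  | _ n ih =>
    rcases n with - | - | n
    · constructor
      · intro k
        have := outer_add 0 k 0
        rw [pow_zero, mul_one, zero_add] at this
        rw [this, ← o₀_eq]
        exact .o₀
      · intro j
        rcases Int.even_or_odd' j with ⟨i, rfl | rfl⟩
        · rw [show 2 * i = 0 + i * 2 ^ (0 + 1) by ring, side_add, ← s₀_eq]
          exact .s₀
        · rw [show 2 * i + 1 = 1 + i * 2 ^ (0 + 1) by ring, side_add, ← s₁_eq]
          exact .s₁
    · have h0 := (ih 0 (by norm_num)).1
      constructor
      · intro k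
        rcases Int.even_or_odd' k with ⟨i, rfl | rfl⟩
        · rw [← outer_mid]; exact (h0 i).mid
        · rw [show 2 * i + 1 = 1 + i * 2 ^ (0 + 1) by ring, outer_add, zero_add, ← o₁_mid]
          exact .mid .o₁
      · intro j
        have : j = j % 4 + (j / 4) * 2 ^ (0 + 1 + 1) := by
          norm_num; omega
        rw [this, side_add]
        have h4 : j % 4 = 0 ∨ j % 4 = 1 ∨ j % 4 = 2 ∨ j % 4 = 3 := by omega
        rcases h4 with h | h | h | h <;> rw [h]
        · have := outer_rgt 0 0
          rw [mul_zero] at this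
          rw [← this]; exact (h0 0).rgt
        · rw [← o₁_lft]; exact .lft .o₁
        · rw [← o₁_rgt]; exact .rgt .o₁
        · have := outer_lft 1 0
          norm_num at this
          rw [← this]; exact (h0 1).lft
    · have h0 := ih n (by omega)
      have h1 := ih (n + 1) (by omega)
      constructor
      · intro k
        rcases Int.even_or_odd' k with ⟨i, rfl | rfl⟩
        · rw [← outer_mid]; exact (h1.1 i).mid
        · rw [← side_mid]; exact (h0.2 i).mid
      · intro j
        have h4 : (∃ i, j = 4 * i) ∨ (∃ i, j = 4 * i + 1) ∨ (∃ i, j = 4 * i + 2) ∨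
            ∃ i, j = 4 * i - 1 := by
          have : j % 4 = 0 ∨ j % 4 = 1 ∨ j % 4 = 2 ∨ j % 4 = 3 := by omega
          rcases this with h | h | h | h
          · exact .inl ⟨j / 4, by omega⟩
          · exact .inr (.inl ⟨j / 4, by omega⟩)
          · exact .inr (.inr (.inl ⟨j / 4, by omega⟩))
          · exact .inr (.inr (.inr ⟨j / 4 + 1, by omega⟩))
        rcases h4 with ⟨i, rfl⟩ | ⟨i, rfl⟩ | ⟨i, rfl⟩ | ⟨i, rfl⟩
        · rw [← outer_rgt]; exact (h1.1 i).rgt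
        · rw [← side_lft]; exact (h0.2 i).lft
        · rw [← side_rgt]; exact (h0.2 i).rgt
        · rw [← outer_lft]; exact (h1.1 i).lft

lemma base_arcs : Diagram.base.arcs = {O₁.ends, O₀.ends} := by
  have h1 : O₁.ends = ar (1 / 3) (2 / 3) := by
    simp only [Interval.ends, O₁, iv_point, ar]; norm_num
  have h0 : O₀.ends = ar (1 / 6) (5 / 6) := by
    simp only [Interval.ends, O₀, iv_point, ar]
    rw [coe_sub_one (5 / 6) (-1 / 6) (by norm_num), Sym2.eq_swap]
    norm_num
  rw [h1, h0]
  rfl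

lemma o₁_ends_mem : O₁.ends ∈ lamination := by
  refine ⟨0, 0, ?_⟩
  simp only [Interval.ends, O₁, iv_point]
  rw [Sym2.eq_swap, coe_sub_one (1 / 3 + 1 * (1 / 3)) (-1 / 3) (by norm_num)]
  norm_num

/-- Every arc of the lamination is a basic arc or the primary arc of a standard interval. -/
lemma mem_lamination_iff (s : Sym2 UnitAddCircle) :
    s ∈ lamination ↔ s = O₁.ends ∨ s = O₀.ends ∨ ∃ I, Std I ∧ s = I.primaryArc := by
  constructor
  · rintro ⟨k, n, rfl⟩
    rcases n with - | - | n
    · left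
      simp only [Interval.ends, O₁, iv_point]
      rw [Sym2.eq_swap]
      congr 1
      · rw [coe_eq_coe_iff]; exact ⟨2 * k, by push_cast; ring⟩
      · rw [coe_eq_coe_iff]; exact ⟨2 * k - 1, by push_cast; ring⟩
    · right; left
      have := outer_add 0 k 0
      rw [pow_zero, mul_one, zero_add] at this
      rw [zero_add, o₀_eq, ← this, outer_ends, zero_add]
    · right; right
      rw [← outer_ends]
      rcases Int.even_or_odd' k with ⟨i, rfl | rfl⟩
      · exact ⟨outer i n, (std_outer_side n).1 i, by rw [primaryArc_eq, outer_mid]⟩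
      · rcases n with - | n
        · refine ⟨O₁, .o₁, ?_⟩
          rw [primaryArc_eq, o₁_mid, show 2 * i + 1 = 1 + i * 2 ^ (0 + 1) by ring, outer_add]
        · exact ⟨side i n, (std_outer_side n).2 i, by rw [primaryArc_eq, side_mid]⟩
  · rintro (rfl | rfl | ⟨I, hI, rfl⟩)
    · exact o₁_ends_mem
    · rw [o₀_eq]; exact outer_ends_mem _ _
    · rw [primaryArc_eq]; exact hI.mid_ends_mem

lemma IsSide.ends_notMem {K : Interval} (h : IsSide K) : K.ends ∉ lamination := by
  obtain ⟨j, m, rfl⟩ := h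
  rintro ⟨k, n, h⟩
  simp only [Interval.ends, side, iv_point, Sym2.eq_iff, coe_eq_coe_iff] at h
  have key : ∀ ε a b : ℤ, (ε = 1 ∨ ε = -1) →
      (3 * j + 1) * 2 ^ n = (6 * k + ε) * 2 ^ (m + 1) + 3 * 2 ^ (m + 1) * 2 ^ n * a →
      (3 * j + 2) * 2 ^ n = (6 * k - ε) * 2 ^ (m + 1) + 3 * 2 ^ (m + 1) * 2 ^ n * b → False := by
    intro ε a b hε h1 h2
    have e1 : 2 ^ n * (1 - 2 * (3 * 2 ^ m * (b - a))) = -ε * 2 ^ (m + 2) := by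
      ring_nf at h1 h2 ⊢; linarith
    have e2 : (2 * j + 1) * 2 ^ n = 4 * k * 2 ^ (m + 1) + 2 ^ (m + 1) * 2 ^ n * (a + b) := by
      have : 3 * ((2 * j + 1) * 2 ^ n) =
          3 * (4 * k * 2 ^ (m + 1) + 2 ^ (m + 1) * 2 ^ n * (a + b)) := by
        ring_nf at h1 h2 ⊢; linarith
      linarith
    generalize 3 * 2 ^ m * (b - a) = x at e1
    rcases lt_trichotomy n (m + 2) with hn | hn | hn
    · obtain ⟨d, hd⟩ := Nat.exists_eq_add_of_lt hn
      rw [hd, show n + d + 1 = n + (d + 1) by ring, pow_add, mul_left_comm] at e1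
      have := mul_left_cancel₀ (pow_ne_zero n (two_ne_zero)) e1
      rw [pow_succ] at this
      have : 2 * (-ε * 2 ^ d + x) = 1 := by linarith
      omega
    · rw [hn, show (2 : ℤ) ^ (m + 2) = 2 * 2 ^ (m + 1) by ring] at e2
      have h0 : (2 : ℤ) ^ (m + 1) ≠ 0 := by positivity
      have : 2 ^ (m + 1) * (2 * j + 1) = 2 ^ (m + 1) * (2 * k + 2 * 2 ^ m * (a + b)) := by
        ring_nf at e2 ⊢; linarith
      have := mul_left_cancel₀ h0 this
      have : 2 * (k + 2 ^ m * (a + b) - j) = 1 := by linarith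
      omega
    · obtain ⟨d, hd⟩ := Nat.exists_eq_add_of_lt hn
      rw [hd, show m + 2 + d + 1 = (m + 2) + (d + 1) by ring, pow_add, mul_assoc,
        mul_comm (-ε)] at e1
      have := mul_left_cancel₀ (pow_ne_zero (m + 2) (two_ne_zero)) e1
      rw [pow_succ] at this
      have : 2 * (2 ^ d * (1 - 2 * x)) = -ε := by linarith
      omega
  rcases h with ⟨⟨a, ha⟩, ⟨b, hb⟩⟩ | ⟨⟨a, ha⟩, ⟨b, hb⟩⟩
  · refine key (-1) a b (.inr rfl) ?_ ?_
    · field_simp at ha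
      have : ((3 * j + 1) * 2 ^ n : ℝ) =
        (6 * k + (-1)) * 2 ^ (m + 1) + 3 * 2 ^ (m + 1) * 2 ^ n * a := by ring_nf at ha ⊢; linarith
      exact_mod_cast this
    · field_simp at hb
      have : ((3 * j + 2) * 2 ^ n : ℝ) =
        (6 * k - (-1)) * 2 ^ (m + 1) + 3 * 2 ^ (m + 1) * 2 ^ n * b := by ring_nf at hb ⊢; linarith
      exact_mod_cast this
  · refine key 1 a b (.inl rfl) ?_ ?_
    · field_simp at ha
      have : ((3 * j + 1) * 2 ^ n : ℝ) =
        (6 * k + 1) * 2 ^ (m + 1) + 3 * 2 ^ (m + 1) * 2 ^ n * a := by ring_nf at ha ⊢; linarith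
      exact_mod_cast this
    · field_simp at hb
      have : ((3 * j + 2) * 2 ^ n : ℝ) =
        (6 * k - 1) * 2 ^ (m + 1) + 3 * 2 ^ (m + 1) * 2 ^ n * b := by ring_nf at hb ⊢; linarith
      exact_mod_cast this

/-! ### Arc diagrams and the lamination -/

/-- `Sub I J`: the interval `J` is obtained from `I` by passing to children. -/
inductive Sub (I : Interval) : Interval → Prop
  | refl : Sub I I
  | lft {J} : Sub I J → Sub I J.lft
  | mid {J} : Sub I J → Sub I J.mid
  | rgt {J} : Sub I J → Sub I J.rgt

lemma Sub.trans {I J K : Interval} (h : Sub I J) (h' : Sub J K) : Sub I K := by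
  induction h' with
  | refl => exact h
  | lft _ ih => exact ih.lft
  | mid _ ih => exact ih.mid
  | rgt _ ih => exact ih.rgt

lemma Sub.cases_head {I J : Interval} (h : Sub I J) :
    J = I ∨ Sub I.lft J ∨ Sub I.mid J ∨ Sub I.rgt J := by
  induction h with
  | refl => exact .inl rfl
  | lft _ ih =>
    rcases ih with rfl | h | h | h
    exacts [.inr (.inl .refl), .inr (.inl h.lft), .inr (.inr (.inl h.lft)), .inr (.inr (.inr h.lft))]
  | mid _ ih =>
    rcases ih with rfl | h | h | h
    exacts [.inr (.inr (.inl .refl)), .inr (.inl h.mid), .inr (.inr (.inl h.mid)),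
      .inr (.inr (.inr h.mid))]
  | rgt _ ih =>
    rcases ih with rfl | h | h | h
    exacts [.inr (.inr (.inr .refl)), .inr (.inl h.rgt), .inr (.inr (.inl h.rgt)),
      .inr (.inr (.inr h.rgt))]

lemma Sub.std {I J : Interval} (h : Sub I J) (hI : Std I) : Std J := by
  induction h with
  | refl => exact hI
  | lft _ ih => exact ih.lft
  | mid _ ih => exact ih.mid
  | rgt _ ih => exact ih.rgt

lemma Std.sub {I : Interval} (h : Std I) : Sub O₀ I ∨ Sub S₀ I ∨ Sub O₁ I ∨ Sub S₁ I := by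
  induction h with
  | o₀ => exact .inl .refl
  | s₀ => exact .inr (.inl .refl)
  | o₁ => exact .inr (.inr (.inl .refl))
  | s₁ => exact .inr (.inr (.inr .refl))
  | lft _ ih => exact ih.imp .lft (.imp .lft (.imp .lft .lft))
  | mid _ ih => exact ih.imp .mid (.imp .mid (.imp .mid .mid))
  | rgt _ ih => exact ih.imp .rgt (.imp .rgt (.imp .rgt .rgt))

lemma MapsLinearly.sub {f : UnitAddCircle → UnitAddCircle} {I J K : Interval}
    (h : MapsLinearly f I J) (hK : Sub I K) : ∃ K', Sub J K' ∧ MapsLinearly f K K' := by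
  induction hK with
  | refl => exact ⟨J, .refl, h⟩
  | lft _ ih => obtain ⟨K', h1, h2⟩ := ih; exact ⟨_, h1.lft, h2.lft⟩
  | mid _ ih => obtain ⟨K', h1, h2⟩ := ih; exact ⟨_, h1.mid, h2.mid⟩
  | rgt _ ih => obtain ⟨K', h1, h2⟩ := ih; exact ⟨_, h1.rgt, h2.rgt⟩

lemma IsArcDiagram.std {D : Diagram} (h : IsArcDiagram D) : ∀ I ∈ D.intervals, Std I := by
  induction h with
  | refl =>
    intro I hI
    simp only [base_intervals, Multiset.mem_cons, Multiset.mem_singleton] at hI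
    rcases hI with rfl | rfl | rfl | rfl
    exacts [.o₀, .s₀, .o₁, .s₁]
  | tail _ hs ih =>
    obtain ⟨I, s, A⟩ := hs
    have hI : Std I := ih I (by simp)
    intro J hJ
    simp only [Interval.children_eq, Multiset.cons_add, Multiset.mem_cons,
      Multiset.singleton_add] at hJ
    rcases hJ with rfl | rfl | rfl | h
    exacts [hI.lft, hI.mid, hI.rgt, ih J (by simp [h])]

lemma IsArcDiagram.lamination_eq {D : Diagram} (h : IsArcDiagram D) :
    lamination = D.arcs ∪ {s | ∃ I ∈ D.intervals, ∃ J, Sub I J ∧ s = J.primaryArc} := by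
  induction h with
  | refl =>
    ext s
    rw [mem_lamination_iff, base_arcs, base_intervals]
    simp only [mem_union, mem_insert_iff, mem_singleton_iff, Multiset.mem_cons,
      Multiset.mem_singleton, mem_ofPred_eq, or_assoc]
    refine or_congr_right (or_congr_right ?_)
    constructor
    · rintro ⟨I, hI, rfl⟩
      rcases hI.sub with h | h | h | h
      exacts [⟨O₀, by simp, I, h, rfl⟩, ⟨S₀, by simp, I, h, rfl⟩, ⟨O₁, by simp, I, h, rfl⟩,
        ⟨S₁, by simp, I, h, rfl⟩]
    · rintro ⟨I, rfl | rfl | rfl | rfl, J, hJ, rfl⟩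
      exacts [⟨J, hJ.std .o₀, rfl⟩, ⟨J, hJ.std .s₀, rfl⟩, ⟨J, hJ.std .o₁, rfl⟩,
        ⟨J, hJ.std .s₁, rfl⟩]
  | tail _ hs ih =>
    obtain ⟨I, s, A⟩ := hs
    rw [ih]
    ext x
    simp only [mem_union, mem_insert_iff, mem_ofPred_eq, Interval.children_eq, Multiset.cons_add,
      Multiset.mem_cons, Multiset.singleton_add, or_and_right, exists_or, exists_eq_left]
    constructor
    · rintro (h | ⟨J, hJ, rfl⟩ | h)
      · exact .inl (.inr h)
      · rcases hJ.cases_head with rfl | h | h | h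
        exacts [.inl (.inl rfl), .inr (.inl ⟨J, h, rfl⟩), .inr (.inr (.inl ⟨J, h, rfl⟩)),
          .inr (.inr (.inr (.inl ⟨J, h, rfl⟩)))]
      · exact .inr (.inr (.inr (.inr h)))
    · rintro ((rfl | h) | ⟨J, hJ, rfl⟩ | ⟨J, hJ, rfl⟩ | ⟨J, hJ, rfl⟩ | h)
      · exact .inr (.inl ⟨I, .refl, rfl⟩)
      · exact .inl h
      · exact .inr (.inl ⟨J, (Sub.refl.lft).trans hJ, rfl⟩)
      · exact .inr (.inl ⟨J, (Sub.refl.mid).trans hJ, rfl⟩)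
      · exact .inr (.inl ⟨J, (Sub.refl.rgt).trans hJ, rfl⟩)
      · exact .inr (.inr h)

lemma TB.map_mem_lamination (f : TB) {s : Sym2 UnitAddCircle} (hs : s ∈ lamination) :
    Sym2.map f.1 s ∈ lamination := by
  obtain ⟨D, R, hD, hR, h⟩ := f.2
  rw [hD.lamination_eq] at hs
  rw [hR.lamination_eq]
  rcases hs with hs | ⟨I, hI, K, hK, rfl⟩
  · left
    rw [← h.2]
    exact mem_image_of_mem _ hs
  · right
    obtain ⟨J, hJ, hIJ⟩ := Multiset.exists_mem_of_rel_of_mem h.1 hI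
    obtain ⟨K', h1, h2⟩ := hIJ.sub hK
    refine ⟨J, hJ, K', h1, ?_⟩
    rw [Interval.primaryArc, Sym2.map_mk, h2 _ (by norm_num), h2 _ (by norm_num),
      Interval.primaryArc]

lemma TB.map_mem_lamination_iff (f : TB) {s : Sym2 UnitAddCircle} :
    Sym2.map f.1 s ∈ lamination ↔ s ∈ lamination := by
  refine ⟨fun h => ?_, TB.map_mem_lamination f⟩
  have := TB.map_mem_lamination f⁻¹ h
  rw [Sym2.map_map] at this
  have e : ((f⁻¹ : TB).1 : UnitAddCircle → UnitAddCircle) ∘ f.1 = id := by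
    funext x
    exact f.1.symm_apply_apply x
  rwa [e, Sym2.map_id] at this

lemma MapsLinearly.map_ends {f : UnitAddCircle → UnitAddCircle} {I J : Interval}
    (h : MapsLinearly f I J) : Sym2.map f I.ends = J.ends := by
  rw [Interval.ends, Sym2.map_mk, h 0 (by norm_num), h 1 (by norm_num), Interval.ends]

/-! ### Disjointness of the intervals of a diagram -/

/-- The interval `I` does not meet the interior of `J`. -/
def Off (I J : Interval) : Prop :=
  ∀ s ∈ Icc (0 : ℝ) 1, ∀ t ∈ Ioo (0 : ℝ) 1, I.point s ≠ J.point t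

/-- The interiors of two intervals are disjoint. -/
def Disj (I J : Interval) : Prop :=
  ∀ s ∈ Ioo (0 : ℝ) 1, ∀ t ∈ Ioo (0 : ℝ) 1, I.point s ≠ J.point t

instance : Std.Symm Disj := ⟨fun _ _ h s hs t ht => (h t ht s hs).symm⟩

lemma Off.disj {I J : Interval} (h : Off I J) : Disj I J :=
  fun s hs t ht => h s (Ioo_subset_Icc_self hs) t ht

lemma Disj.lft {I J : Interval} (h : Disj I J) : Disj I.lft J := by
  intro s hs t ht
  rw [Interval.lft_point]
  exact h _ ⟨by linarith [hs.1], by linarith [hs.2]⟩ t ht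

lemma Disj.mid {I J : Interval} (h : Disj I J) : Disj I.mid J := by
  intro s hs t ht
  rw [Interval.mid_point]
  exact h _ ⟨by linarith [hs.1], by linarith [hs.2]⟩ t ht

lemma Disj.rgt {I J : Interval} (h : Disj I J) : Disj I.rgt J := by
  intro s hs t ht
  rw [Interval.rgt_point]
  exact h _ ⟨by linarith [hs.1], by linarith [hs.2]⟩ t ht

lemma off_iv {a l b m : ℝ} (hl : 0 < l) (hm : 0 < m) (h : a + l ≤ b ∨ b + m ≤ a)
    (h1 : a + l - b ≤ 1) (h2 : b + m - a ≤ 1) : Off (iv a l) (iv b m) := by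
  rintro s ⟨hs0, hs1⟩ t ⟨ht0, ht1⟩ e
  rw [iv_point, iv_point] at e
  have h3 : 0 < t * m := mul_pos ht0 hm
  have h4 : t * m < m := by nlinarith
  have h5 : 0 ≤ s * l := mul_nonneg hs0 hl.le
  have h6 : s * l ≤ l := by nlinarith
  have := coe_inj e (by rw [abs_lt]; constructor <;> linarith)
  rcases h with h | h <;> linarith

lemma Std.off_children {I : Interval} (h : Std I) : Off I.lft I.mid ∧ Off I.lft I.rgt ∧
    Off I.mid I.lft ∧ Off I.mid I.rgt ∧ Off I.rgt I.lft ∧ Off I.rgt I.mid := by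
  refine ⟨?_, ?_, ?_, ?_, ?_, ?_⟩ <;>
  · rintro s ⟨hs0, hs1⟩ t ⟨ht0, ht1⟩ e
    simp only [Interval.lft_point, Interval.mid_point, Interval.rgt_point] at e
    have := h.point_inj ⟨by linarith, by linarith⟩ ⟨by linarith, by linarith⟩ e
    linarith

lemma off_base : (Off O₀ S₀ ∧ Off O₀ O₁ ∧ Off O₀ S₁) ∧ (Off S₀ O₀ ∧ Off S₀ O₁ ∧ Off S₀ S₁) ∧
    (Off O₁ O₀ ∧ Off O₁ S₀ ∧ Off O₁ S₁) ∧ Off S₁ O₀ ∧ Off S₁ S₀ ∧ Off S₁ O₁ := by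
  simp only [O₀, O₁, S₀, S₁]
  refine ⟨⟨?_, ?_, ?_⟩, ⟨?_, ?_, ?_⟩, ⟨?_, ?_, ?_⟩, ?_, ?_, ?_⟩ <;>
  exact off_iv (by norm_num) (by norm_num) (by norm_num) (by norm_num) (by norm_num)

lemma IsArcDiagram.pairwise_disj {D : Diagram} (h : IsArcDiagram D) :
    ∃ l : List Interval, D.intervals = l ∧ l.Pairwise Disj := by
  induction h with
  | refl =>
    obtain ⟨⟨h1, h2, h3⟩, ⟨-, h4, h5⟩, ⟨-, -, h6⟩, -⟩ := off_base
    refine ⟨[O₀, S₀, O₁, S₁], rfl, ?_⟩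
    simp [h1.disj, h2.disj, h3.disj, h4.disj, h5.disj, h6.disj]
  | tail hD hs ih =>
    obtain ⟨I, s, A⟩ := hs
    have hI : Std I := IsArcDiagram.std hD I (by simp)
    obtain ⟨h1, h2, -, h3, -⟩ := hI.off_children
    induction s using Quotient.inductionOn with
    | _ l =>
      have h : Multiset.Pairwise Disj ((I :: l : List Interval) : Multiset Interval) := ih
      rw [Multiset.pairwise_coe_iff_pairwise, List.pairwise_cons] at h
      refine ⟨I.lft :: I.mid :: I.rgt :: l, rfl, ?_⟩
      simp only [List.pairwise_cons, List.mem_cons, forall_eq_or_imp]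
      exact ⟨⟨h1.disj, h2.disj, fun J hJ => (h.1 J hJ).lft⟩, ⟨h3.disj, fun J hJ => (h.1 J hJ).mid⟩,
        fun J hJ => (h.1 J hJ).rgt, h.2⟩

lemma IsArcDiagram.eq_of_not_disj {D : Diagram} (h : IsArcDiagram D) {I J : Interval}
    (hI : I ∈ D.intervals) (hJ : J ∈ D.intervals) (hd : ¬ Disj I J) : I = J := by
  obtain ⟨l, hl, hp⟩ := h.pairwise_disj
  rw [hl, Multiset.mem_coe] at hI hJ
  by_contra hne
  exact hd (hp.forall hI hJ hne)

/-- Two intervals of an arc diagram with the same left endpoint agree. -/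
lemma IsArcDiagram.eq_of_left {D : Diagram} (h : IsArcDiagram D) {I J : Interval}
    (hI : I ∈ D.intervals) (hJ : J ∈ D.intervals) (e : I.point 0 = J.point 0) : I = J := by
  refine h.eq_of_not_disj hI hJ fun hd => ?_
  have h1 := (h.std I hI).length_pos
  have h2 := (h.std J hJ).length_pos
  rw [Interval.point_zero, Interval.point_zero] at e
  have h3 : 0 < I.length + J.length := by positivity
  refine hd (J.length / (I.length + J.length)) ⟨by positivity, ?_⟩
    (I.length / (I.length + J.length)) ⟨by positivity, ?_⟩ ?_
  · rw [div_lt_one h3]; linarith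
  · rw [div_lt_one h3]; linarith
  · rw [Interval.point, Interval.point, e]
    congr 2
    ring

/-- Two intervals of an arc diagram with the same right endpoint agree. -/
lemma IsArcDiagram.eq_of_right {D : Diagram} (h : IsArcDiagram D) {I J : Interval}
    (hI : I ∈ D.intervals) (hJ : J ∈ D.intervals) (e : I.point 1 = J.point 1) : I = J := by
  refine h.eq_of_not_disj hI hJ fun hd => ?_
  have h1 := (h.std I hI).length_pos
  have h2 := (h.std J hJ).length_pos
  have h3 : 0 < I.length + J.length := by positivity
  have key : ∀ (K : Interval) (t : ℝ), K.point (1 - t) =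
      K.point 1 + ((-(t * K.length) : ℝ) : UnitAddCircle) := by
    intro K t
    simp only [Interval.point, add_assoc, ← AddCircle.coe_add]
    congr 2
    ring
  refine hd (1 - J.length / (I.length + J.length)) ⟨?_, ?_⟩
    (1 - I.length / (I.length + J.length)) ⟨?_, ?_⟩ ?_
  · rw [sub_pos, div_lt_one h3]; linarith
  · rw [sub_lt_self_iff]; positivity
  · rw [sub_pos, div_lt_one h3]; linarith
  · rw [sub_lt_self_iff]; positivity
  · rw [key, key, e]
    congr 3
    ring

/-! ### The generators on standard intervals -/

lemma iv_eq_iv_of_sub_one {a b l m : ℝ} (h : b = a - 1) (h' : l = m) : iv a l = iv b m := by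
  rw [h']
  simp only [iv]
  rw [coe_sub_one a b h]

lemma β_s₀ : MapsLinearly β.1 S₀ S₀.lft := by
  simp only [S₀, iv_lft]
  exact mapsLinearly_iv beta_apply (by norm_num) (by norm_num) (by norm_num) (by
    intro t h0 h1; unfold betaFun; split_ifs <;> linarith)

lemma β_o₁ : MapsLinearly β.1 O₁ S₀.mid := by
  simp only [S₀, O₁, iv_mid]
  exact mapsLinearly_iv beta_apply (by norm_num) (by norm_num) (by norm_num) (by
    intro t h0 h1; unfold betaFun; split_ifs <;> linarith)

lemma β_s₁_lft : MapsLinearly β.1 S₁.lft S₀.rgt := by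
  simp only [S₀, S₁, iv_lft, iv_rgt]
  exact mapsLinearly_iv beta_apply (by norm_num) (by norm_num) (by norm_num) (by
    intro t h0 h1; unfold betaFun; split_ifs <;> linarith)

lemma β_s₁_mid : MapsLinearly β.1 S₁.mid O₁ := by
  simp only [O₁, S₁, iv_mid]
  exact mapsLinearly_iv beta_apply (by norm_num) (by norm_num) (by norm_num) (by
    intro t h0 h1; unfold betaFun; split_ifs <;> linarith)

lemma β_s₁_rgt : MapsLinearly β.1 S₁.rgt S₁ := by
  simp only [S₁, iv_rgt]
  exact mapsLinearly_iv beta_apply (by norm_num) (by norm_num) (by norm_num) (by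
    intro t h0 h1; unfold betaFun; split_ifs <;> linarith)

lemma β_o₀ : MapsLinearly β.1 O₀ O₀ :=
  mapsLinearly_center (k := (1 / 1)) beta_apply beta_aux beta_aux' (by norm_num) (by norm_num)

lemma γ_s₀_lft : MapsLinearly γ.1 S₀.lft S₀.lft.lft := by
  simp only [S₀, iv_lft]
  exact mapsLinearly_iv gamma_apply (by norm_num) (by norm_num) (by norm_num) (by
    intro t h0 h1; unfold gammaFun; split_ifs <;> linarith)

lemma γ_s₀_mid : MapsLinearly γ.1 S₀.mid S₀.lft.mid := by
  simp only [S₀, iv_lft, iv_mid]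
  exact mapsLinearly_iv gamma_apply (by norm_num) (by norm_num) (by norm_num) (by
    intro t h0 h1; unfold gammaFun; split_ifs <;> linarith)

lemma γ_s₀_rgt_lft : MapsLinearly γ.1 S₀.rgt.lft S₀.lft.rgt := by
  simp only [S₀, iv_lft, iv_rgt]
  exact mapsLinearly_iv gamma_apply (by norm_num) (by norm_num) (by norm_num) (by
    intro t h0 h1; unfold gammaFun; split_ifs <;> linarith)

lemma γ_s₀_rgt_mid : MapsLinearly γ.1 S₀.rgt.mid S₀.mid := by
  simp only [S₀, iv_mid, iv_rgt]
  exact mapsLinearly_iv gamma_apply (by norm_num) (by norm_num) (by norm_num) (by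
    intro t h0 h1; unfold gammaFun; split_ifs <;> linarith)

lemma γ_s₀_rgt_rgt : MapsLinearly γ.1 S₀.rgt.rgt S₀.rgt := by
  simp only [S₀, iv_rgt]
  exact mapsLinearly_iv gamma_apply (by norm_num) (by norm_num) (by norm_num) (by
    intro t h0 h1; unfold gammaFun; split_ifs <;> linarith)

lemma γ_o₀ : MapsLinearly γ.1 O₀ O₀ :=
  mapsLinearly_center (k := (1 / 1)) gamma_apply gamma_aux gamma_aux' (by norm_num) (by norm_num)

lemma γ_o₁ : MapsLinearly γ.1 O₁ O₁ :=
  mapsLinearly_iv gamma_apply (by norm_num) (by norm_num) (by norm_num) (by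
    intro t h0 h1; unfold gammaFun; split_ifs <;> linarith)

lemma γ_s₁ : MapsLinearly γ.1 S₁ S₁ :=
  mapsLinearly_iv gamma_apply (by norm_num) (by norm_num) (by norm_num) (by
    intro t h0 h1; unfold gammaFun; split_ifs <;> linarith)

lemma δ_o₀ : MapsLinearly δ.1 O₀ O₁ := mapsLinearly_delta (by norm_num)

lemma δ_s₀ : MapsLinearly δ.1 S₀ S₁ := mapsLinearly_delta (by norm_num)

lemma δ_o₁ : MapsLinearly δ.1 O₁ O₀ := by
  rw [O₀, ← iv_eq_iv_of_sub_one (a := 5 / 6) (by norm_num) rfl]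
  exact mapsLinearly_delta (by norm_num)

lemma δ_s₁ : MapsLinearly δ.1 S₁ S₀ := by
  rw [S₀, ← iv_eq_iv_of_sub_one (a := 7 / 6) (by norm_num) rfl]
  exact mapsLinearly_delta (by norm_num)

lemma α_o₁_lft : MapsLinearly α.1 O₁.lft S₀ := by
  simp only [O₁, iv_lft]
  exact mapsLinearly_iv alpha_apply (by norm_num) (by norm_num) (by norm_num) (by
    intro t h0 h1; unfold alphaFun; split_ifs <;> linarith)

lemma α_o₁_mid : MapsLinearly α.1 O₁.mid O₁ := by
  simp only [O₁, iv_mid]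
  exact mapsLinearly_iv alpha_apply (by norm_num) (by norm_num) (by norm_num) (by
    intro t h0 h1; unfold alphaFun; split_ifs <;> linarith)

lemma α_o₁_rgt : MapsLinearly α.1 O₁.rgt S₁ := by
  simp only [O₁, iv_rgt]
  exact mapsLinearly_iv alpha_apply (by norm_num) (by norm_num) (by norm_num) (by
    intro t h0 h1; unfold alphaFun; split_ifs <;> linarith)

lemma α_o₀ : MapsLinearly α.1 O₀ O₀.mid := by
  simp only [O₀, iv_mid]
  exact mapsLinearly_center (k := (1 / 2)) alpha_apply alpha_aux alpha_aux' (by norm_num)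
    (by norm_num)

lemma α_s₀ : MapsLinearly α.1 S₀ O₀.rgt := by
  simp only [O₀, iv_rgt]
  exact mapsLinearly_iv alpha_apply (by norm_num) (by norm_num) (by norm_num) (by
    intro t h0 h1; unfold alphaFun; split_ifs <;> linarith)

lemma α_s₁ : MapsLinearly α.1 S₁ O₀.lft := by
  rw [O₀, iv_lft, ← iv_eq_iv_of_sub_one (a := 5 / 6) (l := 1 / 12) (by norm_num) (by norm_num)]
  exact mapsLinearly_iv alpha_apply (by norm_num) (by norm_num) (by norm_num) (by
    intro t h0 h1; unfold alphaFun; split_ifs <;> linarith)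

/-- The four basic intervals cover the circle. -/
lemma exists_base_point (x : UnitAddCircle) : ∃ t ∈ Icc (0 : ℝ) 1,
    x = O₀.point t ∨ x = S₀.point t ∨ x = O₁.point t ∨ x = S₁.point t := by
  obtain ⟨y, ⟨h0, h1⟩, rfl⟩ := AddCircle.eq_coe_Ico x
  have key : ∀ a l : ℝ, 0 < l → a ≤ y → y ≤ a + l →
      ∃ t ∈ Icc (0 : ℝ) 1, (y : UnitAddCircle) = (iv a l).point t := by
    intro a l hl ha hb
    refine ⟨(y - a) / l, ⟨div_nonneg (by linarith) hl.le, (div_le_one hl).2 (by linarith)⟩, ?_⟩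
    rw [iv_point, div_mul_cancel₀ _ hl.ne', add_sub_cancel]
  rcases le_total y (1 / 6) with h | h
  · obtain ⟨t, ht, e⟩ := key (-1 / 6) (1 / 3) (by norm_num) (by linarith) (by linarith)
    exact ⟨t, ht, .inl e⟩
  rcases le_total y (1 / 3) with h' | h'
  · obtain ⟨t, ht, e⟩ := key (1 / 6) (1 / 6) (by norm_num) (by linarith) (by linarith)
    exact ⟨t, ht, .inr (.inl e)⟩
  rcases le_total y (2 / 3) with h2 | h2
  · obtain ⟨t, ht, e⟩ := key (1 / 3) (1 / 3) (by norm_num) (by linarith) (by linarith)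
    exact ⟨t, ht, .inr (.inr (.inl e))⟩
  rcases le_total y (5 / 6) with h3 | h3
  · obtain ⟨t, ht, e⟩ := key (2 / 3) (1 / 6) (by norm_num) (by linarith) (by linarith)
    exact ⟨t, ht, .inr (.inr (.inr e))⟩
  · obtain ⟨t, ht, e⟩ := key (5 / 6) (1 / 3) (by norm_num) (by linarith) (by linarith)
    refine ⟨t, ht, .inl ?_⟩
    rw [e, O₀, iv_eq_iv_of_sub_one (b := -1 / 6) (by norm_num) rfl]

/-- The homeomorphisms agree at all points of the interval. -/
def EqOn' (f g : TB) (I : Interval) : Prop := ∀ t ∈ Icc (0 : ℝ) 1, f.1 (I.point t) = g.1 (I.point t)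

lemma EqOn'.of_maps {f g : TB} {I J : Interval} (h : MapsLinearly f.1 I J)
    (h' : MapsLinearly g.1 I J) : EqOn' f g I := fun t ht => by rw [h t ht, h' t ht]

lemma EqOn'.glue {f g : TB} {I : Interval} (hl : EqOn' f g I.lft) (hm : EqOn' f g I.mid)
    (hr : EqOn' f g I.rgt) : EqOn' f g I := by
  refine unit_cases (fun t ht => ?_) (fun t ht => ?_) (fun t ht => ?_)
  · simpa only [Interval.lft_point] using hl t ht
  · simpa only [Interval.mid_point] using hm t ht
  · simpa only [Interval.rgt_point] using hr t ht

lemma TB.ext_base {f g : TB} (h0 : EqOn' f g O₀) (h1 : EqOn' f g S₀) (h2 : EqOn' f g O₁)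
    (h3 : EqOn' f g S₁) : f = g := by
  refine Subtype.ext (Homeomorph.ext fun x => ?_)
  obtain ⟨t, ht, rfl | rfl | rfl | rfl⟩ := exists_base_point x
  exacts [h0 t ht, h1 t ht, h2 t ht, h3 t ht]

lemma maps_mul {f g : TB} {I J K : Interval} (hg : MapsLinearly g.1 I J)
    (hf : MapsLinearly f.1 J K) : MapsLinearly (f * g).1 I K := MapsLinearly.comp hf hg

lemma maps_inv {f : TB} {I J : Interval} (h : MapsLinearly f.1 I J) :
    MapsLinearly (f⁻¹).1 J I := MapsLinearly.symm h

lemma maps_one (I : Interval) : MapsLinearly (1 : TB).1 I I := fun _ _ => rfl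

/-! ### Relations -/

lemma δ_sq : δ * δ = 1 :=
  TB.ext_base (.of_maps (maps_mul δ_o₀ δ_o₁) (maps_one _))
    (.of_maps (maps_mul δ_s₀ δ_s₁) (maps_one _)) (.of_maps (maps_mul δ_o₁ δ_o₀) (maps_one _))
    (.of_maps (maps_mul δ_s₁ δ_s₀) (maps_one _))

lemma α_inv : δ * α * δ = α⁻¹ :=
  TB.ext_base
    (.glue (.of_maps (maps_mul δ_o₀.lft (maps_mul α_o₁_lft δ_s₀)) (maps_inv α_s₁))
      (.of_maps (maps_mul δ_o₀.mid (maps_mul α_o₁_mid δ_o₁)) (maps_inv α_o₀))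
      (.of_maps (maps_mul δ_o₀.rgt (maps_mul α_o₁_rgt δ_s₁)) (maps_inv α_s₀)))
    (.of_maps (maps_mul δ_s₀ (maps_mul α_s₁ δ_o₀.lft)) (maps_inv α_o₁_lft))
    (.of_maps (maps_mul δ_o₁ (maps_mul α_o₀ δ_o₀.mid)) (maps_inv α_o₁_mid))
    (.of_maps (maps_mul δ_s₁ (maps_mul α_s₀ δ_o₀.rgt)) (maps_inv α_o₁_rgt))

lemma β_mul_δ_pow : β * δ * (β * δ) * (β * δ) = 1 := by
  have o₀ : MapsLinearly (β * δ).1 O₀ S₀.mid := maps_mul δ_o₀ β_o₁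
  have l : MapsLinearly (β * δ).1 S₀.lft S₀.rgt := maps_mul δ_s₀.lft β_s₁_lft
  have m : MapsLinearly (β * δ).1 S₀.mid O₁ := maps_mul δ_s₀.mid β_s₁_mid
  have r : MapsLinearly (β * δ).1 S₀.rgt S₁ := maps_mul δ_s₀.rgt β_s₁_rgt
  have o₁ : MapsLinearly (β * δ).1 O₁ O₀ := maps_mul δ_o₁ β_o₀
  have s₁ : MapsLinearly (β * δ).1 S₁ S₀.lft := maps_mul δ_s₁ β_s₀
  generalize β * δ = t at *
  exact TB.ext_base (.of_maps (maps_mul o₀ (maps_mul m o₁)) (maps_one _))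
    (.glue (.of_maps (maps_mul l (maps_mul r s₁)) (maps_one _))
      (.of_maps (maps_mul m (maps_mul o₁ o₀)) (maps_one _))
      (.of_maps (maps_mul r (maps_mul s₁ l)) (maps_one _)))
    (.of_maps (maps_mul o₁ (maps_mul o₀ m)) (maps_one _))
    (.of_maps (maps_mul s₁ (maps_mul l r)) (maps_one _))

lemma maps_conj {u g : TB} {I I' J J' : Interval} (h : MapsLinearly u.1 I I')
    (hg : MapsLinearly g.1 I J) (h' : MapsLinearly u.1 J J') :
    MapsLinearly (u * g * u⁻¹).1 I' J' :=
  maps_mul (maps_inv h) (maps_mul hg h')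

lemma β_sq : β * β = γ * β * (δ * γ * δ⁻¹) := by
  have c {I I' J J' : Interval} (h : MapsLinearly δ.1 I I') (hg : MapsLinearly γ.1 I J)
    (h' : MapsLinearly δ.1 J J') := maps_conj h hg h'
  generalize δ * γ * δ⁻¹ = g at *
  refine TB.ext_base (.of_maps (maps_mul β_o₀ β_o₀)
      (maps_mul (c δ_o₁ γ_o₁ δ_o₁) (maps_mul β_o₀ γ_o₀)))
    (.of_maps (maps_mul β_s₀ β_s₀.lft) (maps_mul (c δ_s₁ γ_s₁ δ_s₁) (maps_mul β_s₀ γ_s₀_lft)))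
    (.of_maps (maps_mul β_o₁ β_s₀.mid) (maps_mul (c δ_o₀ γ_o₀ δ_o₀) (maps_mul β_o₁ γ_s₀_mid)))
    (.glue ?_ ?_ (.glue ?_ ?_ ?_))
  · exact .of_maps (maps_mul β_s₁_lft β_s₀.rgt)
      (maps_mul (c δ_s₀.lft γ_s₀_lft δ_s₀.lft.lft) (maps_mul β_s₁_lft.lft γ_s₀_rgt_lft))
  · exact .of_maps (maps_mul β_s₁_mid β_o₁)
      (maps_mul (c δ_s₀.mid γ_s₀_mid δ_s₀.lft.mid) (maps_mul β_s₁_lft.mid γ_s₀_rgt_mid))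
  · exact .of_maps (maps_mul β_s₁_rgt.lft β_s₁_lft)
      (maps_mul (c δ_s₀.rgt.lft γ_s₀_rgt_lft δ_s₀.lft.rgt) (maps_mul β_s₁_lft.rgt γ_s₀_rgt_rgt))
  · exact .of_maps (maps_mul β_s₁_rgt.mid β_s₁_mid)
      (maps_mul (c δ_s₀.rgt.mid γ_s₀_rgt_mid δ_s₀.mid) (maps_mul β_s₁_mid γ_o₁))
  · exact .of_maps (maps_mul β_s₁_rgt.rgt β_s₁_rgt)
      (maps_mul (c δ_s₀.rgt.rgt γ_s₀_rgt_rgt δ_s₀.rgt) (maps_mul β_s₁_rgt γ_s₁))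

lemma γ_sq : γ * γ = β * γ * β⁻¹ * γ * (β * δ * β * γ * (β * δ * β)⁻¹) := by
  have c {I I' J J' : Interval} (h : MapsLinearly β.1 I I') (hg : MapsLinearly γ.1 I J)
    (h' : MapsLinearly β.1 J J') := maps_conj h hg h'
  have d {I I' J J' : Interval} (h : MapsLinearly (β * δ * β).1 I I') (hg : MapsLinearly γ.1 I J)
    (h' : MapsLinearly (β * δ * β).1 J J') := maps_conj h hg h'
  have s₀ : MapsLinearly (β * δ * β).1 S₀ S₀.rgt :=
    maps_mul β_s₀ (maps_mul δ_s₀.lft β_s₁_lft)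
  have o₀ : MapsLinearly (β * δ * β).1 O₀ S₀.mid := maps_mul β_o₀ (maps_mul δ_o₀ β_o₁)
  have r : MapsLinearly (β * δ * β).1 S₁.rgt S₀.lft := maps_mul β_s₁_rgt (maps_mul δ_s₁ β_s₀)
  have o₁ : MapsLinearly (β * δ * β).1 O₁ O₁ := maps_mul β_o₁ (maps_mul δ_s₀.mid β_s₁_mid)
  have l : MapsLinearly (β * δ * β).1 S₁.lft S₁ := maps_mul β_s₁_lft (maps_mul δ_s₀.rgt β_s₁_rgt)
  have m : MapsLinearly (β * δ * β).1 S₁.mid O₀ := maps_mul β_s₁_mid (maps_mul δ_o₁ β_o₀)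
  generalize β * δ * β = u at *
  generalize u * γ * u⁻¹ = gR at *
  generalize β * γ * β⁻¹ = gL at *
  refine TB.ext_base (.of_maps (maps_mul γ_o₀ γ_o₀)
      (maps_mul (d m γ_s₁.mid m) (maps_mul γ_o₀ (c β_o₀ γ_o₀ β_o₀))))
    (.glue ?_ ?_ (.glue ?_ ?_ (.glue ?_ ?_ ?_)))
    (.of_maps (maps_mul γ_o₁ γ_o₁)
      (maps_mul (d o₁ γ_o₁ o₁) (maps_mul γ_o₁ (c β_s₁_mid γ_s₁.mid β_s₁_mid))))
    (.of_maps (maps_mul γ_s₁ γ_s₁)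
      (maps_mul (d l γ_s₁.lft l) (maps_mul γ_s₁ (c β_s₁_rgt γ_s₁.rgt β_s₁_rgt))))
  · exact .of_maps (maps_mul γ_s₀_lft γ_s₀_lft.lft)
      (maps_mul (d r γ_s₁.rgt r) (maps_mul γ_s₀_lft (c β_s₀.lft γ_s₀_lft β_s₀.lft.lft)))
  · exact .of_maps (maps_mul γ_s₀_mid γ_s₀_lft.mid)
      (maps_mul (d o₀ γ_o₀ o₀) (maps_mul γ_s₀_mid (c β_s₀.mid γ_s₀_mid β_s₀.lft.mid)))
  · exact .of_maps (maps_mul γ_s₀_rgt_lft γ_s₀_lft.rgt)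
      (maps_mul (d s₀.lft γ_s₀_lft s₀.lft.lft)
        (maps_mul γ_s₀_rgt_lft.lft (c β_s₀.rgt.lft γ_s₀_rgt_lft β_s₀.lft.rgt)))
  · exact .of_maps (maps_mul γ_s₀_rgt_mid γ_s₀_mid)
      (maps_mul (d s₀.mid γ_s₀_mid s₀.lft.mid)
        (maps_mul γ_s₀_rgt_lft.mid (c β_s₀.rgt.mid γ_s₀_rgt_mid β_s₀.mid)))
  · exact .of_maps (maps_mul γ_s₀_rgt_rgt.lft γ_s₀_rgt_lft)
      (maps_mul (d s₀.rgt.lft γ_s₀_rgt_lft s₀.lft.rgt)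
        (maps_mul γ_s₀_rgt_lft.rgt (c β_s₀.rgt.rgt γ_s₀_rgt_rgt β_s₀.rgt)))
  · exact .of_maps (maps_mul γ_s₀_rgt_rgt.mid γ_s₀_rgt_mid)
      (maps_mul (d s₀.rgt.mid γ_s₀_rgt_mid s₀.mid)
        (maps_mul γ_s₀_rgt_mid (c β_o₁ γ_o₁ β_o₁)))
  · exact .of_maps (maps_mul γ_s₀_rgt_rgt.rgt γ_s₀_rgt_rgt)
      (maps_mul (d s₀.rgt.rgt γ_s₀_rgt_rgt s₀.rgt)
        (maps_mul γ_s₀_rgt_rgt (c β_s₁_lft γ_s₁.lft β_s₁_lft)))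

lemma αα_eq : α * α = δ * (α⁻¹ * δ * α) := by
  have h1 : δ * (δ * α * δ) * δ = δ * α⁻¹ * δ := by rw [α_inv]
  have h2 : α = δ * α⁻¹ * δ := by
    rw [← h1]
    calc α = 1 * α * 1 := by simp
      _ = (δ * δ) * α * (δ * δ) := by rw [δ_sq]
      _ = _ := by group
  calc α * α = (δ * α⁻¹ * δ) * α := by rw [← h2]
    _ = _ := by group

/-! ### The commutator subgroup, given generation -/

lemma generators_mem_commutator : γ ∈ commutator TB ∧ β ∈ commutator TB ∧ δ ∈ commutator TB := by
  have mem (x : TB) : x ∈ commutator TB ↔ Abelianization.of x = 1 := by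
    rw [← Abelianization.ker_of, MonoidHom.mem_ker]
  have hγ : Abelianization.of γ = 1 := by
    have h := congrArg Abelianization.of γ_sq
    simp only [map_mul, map_inv] at h
    generalize Abelianization.of γ = g at *
    generalize Abelianization.of β = b at *
    generalize Abelianization.of δ = d at *
    rw [mul_inv_cancel_comm, mul_inv_cancel_comm] at h
    exact mul_eq_left.1 h.symm
  have hβ : Abelianization.of β = 1 := by
    have h := congrArg Abelianization.of β_sq
    simp only [map_mul, map_inv, hγ, mul_one, one_mul, mul_inv_cancel] at h
    exact mul_eq_left.1 h
  have hδ : Abelianization.of δ = 1 := by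
    have h := congrArg Abelianization.of β_mul_δ_pow
    have h' := congrArg Abelianization.of δ_sq
    simp only [map_mul, map_one, hβ, one_mul] at h h'
    rwa [h', one_mul] at h
  exact ⟨(mem _).2 hγ, (mem _).2 hβ, (mem _).2 hδ⟩

/-- The subgroup generated by `β, γ, δ` and their conjugates by `α`. -/
def evenGroup : Subgroup TB :=
  Subgroup.closure {β, γ, δ, α⁻¹ * β * α, α⁻¹ * γ * α, α⁻¹ * δ * α}

lemma evenGroup_le_commutator : evenGroup ≤ commutator TB := by
  obtain ⟨hγ, hβ, hδ⟩ := generators_mem_commutator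
  have conj {x : TB} (h : x ∈ commutator TB) : α⁻¹ * x * α ∈ commutator TB := by
    have := (inferInstance : (commutator TB).Normal).conj_mem x h α⁻¹
    rwa [inv_inv] at this
  rw [evenGroup, Subgroup.closure_le]
  rintro x (rfl | rfl | rfl | rfl | rfl | rfl)
  exacts [hβ, hγ, hδ, conj hβ, conj hγ, conj hδ]

lemma α_conj_mem {x : TB} (hx : x ∈ evenGroup) : α⁻¹ * x * α ∈ evenGroup := by
  have m {y : TB} (h : y ∈ ({β, γ, δ, α⁻¹ * β * α, α⁻¹ * γ * α, α⁻¹ * δ * α} : Set TB)) :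
    y ∈ evenGroup := Subgroup.subset_closure h
  have hαα : α * α ∈ evenGroup := by
    rw [αα_eq]
    exact mul_mem (m (by simp)) (m (by simp))
  have tw {y : TB} (h : y ∈ evenGroup) : α⁻¹ * (α⁻¹ * y * α) * α ∈ evenGroup := by
    have := mul_mem (mul_mem (inv_mem hαα) h) hαα
    convert this using 1
    group
  induction hx using Subgroup.closure_induction with
  | mem x hx =>
    rcases hx with rfl | rfl | rfl | rfl | rfl | rfl
    exacts [m (by simp), m (by simp), m (by simp), tw (m (by simp)), tw (m (by simp)),
      tw (m (by simp))]
  | one => simp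
  | mul x y _ _ hx hy =>
    convert mul_mem hx hy using 1
    group
  | inv x _ hx =>
    convert inv_mem hx using 1
    group

lemma α_conj_mem' {x : TB} (hx : x ∈ evenGroup) : α * x * α⁻¹ ∈ evenGroup := by
  have m {y : TB} (h : y ∈ ({β, γ, δ, α⁻¹ * β * α, α⁻¹ * γ * α, α⁻¹ * δ * α} : Set TB)) :
    y ∈ evenGroup := Subgroup.subset_closure h
  have hαα : α * α ∈ evenGroup := by
    rw [αα_eq]
    exact mul_mem (m (by simp)) (m (by simp))
  have := mul_mem (mul_mem hαα (α_conj_mem hx)) (inv_mem hαα)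
  convert this using 1
  group

/-- If `α, β, γ, δ` generate `T_B`, then every element lies in `evenGroup` or in `α * evenGroup`. -/
lemma mem_or_mem_of_closure {f : TB} (hf : f ∈ Subgroup.closure {α, β, γ, δ}) :
    f ∈ evenGroup ∨ α * f ∈ evenGroup := by
  have m {y : TB} (h : y ∈ ({β, γ, δ, α⁻¹ * β * α, α⁻¹ * γ * α, α⁻¹ * δ * α} : Set TB)) :
    y ∈ evenGroup := Subgroup.subset_closure h
  have hαα : α * α ∈ evenGroup := by
    rw [αα_eq]
    exact mul_mem (m (by simp)) (m (by simp))
  induction hf using Subgroup.closure_induction with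
  | mem x hx =>
    rcases hx with rfl | rfl | rfl | rfl
    exacts [.inr hαα, .inl (m (by simp)), .inl (m (by simp)), .inl (m (by simp))]
  | one => exact .inl (one_mem _)
  | mul x y _ _ hx hy =>
    rcases hx with hx | hx <;> rcases hy with hy | hy
    · exact .inl (mul_mem hx hy)
    · right
      convert mul_mem (α_conj_mem' hx) hy using 1
      group
    · right
      convert mul_mem hx hy using 1
      group
    · left
      have := mul_mem (mul_mem (inv_mem hαα) (α_conj_mem' hx)) hy
      convert this using 1
      group
  | inv x _ hx =>
    rcases hx with hx | hx
    · exact .inl (inv_mem hx)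
    · right
      have := mul_mem (α_conj_mem' (inv_mem hx)) hαα
      convert this using 1
      group

/-! ### Generation of `T_B` by `α, β, γ, δ` -/

/-- The subgroup generated by `α, β, γ, δ`. -/
def genGroup : Subgroup TB := Subgroup.closure {α, β, γ, δ}

lemma α_mem : α ∈ genGroup := Subgroup.subset_closure (by simp)
lemma β_mem : β ∈ genGroup := Subgroup.subset_closure (by simp)
lemma γ_mem : γ ∈ genGroup := Subgroup.subset_closure (by simp)
lemma δ_mem : δ ∈ genGroup := Subgroup.subset_closure (by simp)

/-- `h` fixes all points that are not in the interior of `J`. -/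
def SuppIn (h : TB) (J : Interval) : Prop :=
  ∀ x, (∀ t ∈ Ioo (0 : ℝ) 1, x ≠ J.point t) → h.1 x = x

lemma SuppIn.one (J : Interval) : SuppIn 1 J := fun _ _ => rfl

lemma SuppIn.mul {g h : TB} {J : Interval} (hg : SuppIn g J) (hh : SuppIn h J) :
    SuppIn (g * h) J := by
  intro x hx
  change g.1 (h.1 x) = x
  rw [hh x hx, hg x hx]

lemma SuppIn.inv {g : TB} {J : Interval} (hg : SuppIn g J) : SuppIn g⁻¹ J := by
  intro x hx
  have := hg x hx
  conv_lhs => rw [← this]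
  exact g.1.symm_apply_apply x

lemma SuppIn.of_lft {g : TB} {J : Interval} (hg : SuppIn g J.lft) : SuppIn g J := by
  refine fun x hx => hg x fun t ht => ?_
  rw [Interval.lft_point]
  exact hx _ ⟨by linarith [ht.1], by linarith [ht.2]⟩

lemma SuppIn.of_mid {g : TB} {J : Interval} (hg : SuppIn g J.mid) : SuppIn g J := by
  refine fun x hx => hg x fun t ht => ?_
  rw [Interval.mid_point]
  exact hx _ ⟨by linarith [ht.1], by linarith [ht.2]⟩

lemma SuppIn.of_rgt {g : TB} {J : Interval} (hg : SuppIn g J.rgt) : SuppIn g J := by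
  refine fun x hx => hg x fun t ht => ?_
  rw [Interval.rgt_point]
  exact hx _ ⟨by linarith [ht.1], by linarith [ht.2]⟩

lemma SuppIn.maps {g : TB} {I J : Interval} (hg : SuppIn g J) (h : Off I J) :
    MapsLinearly g.1 I I := fun t ht => hg _ fun s hs => h t ht s hs

/-- `h` acts on `P` as the elementary rotation and is the identity elsewhere. -/
structure IsRotation (h : TB) (P : Interval) : Prop where
  ll : MapsLinearly h.1 P.lft.lft P.lft
  lm : MapsLinearly h.1 P.lft.mid P.mid
  lr : MapsLinearly h.1 P.lft.rgt P.rgt.lft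
  m : MapsLinearly h.1 P.mid P.rgt.mid
  r : MapsLinearly h.1 P.rgt P.rgt.rgt
  supp : SuppIn h P

lemma SuppIn.conj {g h : TB} {P Q : Interval} (hg : MapsLinearly g.1 P Q) (hh : SuppIn h Q) :
    SuppIn (g⁻¹ * h * g) P := by
  intro x hx
  change (g⁻¹).1 (h.1 (g.1 x)) = x
  rw [hh]
  · exact g.1.symm_apply_apply x
  · intro t ht e
    rw [← hg t (Ioo_subset_Icc_self ht)] at e
    exact hx t ht (g.1.injective e)

lemma IsRotation.conj {g h : TB} {P Q : Interval} (hg : MapsLinearly g.1 P Q)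
    (hh : IsRotation h Q) : IsRotation (g⁻¹ * h * g) P where
  ll := maps_mul hg.lft.lft (maps_mul hh.ll (maps_inv hg.lft))
  lm := maps_mul hg.lft.mid (maps_mul hh.lm (maps_inv hg.mid))
  lr := maps_mul hg.lft.rgt (maps_mul hh.lr (maps_inv hg.rgt.lft))
  m := maps_mul hg.mid (maps_mul hh.m (maps_inv hg.rgt.mid))
  r := maps_mul hg.rgt (maps_mul hh.r (maps_inv hg.rgt.rgt))
  supp := hh.supp.conj hg

/-- A point outside of the interior of a basic interval is in one of the other three. -/
lemma suppIn_of_maps {h : TB} {J A B C : Interval} (hA : MapsLinearly h.1 A A)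
    (hB : MapsLinearly h.1 B B) (hC : MapsLinearly h.1 C C)
    (hc : ∀ x, ∃ t ∈ Icc (0 : ℝ) 1, x = J.point t ∨ x = A.point t ∨ x = B.point t ∨ x = C.point t)
    (h0 : J.point 0 = A.point 1) (h1 : J.point 1 = B.point 0) : SuppIn h J := by
  intro x hx
  obtain ⟨t, ht, rfl | rfl | rfl | rfl⟩ := hc x
  · rcases eq_or_lt_of_le ht.1 with e | e
    · rw [← e, h0, hA 1 (by norm_num)]
    rcases eq_or_lt_of_le ht.2 with e' | e'
    · rw [e', h1, hB 0 (by norm_num)]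
    · exact absurd rfl (hx t ⟨e, e'⟩)
  exacts [hA t ht, hB t ht, hC t ht]

lemma isRotation_s₀ : IsRotation γ⁻¹ S₀ where
  ll := maps_inv γ_s₀_lft
  lm := maps_inv γ_s₀_mid
  lr := maps_inv γ_s₀_rgt_lft
  m := maps_inv γ_s₀_rgt_mid
  r := maps_inv γ_s₀_rgt_rgt
  supp := by
    refine suppIn_of_maps (maps_inv γ_o₀) (maps_inv γ_o₁) (maps_inv γ_s₁) (fun x => ?_) ?_ ?_
    · obtain ⟨t, ht, h⟩ := exists_base_point x
      exact ⟨t, ht, by tauto⟩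
    · simp only [S₀, O₀, iv_point]; norm_num
    · simp only [S₀, O₁, iv_point]; norm_num

lemma isRotation_o₁ : IsRotation (α⁻¹ * β⁻¹ * α) O₁ where
  ll := maps_mul α_o₁_lft.lft (maps_mul (maps_inv β_s₀) (maps_inv α_o₁_lft))
  lm := maps_mul α_o₁_lft.mid (maps_mul (maps_inv β_o₁) (maps_inv α_o₁_mid))
  lr := maps_mul α_o₁_lft.rgt (maps_mul (maps_inv β_s₁_lft) (maps_inv α_o₁_rgt.lft))
  m := maps_mul α_o₁_mid (maps_mul (maps_inv β_s₁_mid) (maps_inv α_o₁_rgt.mid))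
  r := maps_mul α_o₁_rgt (maps_mul (maps_inv β_s₁_rgt) (maps_inv α_o₁_rgt.rgt))
  supp := by
    have hb := maps_inv β_o₀
    refine suppIn_of_maps (A := S₀) (B := S₁) (C := O₀)
      (maps_mul α_s₀ (maps_mul hb.rgt (maps_inv α_s₀)))
      (maps_mul α_s₁ (maps_mul hb.lft (maps_inv α_s₁)))
      (maps_mul α_o₀ (maps_mul hb.mid (maps_inv α_o₀))) (fun x => ?_) ?_ ?_
    · obtain ⟨t, ht, h⟩ := exists_base_point x
      exact ⟨t, ht, by tauto⟩
    · simp only [S₀, O₁, iv_point]; norm_num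
    · simp only [S₁, O₁, iv_point]; norm_num

/-- Every standard interval is mapped linearly to `S₀` or `O₁` by an element of `genGroup`. -/
lemma Std.exists_maps {P : Interval} (h : Std P) :
    ∃ g ∈ genGroup, MapsLinearly g.1 P S₀ ∨ MapsLinearly g.1 P O₁ := by
  have hβ := inv_mem β_mem
  induction h with
  | o₀ => exact ⟨δ, δ_mem, .inr δ_o₀⟩
  | s₀ => exact ⟨1, one_mem _, .inl (maps_one _)⟩
  | o₁ => exact ⟨1, one_mem _, .inr (maps_one _)⟩
  | s₁ => exact ⟨δ, δ_mem, .inl δ_s₁⟩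
  | lft _ ih =>
    obtain ⟨g, hg, h | h⟩ := ih
    · exact ⟨_, mul_mem hβ hg, .inl (maps_mul h.lft (maps_inv β_s₀))⟩
    · exact ⟨_, mul_mem α_mem hg, .inl (maps_mul h.lft α_o₁_lft)⟩
  | mid _ ih =>
    obtain ⟨g, hg, h | h⟩ := ih
    · exact ⟨_, mul_mem hβ hg, .inr (maps_mul h.mid (maps_inv β_o₁))⟩
    · exact ⟨_, mul_mem α_mem hg, .inr (maps_mul h.mid α_o₁_mid)⟩
  | rgt _ ih =>
    obtain ⟨g, hg, h | h⟩ := ih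
    · exact ⟨_, mul_mem hβ (mul_mem δ_mem (mul_mem hβ hg)),
        .inl (maps_mul (maps_mul (maps_mul h.rgt (maps_inv β_s₁_lft)) δ_s₁.lft) (maps_inv β_s₀))⟩
    · exact ⟨_, mul_mem δ_mem (mul_mem α_mem hg),
        .inl (maps_mul (maps_mul h.rgt α_o₁_rgt) δ_s₁)⟩

lemma Std.exists_isRotation {P : Interval} (h : Std P) : ∃ g ∈ genGroup, IsRotation g P := by
  obtain ⟨g, hg, h | h⟩ := h.exists_maps
  · exact ⟨_, mul_mem (mul_mem (inv_mem hg) (inv_mem γ_mem)) hg, isRotation_s₀.conj h⟩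
  · exact ⟨_, mul_mem (mul_mem (inv_mem hg) (mul_mem (mul_mem (inv_mem α_mem) (inv_mem β_mem))
      α_mem)) hg, isRotation_o₁.conj h⟩

/-! ### Labelled trees -/

/-- Ternary trees with leaves labelled by intervals. -/
inductive LTree
  | leaf (A : Interval)
  | node (l m r : LTree)

/-- The labels of the leaves. -/
def LTree.labels : LTree → Multiset Interval
  | leaf A => {A}
  | node l m r => l.labels + (m.labels + r.labels)

/-- `f` maps the labels of the tree linearly onto the corresponding subintervals of `J`. -/
def Maps (f : TB) : LTree → Interval → Prop
  | .leaf A, J => MapsLinearly f.1 A J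
  | .node l m r, J => Maps f l J.lft ∧ Maps f m J.mid ∧ Maps f r J.rgt

lemma Maps.comp {f h : TB} {t : LTree} {J K : Interval} (ht : Maps f t J)
    (hh : MapsLinearly h.1 J K) : Maps (h * f) t K := by
  induction t generalizing J K with
  | leaf A => exact maps_mul ht hh
  | node l m r ihl ihm ihr =>
    exact ⟨ihl ht.1 hh.lft, ihm ht.2.1 hh.mid, ihr ht.2.2 hh.rgt⟩

/-- The interval `M` is the label of the middle child of some node. -/
inductive LTree.MidOcc (M : Interval) : LTree → Prop
  | here (l r) : MidOcc M (.node l (.leaf M) r)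
  | lft {l} (m r) : MidOcc M l → MidOcc M (.node l m r)
  | mid {m} (l r) : MidOcc M m → MidOcc M (.node l m r)
  | rgt {r} (l m) : MidOcc M r → MidOcc M (.node l m r)

lemma Maps.label_cases {f : TB} {t : LTree} {J M : Interval} (hJ : Std J) (ht : Maps f t J)
    (hM : M ∈ t.labels) :
    t = .leaf M ∨ t.MidOcc M ∨ ∃ K, IsSide K ∧ MapsLinearly f.1 M K := by
  induction t generalizing J with
  | leaf A =>
    rw [LTree.labels, Multiset.mem_singleton] at hM
    exact .inl (by rw [hM])
  | node l m r ihl ihm ihr =>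
    right
    simp only [LTree.labels, Multiset.mem_add] at hM
    rcases hM with h | h | h
    · rcases ihl hJ.lft ht.1 h with rfl | h | h
      exacts [.inr ⟨_, hJ.isSide_lft, ht.1⟩, .inl (.lft _ _ h), .inr h]
    · rcases ihm hJ.mid ht.2.1 h with rfl | h | h
      exacts [.inl (.here _ _), .inl (.mid _ _ h), .inr h]
    · rcases ihr hJ.rgt ht.2.2 h with rfl | h | h
      exacts [.inr ⟨_, hJ.isSide_rgt, ht.2.2⟩, .inl (.rgt _ _ h), .inr h]

/-- After composition with an element of `genGroup` supported in `J`, the label `M` is the middle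
child of a node whose other children are leaves, and the node can be collapsed to a leaf. -/
def Reducible (f : TB) (t : LTree) (J M : Interval) : Prop :=
  ∃ h ∈ genGroup, SuppIn h J ∧ ∃ A B s Q, t.labels = A ::ₘ M ::ₘ B ::ₘ s ∧
    MapsLinearly (h * f).1 A Q.lft ∧ MapsLinearly (h * f).1 M Q.mid ∧
    MapsLinearly (h * f).1 B Q.rgt ∧
    ∀ I, MapsLinearly (h * f).1 I Q → ∃ t' : LTree, Maps (h * f) t' J ∧ t'.labels = I ::ₘ s

lemma Reducible.of_mul {f g : TB} {t u : LTree} {J M : Interval} (h : Reducible (g * f) u J M)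
    (hg : g ∈ genGroup) (hs : SuppIn g J) (e : u.labels = t.labels) : Reducible f t J M := by
  obtain ⟨h, hh, hJ, A, B, s, Q, h1, h2, h3, h4, h5⟩ := h
  rw [← mul_assoc] at h2 h3 h4 h5
  exact ⟨h * g, mul_mem hh hg, hJ.mul hs, A, B, s, Q, e ▸ h1, h2, h3, h4, h5⟩

lemma Reducible.lft {f : TB} {l m r : LTree} {J M : Interval} (hJ : Std J)
    (hm : Maps f m J.mid) (hr : Maps f r J.rgt) (h : Reducible f l J.lft M) :
    Reducible f (.node l m r) J M := by
  obtain ⟨h, hh, hs, A, B, s, Q, h1, h2, h3, h4, h5⟩ := h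
  obtain ⟨-, -, o1, -, o2, -⟩ := hJ.off_children
  refine ⟨h, hh, hs.of_lft, A, B, s + (m.labels + r.labels), Q, ?_, h2, h3, h4, fun I hI => ?_⟩
  · simp [LTree.labels, h1]
  · obtain ⟨t', ht', e⟩ := h5 I hI
    exact ⟨.node t' m r, ⟨ht', hm.comp (hs.maps o1), hr.comp (hs.maps o2)⟩, by
      simp [LTree.labels, e]⟩

lemma Reducible.mid {f : TB} {l m r : LTree} {J M : Interval} (hJ : Std J)
    (hl : Maps f l J.lft) (hr : Maps f r J.rgt) (h : Reducible f m J.mid M) :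
    Reducible f (.node l m r) J M := by
  obtain ⟨h, hh, hs, A, B, s, Q, h1, h2, h3, h4, h5⟩ := h
  obtain ⟨o1, -, -, -, -, o2⟩ := hJ.off_children
  refine ⟨h, hh, hs.of_mid, A, B, s + (l.labels + r.labels), Q, ?_, h2, h3, h4, fun I hI => ?_⟩
  · simp only [LTree.labels, h1, ← Multiset.singleton_add]; abel
  · obtain ⟨t', ht', e⟩ := h5 I hI
    refine ⟨.node l t' r, ⟨hl.comp (hs.maps o1), ht', hr.comp (hs.maps o2)⟩, ?_⟩
    simp only [LTree.labels, e, ← Multiset.singleton_add]; abel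

lemma Reducible.rgt {f : TB} {l m r : LTree} {J M : Interval} (hJ : Std J)
    (hl : Maps f l J.lft) (hm : Maps f m J.mid) (h : Reducible f r J.rgt M) :
    Reducible f (.node l m r) J M := by
  obtain ⟨h, hh, hs, A, B, s, Q, h1, h2, h3, h4, h5⟩ := h
  obtain ⟨-, o1, -, o2, -, -⟩ := hJ.off_children
  refine ⟨h, hh, hs.of_rgt, A, B, s + (l.labels + m.labels), Q, ?_, h2, h3, h4, fun I hI => ?_⟩
  · simp only [LTree.labels, h1, ← Multiset.singleton_add]; abel
  · obtain ⟨t', ht', e⟩ := h5 I hI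
    refine ⟨.node l m t', ⟨hl.comp (hs.maps o1), hm.comp (hs.maps o2), ht'⟩, ?_⟩
    simp only [LTree.labels, e, ← Multiset.singleton_add]; abel

lemma reducible_here {f : TB} {l r : LTree} {J M : Interval} (hJ : Std J)
    (h : Maps f (.node l (.leaf M) r) J) : Reducible f (.node l (.leaf M) r) J M := by
  induction l generalizing f r J with
  | leaf A =>
    induction r generalizing f J with
    | leaf B =>
      refine ⟨1, one_mem _, .one _, A, B, 0, J, rfl, ?_, ?_, ?_, fun I hI => ⟨.leaf I, hI, rfl⟩⟩ <;>
      rw [one_mul]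
      exacts [h.1, h.2.1, h.2.2]
    | node a b c iha _ _ =>
      obtain ⟨g, hg, hr⟩ := hJ.exists_isRotation
      obtain ⟨h1, h2, h3, h4, h5⟩ := h
      have h1' : Maps (g⁻¹ * f) (.node (.leaf A) (.leaf M) a) J.lft :=
        ⟨h1.comp (t := .leaf A) (maps_inv hr.ll), h2.comp (t := .leaf M) (maps_inv hr.lm),
          h3.comp (maps_inv hr.lr)⟩
      refine Reducible.of_mul (u := .node (.node (.leaf A) (.leaf M) a) b c) ?_ (inv_mem hg)
        hr.supp.inv ?_
      · exact (iha hJ.lft h1').lft hJ (h4.comp (maps_inv hr.m)) (h5.comp (maps_inv hr.r))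
      · simp only [LTree.labels]; abel
  | node a b c _ _ ihc =>
    obtain ⟨g, hg, hr⟩ := hJ.exists_isRotation
    obtain ⟨⟨h1, h2, h3⟩, h4, h5⟩ := h
    have h1' : Maps (g * f) (.node c (.leaf M) r) J.rgt :=
      ⟨h3.comp hr.lr, h4.comp (t := .leaf M) hr.m, h5.comp hr.r⟩
    refine Reducible.of_mul (u := .node a b (.node c (.leaf M) r)) ?_ hg hr.supp ?_
    · exact (ihc hJ.rgt h1').rgt hJ (h1.comp hr.ll) (h2.comp hr.lm)
    · simp only [LTree.labels]; abel

lemma LTree.MidOcc.reducible {f : TB} {t : LTree} {J M : Interval} (hM : t.MidOcc M) (hJ : Std J)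
    (h : Maps f t J) : Reducible f t J M := by
  induction hM generalizing J with
  | here l r => exact reducible_here hJ h
  | lft m r _ ih => exact (ih hJ.lft h.1).lft hJ h.2.1 h.2.2
  | mid l r _ ih => exact (ih hJ.mid h.2.1).mid hJ h.1 h.2.2
  | rgt l m _ ih => exact (ih hJ.rgt h.2.2).rgt hJ h.1 h.2.1

/-- `f` maps the labels of four trees linearly onto subintervals of the four basic intervals. -/
def ForestMaps (f : TB) (a b c d : LTree) : Prop :=
  Maps f a O₀ ∧ Maps f b S₀ ∧ Maps f c O₁ ∧ Maps f d S₁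

/-- The labels of four trees. -/
def forestLabels (a b c d : LTree) : Multiset Interval :=
  a.labels + (b.labels + (c.labels + d.labels))

/-- The analogue of `Reducible` for four trees with the labels `L`. -/
def ForestReducible (f : TB) (L : Multiset Interval) (M : Interval) : Prop :=
  ∃ h ∈ genGroup, ∃ A B s Q, L = A ::ₘ M ::ₘ B ::ₘ s ∧
    MapsLinearly (h * f).1 A Q.lft ∧ MapsLinearly (h * f).1 M Q.mid ∧
    MapsLinearly (h * f).1 B Q.rgt ∧
    ∀ I, MapsLinearly (h * f).1 I Q →
      ∃ a b c d, ForestMaps (h * f) a b c d ∧ forestLabels a b c d = I ::ₘ s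

lemma ForestReducible.of_mul {f g : TB} {L L' : Multiset Interval} {M : Interval}
    (h : ForestReducible (g * f) L' M) (hg : g ∈ genGroup) (e : L' = L) :
    ForestReducible f L M := by
  obtain ⟨h, hh, A, B, s, Q, h1, h2, h3, h4, h5⟩ := h
  rw [← mul_assoc] at h2 h3 h4 h5
  exact ⟨h * g, mul_mem hh hg, A, B, s, Q, e ▸ h1, h2, h3, h4, h5⟩

lemma ForestMaps.reducible_of_midOcc {f : TB} {a b c d : LTree} (h : ForestMaps f a b c d)
    {M : Interval} (hM : a.MidOcc M ∨ b.MidOcc M ∨ c.MidOcc M ∨ d.MidOcc M) :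
    ForestReducible f (forestLabels a b c d) M := by
  obtain ⟨ha, hb, hc, hd⟩ := h
  obtain ⟨⟨o01, o02, o03⟩, ⟨o10, o12, o13⟩, ⟨o20, o21, o23⟩, o30, o31, o32⟩ := off_base
  rcases hM with hM | hM | hM | hM
  · obtain ⟨h, hh, hs, A, B, s, Q, h1, h2, h3, h4, h5⟩ := hM.reducible .o₀ ha
    refine ⟨h, hh, A, B, s + (b.labels + (c.labels + d.labels)), Q, ?_, h2, h3, h4,
      fun I hI => ?_⟩
    · simp only [forestLabels, h1, ← Multiset.singleton_add]; abel
    · obtain ⟨t', ht', e⟩ := h5 I hI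
      refine ⟨t', b, c, d, ⟨ht', hb.comp (hs.maps o10), hc.comp (hs.maps o20),
        hd.comp (hs.maps o30)⟩, ?_⟩
      simp only [forestLabels, e, ← Multiset.singleton_add]; abel
  · obtain ⟨h, hh, hs, A, B, s, Q, h1, h2, h3, h4, h5⟩ := hM.reducible .s₀ hb
    refine ⟨h, hh, A, B, s + (a.labels + (c.labels + d.labels)), Q, ?_, h2, h3, h4,
      fun I hI => ?_⟩
    · simp only [forestLabels, h1, ← Multiset.singleton_add]; abel
    · obtain ⟨t', ht', e⟩ := h5 I hI
      refine ⟨a, t', c, d, ⟨ha.comp (hs.maps o01), ht', hc.comp (hs.maps o21),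
        hd.comp (hs.maps o31)⟩, ?_⟩
      simp only [forestLabels, e, ← Multiset.singleton_add]; abel
  · obtain ⟨h, hh, hs, A, B, s, Q, h1, h2, h3, h4, h5⟩ := hM.reducible .o₁ hc
    refine ⟨h, hh, A, B, s + (a.labels + (b.labels + d.labels)), Q, ?_, h2, h3, h4,
      fun I hI => ?_⟩
    · simp only [forestLabels, h1, ← Multiset.singleton_add]; abel
    · obtain ⟨t', ht', e⟩ := h5 I hI
      refine ⟨a, b, t', d, ⟨ha.comp (hs.maps o02), hb.comp (hs.maps o12), ht',
        hd.comp (hs.maps o32)⟩, ?_⟩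
      simp only [forestLabels, e, ← Multiset.singleton_add]; abel
  · obtain ⟨h, hh, hs, A, B, s, Q, h1, h2, h3, h4, h5⟩ := hM.reducible .s₁ hd
    refine ⟨h, hh, A, B, s + (a.labels + (b.labels + c.labels)), Q, ?_, h2, h3, h4,
      fun I hI => ?_⟩
    · simp only [forestLabels, h1, ← Multiset.singleton_add]; abel
    · obtain ⟨t', ht', e⟩ := h5 I hI
      refine ⟨a, b, c, t', ⟨ha.comp (hs.maps o03), hb.comp (hs.maps o13), hc.comp (hs.maps o23),
        ht'⟩, ?_⟩
      simp only [forestLabels, e, ← Multiset.singleton_add]; abel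

lemma ForestMaps.reducible_of_leaf {f : TB} {a b d : LTree} {M : Interval}
    (h : ForestMaps f a b (.leaf M) d) (hL : 4 < (forestLabels a b (.leaf M) d).card) :
    ForestReducible f (forestLabels a b (.leaf M) d) M := by
  obtain ⟨ha, hb, hc, hd⟩ := h
  cases d with
  | node d₁ d₂ d₃ =>
    have : ForestMaps (β * f) a (.node b (.leaf M) d₁) d₂ d₃ :=
      ⟨ha.comp β_o₀, ⟨hb.comp β_s₀, hc.comp (t := .leaf M) β_o₁, hd.1.comp β_s₁_lft⟩,
        hd.2.1.comp β_s₁_mid, hd.2.2.comp β_s₁_rgt⟩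
    refine (this.reducible_of_midOcc (.inr (.inl (.here _ _)))).of_mul β_mem ?_
    simp only [forestLabels, LTree.labels]; abel
  | leaf D =>
  cases b with
  | node b₁ b₂ b₃ =>
    have : ForestMaps (β⁻¹ * f) a b₁ b₂ (.node b₃ (.leaf M) (.leaf D)) :=
      ⟨ha.comp (maps_inv β_o₀), hb.1.comp (maps_inv β_s₀), hb.2.1.comp (maps_inv β_o₁),
        hb.2.2.comp (maps_inv β_s₁_lft), hc.comp (t := .leaf M) (maps_inv β_s₁_mid),
        hd.comp (t := .leaf D) (maps_inv β_s₁_rgt)⟩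
    refine (this.reducible_of_midOcc (.inr (.inr (.inr (.here _ _))))).of_mul (inv_mem β_mem) ?_
    simp only [forestLabels, LTree.labels]; abel
  | leaf B =>
  cases a with
  | node a₁ a₂ a₃ =>
    have : ForestMaps (α⁻¹ * f) a₂ a₃ (.node (.leaf B) (.leaf M) (.leaf D)) a₁ :=
      ⟨ha.2.1.comp (maps_inv α_o₀), ha.2.2.comp (maps_inv α_s₀),
        ⟨hb.comp (t := .leaf B) (maps_inv α_o₁_lft), hc.comp (t := .leaf M) (maps_inv α_o₁_mid),
        hd.comp (t := .leaf D) (maps_inv α_o₁_rgt)⟩, ha.1.comp (maps_inv α_s₁)⟩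
    refine (this.reducible_of_midOcc (.inr (.inr (.inl (.here _ _))))).of_mul (inv_mem α_mem) ?_
    simp only [forestLabels, LTree.labels]; abel
  | leaf A => simp [forestLabels, LTree.labels] at hL

lemma ForestMaps.reducible {f : TB} {a b c d : LTree} (h : ForestMaps f a b c d)
    (hL : 4 < (forestLabels a b c d).card) {M : Interval} (hM : M ∈ forestLabels a b c d)
    (hlam : M.ends ∈ lamination) : ForestReducible f (forestLabels a b c d) M := by
  have key : ∀ K, IsSide K → ¬ MapsLinearly f.1 M K := by
    intro K hK hMK
    have := TB.map_mem_lamination f hlam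
    rw [hMK.map_ends] at this
    exact hK.ends_notMem this
  have hM' := hM
  simp only [forestLabels, Multiset.mem_add] at hM'
  rcases hM' with h' | h' | h' | h'
  · rcases h.1.label_cases .o₀ h' with rfl | h' | ⟨K, hK, h'⟩
    · have hδ : ForestMaps (δ * f) c d (.leaf M) b :=
        ⟨h.2.2.1.comp δ_o₁, h.2.2.2.comp δ_s₁, h.1.comp δ_o₀, h.2.1.comp δ_s₀⟩
      have e : forestLabels c d (.leaf M) b = forestLabels (.leaf M) b c d := by
        simp only [forestLabels]; abel
      exact (hδ.reducible_of_leaf (by rwa [e])).of_mul δ_mem e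
    · exact h.reducible_of_midOcc (.inl h')
    · exact absurd h' (key K hK)
  · rcases h.2.1.label_cases .s₀ h' with rfl | h' | ⟨K, hK, h'⟩
    · exact absurd h.2.1 (key _ ⟨_, _, s₀_eq⟩)
    · exact h.reducible_of_midOcc (.inr (.inl h'))
    · exact absurd h' (key K hK)
  · rcases h.2.2.1.label_cases .o₁ h' with rfl | h' | ⟨K, hK, h'⟩
    · exact h.reducible_of_leaf hL
    · exact h.reducible_of_midOcc (.inr (.inr (.inl h')))
    · exact absurd h' (key K hK)
  · rcases h.2.2.2.label_cases .s₁ h' with rfl | h' | ⟨K, hK, h'⟩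
    · exact absurd h.2.2.2 (key _ ⟨_, _, s₁_eq⟩)
    · exact h.reducible_of_midOcc (.inr (.inr (.inr h')))
    · exact absurd h' (key K hK)

lemma IsArcDiagram.exists_forest {R : Diagram} (hR : IsArcDiagram R) (f : TB)
    (X : Multiset LTree) (hX : Multiset.Rel (Maps f) X R.intervals) :
    ∃ a b c d, ForestMaps f a b c d ∧ forestLabels a b c d = (X.map LTree.labels).sum := by
  induction hR generalizing X with
  | refl =>
    rw [base_intervals] at hX
    obtain ⟨a, X₁, ha, h₁, rfl⟩ := Multiset.rel_cons_right.1 hX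
    obtain ⟨b, X₂, hb, h₂, rfl⟩ := Multiset.rel_cons_right.1 h₁
    obtain ⟨c, X₃, hc, h₃, rfl⟩ := Multiset.rel_cons_right.1 h₂
    rw [← Multiset.cons_zero] at h₃
    obtain ⟨d, X₄, hd, h₄, rfl⟩ := Multiset.rel_cons_right.1 h₃
    rw [Multiset.rel_zero_right] at h₄
    subst h₄
    exact ⟨a, b, c, d, ⟨ha, hb, hc, hd⟩, by simp [forestLabels]⟩
  | tail _ hs ih =>
    obtain ⟨I, s, A⟩ := hs
    simp only [Interval.children_eq, Multiset.cons_add, Multiset.singleton_add] at hX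
    obtain ⟨a, X₁, ha, h₁, rfl⟩ := Multiset.rel_cons_right.1 hX
    obtain ⟨b, X₂, hb, h₂, rfl⟩ := Multiset.rel_cons_right.1 h₁
    obtain ⟨c, X₃, hc, h₃, rfl⟩ := Multiset.rel_cons_right.1 h₂
    obtain ⟨a', b', c', d', h, e⟩ :=
      ih (.node a b c ::ₘ X₃) (.cons (a := .node a b c) ⟨ha, hb, hc⟩ h₃)
    refine ⟨a', b', c', d', h, ?_⟩
    rw [e]
    simp [LTree.labels, add_assoc]

lemma LTree.card_labels (t : LTree) : (∃ A, t = .leaf A) ∧ 0 < t.labels.card ∨ 2 < t.labels.card := by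
  have pos : ∀ t : LTree, 0 < t.labels.card := by
    intro t
    induction t with
    | leaf A => simp [LTree.labels]
    | node l m r ihl ihm ihr => simp only [LTree.labels, Multiset.card_add]; omega
  cases t with
  | leaf A => exact .inl ⟨⟨A, rfl⟩, pos _⟩
  | node l m r =>
    right
    have := pos l
    have := pos m
    have := pos r
    simp only [LTree.labels, Multiset.card_add]; omega

lemma mem_genGroup_of_base {f : TB} {a b c d : LTree} (h : ForestMaps f a b c d)
    (hL : forestLabels a b c d = Diagram.base.intervals) : f ∈ genGroup := by
  have hcard := congrArg Multiset.card hL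
  simp only [forestLabels, base_intervals, Multiset.card_add, Multiset.card_cons,
    Multiset.card_singleton] at hcard
  have ca := a.card_labels
  have cb := b.card_labels
  have cc := c.card_labels
  have cd := d.card_labels
  have leaves : (∃ A, a = .leaf A) ∧ (∃ A, b = .leaf A) ∧ (∃ A, c = .leaf A) ∧
      ∃ A, d = .leaf A := by
    rcases ca with ca | ca <;> rcases cb with cb | cb <;> rcases cc with cc | cc <;>
      rcases cd with cd | cd <;> first | omega | exact ⟨ca.1, cb.1, cc.1, cd.1⟩
  obtain ⟨⟨A, rfl⟩, ⟨B, rfl⟩, ⟨C, rfl⟩, ⟨D, rfl⟩⟩ := leaves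
  obtain ⟨ha, hb, hc, hd⟩ := h
  change MapsLinearly _ _ _ at ha hb hc hd
  simp only [forestLabels, LTree.labels] at hL
  have mem (x : Interval) (hx : x = A ∨ x = B ∨ x = C ∨ x = D) :
      x ∈ Diagram.base.intervals := by
    rw [← hL]; simp; tauto
  have memb (x : Interval) (hx : x = O₀ ∨ x = S₀ ∨ x = O₁ ∨ x = S₁) :
      x ∈ Diagram.base.intervals := by
    rw [base_intervals]; simpa using hx
  have next {X Y Z J K : Interval} (hX : MapsLinearly f.1 X J) (hY : MapsLinearly f.1 Y K)
      (hJK : J.point 1 = K.point 0) (hXZ : X.point 1 = Z.point 0)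
      (mY : Y = A ∨ Y = B ∨ Y = C ∨ Y = D) (mZ : Z = O₀ ∨ Z = S₀ ∨ Z = O₁ ∨ Z = S₁) : Y = Z := by
    refine IsArcDiagram.eq_of_left (D := Diagram.base) .refl (mem _ mY) (memb _ mZ) ?_
    rw [← hXZ]
    apply f.1.injective
    rw [hX 1 (by norm_num), hY 0 (by norm_num), hJK]
  have e1 : O₁.point 1 = S₁.point 0 := by simp only [O₁, S₁, iv_point]; norm_num
  have e2 : S₁.point 1 = O₀.point 0 := by
    simp only [O₀, S₁, iv_point]; exact coe_sub_one _ _ (by norm_num)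
  have e3 : O₀.point 1 = S₀.point 0 := by simp only [O₀, S₀, iv_point]; norm_num
  have e4 : S₀.point 1 = O₁.point 0 := by simp only [O₁, S₀, iv_point]; norm_num
  have hside : ¬ IsSide C := by
    intro hC
    have := TB.map_mem_lamination_iff f (s := C.ends)
    rw [hc.map_ends] at this
    exact hC.ends_notMem (this.1 o₁_ends_mem)
  have hC := mem C (by simp)
  rw [base_intervals] at hC
  simp only [Multiset.mem_cons, Multiset.mem_singleton] at hC
  rcases hC with rfl | rfl | rfl | rfl
  · obtain rfl := next hc hd e1 e3 (by simp) (by simp)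
    obtain rfl := next hd ha e2 e4 (by simp) (by simp)
    obtain rfl := next ha hb e3 e1 (by simp) (by simp)
    rw [TB.ext_base (.of_maps hc δ_o₀) (.of_maps hd δ_s₀) (.of_maps ha δ_o₁) (.of_maps hb δ_s₁)]
    exact δ_mem
  · exact absurd ⟨_, _, s₀_eq⟩ hside
  · obtain rfl := next hc hd e1 e1 (by simp) (by simp)
    obtain rfl := next hd ha e2 e2 (by simp) (by simp)
    obtain rfl := next ha hb e3 e3 (by simp) (by simp)
    rw [TB.ext_base (.of_maps ha (maps_one _)) (.of_maps hb (maps_one _))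
      (.of_maps hc (maps_one _)) (.of_maps hd (maps_one _))]
    exact one_mem _
  · exact absurd ⟨_, _, s₁_eq⟩ hside

lemma IsArcDiagram.card_intervals {D : Diagram} (h : IsArcDiagram D) :
    4 ≤ D.intervals.card := by
  induction h with
  | refl => simp [base_intervals]
  | tail _ hs ih =>
    obtain ⟨I, s, A⟩ := hs
    simp [Interval.children_eq] at ih ⊢
    omega

lemma IsArcDiagram.mem_genGroup {D : Diagram} (hD : IsArcDiagram D) (f : TB) (a b c d : LTree)
    (h : ForestMaps f a b c d) (hL : forestLabels a b c d = D.intervals) : f ∈ genGroup := by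
  induction hD generalizing f a b c d with
  | refl => exact mem_genGroup_of_base h hL
  | tail hD hs ih =>
    have hD' := Relation.ReflTransGen.tail hD hs
    have hcard := IsArcDiagram.card_intervals hD
    obtain ⟨I, s, A⟩ := hs
    have hI : Std I := IsArcDiagram.std hD I (by simp)
    have hc : I.children + s = I.lft ::ₘ I.mid ::ₘ I.rgt ::ₘ s := by
      simp [Interval.children_eq]
    change forestLabels a b c d = I.children + s at hL
    rw [hc] at hL
    have hr := h.reducible (M := I.mid) (by rw [hL]; simp at hcard ⊢; omega)
      (by rw [hL]; simp) hI.mid_ends_mem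
    rw [hL] at hr
    obtain ⟨g, hg, A', B', s', Q, e, h1, h2, h3, h4⟩ := hr
    have memL : ∀ X ∈ I.lft ::ₘ I.mid ::ₘ I.rgt ::ₘ s, X ∈
        (⟨I.children + s, insert I.primaryArc A⟩ : Diagram).intervals := by
      intro X hX
      change X ∈ I.children + s
      rwa [hc]
    have eA : A' = I.lft := by
      refine IsArcDiagram.eq_of_right hD' (memL _ (by rw [e]; simp)) (memL _ (by simp)) ?_
      apply (g * f).1.injective
      rw [h1 1 (by norm_num)]
      have := h2 0 (by norm_num)
      simp only [Interval.mid_point, Interval.lft_point] at this ⊢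
      norm_num at this ⊢
      exact this.symm
    have eB : B' = I.rgt := by
      refine IsArcDiagram.eq_of_left hD' (memL _ (by rw [e]; simp)) (memL _ (by simp)) ?_
      apply (g * f).1.injective
      rw [h3 0 (by norm_num)]
      have := h2 1 (by norm_num)
      simp only [Interval.mid_point, Interval.rgt_point] at this ⊢
      norm_num at this ⊢
      exact this.symm
    subst eA eB
    simp only [Multiset.cons_inj_right] at e
    subst e
    obtain ⟨a', b', c', d', h5, h6⟩ := h4 I (.glue h1 h2 h3)
    have := ih (g * f) a' b' c' d' h5 h6
    have := mul_mem (inv_mem hg) this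
    rwa [inv_mul_cancel_left] at this

/-- `T_B` is generated by `α, β, γ, δ`. -/
lemma mem_genGroup (f : TB) : f ∈ genGroup := by
  obtain ⟨D, R, hD, hR, h⟩ := f.2
  obtain ⟨a, b, c, d, h1, h2⟩ := hR.exists_forest f (D.intervals.map LTree.leaf) (by
    rw [Multiset.rel_map_left]
    exact h.1)
  refine hD.mem_genGroup f a b c d h1 ?_
  rw [h2, Multiset.map_map]
  have : LTree.labels ∘ LTree.leaf = fun A => ({A} : Multiset Interval) := rfl
  rw [this, Multiset.sum_map_singleton]

/-! ### Chords of the unit disk -/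

/-- The arc of the lamination with center `2 k / 2 ^ n` and radius `1 / (3 * 2 ^ n)`. -/
def arc (k : ℤ) (n : ℕ) : Sym2 UnitAddCircle :=
  s((((6 * k - 1) / (3 * 2 ^ n) : ℝ) : UnitAddCircle),
    (((6 * k + 1) / (3 * 2 ^ n) : ℝ) : UnitAddCircle))

lemma arc_mem (k : ℤ) (n : ℕ) : arc k n ∈ lamination := ⟨k, n, rfl⟩

/-- The affine function on the plane whose zero set is the line through the endpoints of an arc. -/
def ell (k : ℤ) (n : ℕ) (z : ℂ) : ℝ :=
  z.re * Real.cos (2 * Real.pi * (2 * k / 2 ^ n)) + z.im * Real.sin (2 * Real.pi * (2 * k / 2 ^ n))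
    - Real.cos (2 * Real.pi * (1 / (3 * 2 ^ n)))

lemma circlePoint_coe (x : ℝ) : circlePoint x =
    ⟨Real.cos (2 * Real.pi * x), Real.sin (2 * Real.pi * x)⟩ := by
  rw [circlePoint, AddCircle.toCircle_apply_mk, Circle.coe_exp]
  apply Complex.ext
  · rw [Complex.exp_ofReal_mul_I_re]; simp
  · rw [Complex.exp_ofReal_mul_I_im]; simp

lemma norm_circlePoint (x : UnitAddCircle) : ‖circlePoint x‖ = 1 := Circle.norm_coe _

lemma continuous_circlePoint : Continuous circlePoint :=
  continuous_subtype_val.comp AddCircle.continuous_toCircle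

lemma circlePoint_injective : Function.Injective circlePoint :=
  Subtype.val_injective.comp (AddCircle.injective_toCircle one_ne_zero)

lemma continuous_ell (k : ℤ) (n : ℕ) : Continuous (ell k n) := by
  unfold ell
  fun_prop

lemma ell_comb (k : ℤ) (n : ℕ) {a b : ℝ} (h : a + b = 1) (z w : ℂ) :
    ell k n (a • z + b • w) = a * ell k n z + b * ell k n w := by
  simp only [ell, Complex.add_re, Complex.add_im, Complex.real_smul, Complex.mul_re,
    Complex.mul_im, Complex.ofReal_re, Complex.ofReal_im]
  linear_combination Real.cos (2 * Real.pi * (1 / (3 * 2 ^ n))) * h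

lemma ell_circle (k : ℤ) (n : ℕ) (x : ℝ) : ell k n (circlePoint x) =
    Real.cos (2 * Real.pi * (x - 2 * k / 2 ^ n)) - Real.cos (2 * Real.pi * (1 / (3 * 2 ^ n))) := by
  rw [ell, circlePoint_coe, mul_sub, Real.cos_sub]

lemma cos_two_pi_sub_int (y : ℝ) (j : ℤ) :
    Real.cos (2 * Real.pi * y) = Real.cos (2 * Real.pi * |y - j|) := by
  rw [← abs_of_pos Real.two_pi_pos, ← abs_mul, Real.cos_abs, abs_of_pos Real.two_pi_pos, mul_sub,
    mul_comm (2 * Real.pi) (j : ℝ), Real.cos_sub_int_mul_two_pi]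

lemma cos_two_pi_lt {a b : ℝ} (ha : 0 ≤ a) (hb : b ≤ 1 / 2) (hab : a < b) :
    Real.cos (2 * Real.pi * b) < Real.cos (2 * Real.pi * a) := by
  have := Real.pi_pos
  apply Real.strictAntiOn_cos ⟨by positivity, by nlinarith⟩ ⟨by nlinarith, by nlinarith⟩
  nlinarith

lemma rad_pos (n : ℕ) : (0 : ℝ) < 1 / (3 * 2 ^ n) := by positivity

lemma rad_le (n : ℕ) : (1 : ℝ) / (3 * 2 ^ n) ≤ 1 / 2 := by
  have : (1 : ℝ) ≤ 2 ^ n := one_le_pow₀ (by norm_num)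
  rw [div_le_div_iff₀ (by positivity) (by norm_num)]
  linarith

lemma ell_pos {k : ℤ} {n : ℕ} {x : ℝ} (j : ℤ) (h : |x - 2 * k / 2 ^ n - j| < 1 / (3 * 2 ^ n)) :
    0 < ell k n (circlePoint x) := by
  rw [ell_circle, sub_pos, cos_two_pi_sub_int (x - 2 * k / 2 ^ n) j]
  exact cos_two_pi_lt (abs_nonneg _) (rad_le n) h

lemma ell_eq_zero {k : ℤ} {n : ℕ} {x : ℝ} (j : ℤ)
    (h : |x - 2 * k / 2 ^ n - j| = 1 / (3 * 2 ^ n)) : ell k n (circlePoint x) = 0 := by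
  rw [ell_circle, sub_eq_zero, cos_two_pi_sub_int (x - 2 * k / 2 ^ n) j, h]

lemma ell_neg {k : ℤ} {n : ℕ} {x : ℝ}
    (h : ∀ j : ℤ, 1 / (3 * 2 ^ n) < |x - 2 * k / 2 ^ n - j|) : ell k n (circlePoint x) < 0 := by
  rw [ell_circle, sub_neg, cos_two_pi_sub_int (x - 2 * k / 2 ^ n)
    (round (x - 2 * k / 2 ^ n))]
  exact cos_two_pi_lt (rad_pos n).le (abs_sub_round _) (h _)

/-- The endpoint `(6 k + e) / (3 * 2 ^ n)` of an arc, where `e = 1` or `e = -1`. -/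
def endpt (k : ℤ) (n : ℕ) (e : ℤ) : ℝ := (6 * k + e) / (3 * 2 ^ n)

lemma arc_eq (k : ℤ) (n : ℕ) : arc k n =
    s((endpt k n (-1) : UnitAddCircle), (endpt k n 1 : UnitAddCircle)) := by
  rw [arc, endpt, endpt]
  push_cast
  rfl

lemma ell_endpt (k : ℤ) (n : ℕ) {e : ℤ} (he : e = 1 ∨ e = -1) :
    ell k n (circlePoint (endpt k n e)) = 0 := by
  refine ell_eq_zero 0 ?_
  have : endpt k n e - 2 * k / 2 ^ n - (0 : ℤ) = e * (1 / (3 * 2 ^ n)) := by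
    rw [endpt]; push_cast; field_simp; ring
  rw [this, abs_mul, abs_of_pos (rad_pos n)]
  rcases he with rfl | rfl <;> simp

lemma three_not_dvd_two_pow (d : ℕ) : ¬ (3 : ℤ) ∣ 2 ^ d := by
  intro h
  have := Int.prime_three.dvd_of_dvd_pow h
  omega

/-- The endpoints of an arc are outside of the intervals of arcs of smaller radius. -/
lemma ell_neg_of_lt {k k' : ℤ} {n n' : ℕ} (h : n < n') {e : ℤ} (he : e = 1 ∨ e = -1) :
    ell k' n' (circlePoint (endpt k n e)) < 0 := by
  obtain ⟨d, rfl⟩ := Nat.exists_eq_add_of_lt h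
  refine ell_neg fun j => ?_
  have h1 : endpt k n e - 2 * k' / 2 ^ (n + d + 1) - j =
      ((((6 * k + e) * 2 ^ (d + 1) - 6 * k' - 3 * 2 ^ (n + d + 1) * j : ℤ)) : ℝ) *
        (1 / (3 * 2 ^ (n + d + 1))) := by
    rw [endpt]; push_cast; field_simp; ring
  rw [h1, abs_mul, abs_of_pos (rad_pos _)]
  refine lt_mul_of_one_lt_left (rad_pos _) ?_
  rw [← Int.cast_abs]
  have h3 : ¬ (3 : ℤ) ∣ (6 * k + e) * 2 ^ (d + 1) := by
    rw [Int.prime_three.dvd_mul, not_or]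
    refine ⟨?_, three_not_dvd_two_pow _⟩
    rcases he with rfl | rfl <;> omega
  have h2 : (6 * k + e) * 2 ^ (d + 1) = 2 * ((6 * k + e) * 2 ^ d) := by ring
  have h4 : (3 : ℤ) * 2 ^ (n + d + 1) * j = 6 * (2 ^ (n + d) * j) := by ring
  rw [h4]
  rw [h2] at h3 ⊢
  generalize (6 * k + e) * 2 ^ d = x at *
  generalize 2 ^ (n + d) * j = y at *
  have : 1 < |2 * x - 6 * k' - 6 * y| := by
    rw [lt_abs]; omega
  exact_mod_cast this

/-- Arcs of equal radius either agree or the endpoints of one are outside of the other. -/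
lemma ell_neg_of_eq {k k' : ℤ} {n : ℕ} (h : ∀ j : ℤ, 2 * k ≠ 2 * k' + j * 2 ^ n)
    {e : ℤ} (he : e = 1 ∨ e = -1) : ell k' n (circlePoint (endpt k n e)) < 0 := by
  refine ell_neg fun j => ?_
  have h1 : endpt k n e - 2 * k' / 2 ^ n - j =
      ((3 * (2 * k - (2 * k' + j * 2 ^ n)) + e : ℤ) : ℝ) * (1 / (3 * 2 ^ n)) := by
    rw [endpt]; push_cast; field_simp; ring
  rw [h1, abs_mul, abs_of_pos (rad_pos _)]
  refine lt_mul_of_one_lt_left (rad_pos _) ?_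
  rw [← Int.cast_abs]
  have hj := sub_ne_zero.2 (h j)
  generalize 2 * k - (2 * k' + j * 2 ^ n) = x at *
  have : 1 < |3 * x + e| := by
    rw [lt_abs]; omega
  exact_mod_cast this

/-- The endpoints of an arc are on one side of every arc of larger radius. -/
lemma ell_mul_pos_of_lt {k k' : ℤ} {n n' : ℕ} (h : n' < n) :
    0 < ell k' n' (circlePoint (endpt k n (-1))) * ell k' n' (circlePoint (endpt k n 1)) := by
  obtain ⟨d, rfl⟩ := Nat.exists_eq_add_of_lt h
  have h1 (e j : ℤ) : endpt k (n' + d + 1) e - 2 * k' / 2 ^ n' - j =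
      ((6 * (k - k' * 2 ^ (d + 1) - 2 ^ (n' + d) * j) + e : ℤ) : ℝ) *
        (1 / (3 * 2 ^ (n' + d + 1))) := by
    rw [endpt]; push_cast; field_simp; ring
  have h2 : (1 : ℝ) / (3 * 2 ^ n') = ((2 * 2 ^ d : ℤ) : ℝ) * (1 / (3 * 2 ^ (n' + d + 1))) := by
    push_cast; field_simp; ring
  have hp : (0 : ℤ) < 2 ^ d := by positivity
  have h3 := three_not_dvd_two_pow d
  by_cases hj : ∃ j : ℤ, |6 * (k - k' * 2 ^ (d + 1) - 2 ^ (n' + d) * j)| < 2 * 2 ^ d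
  · obtain ⟨j, hj⟩ := hj
    rw [abs_lt] at hj
    have key : ∀ e : ℤ, e = 1 ∨ e = -1 → 0 < ell k' n' (circlePoint (endpt k (n' + d + 1) e)) := by
      intro e he
      refine ell_pos j ?_
      rw [h1, h2, abs_mul, abs_of_pos (rad_pos _), mul_lt_mul_iff_left₀ (rad_pos _), ← Int.cast_abs,
        Int.cast_lt, abs_lt]
      omega
    exact mul_pos (key _ (.inr rfl)) (key _ (.inl rfl))
  · push Not at hj
    have key : ∀ e : ℤ, e = 1 ∨ e = -1 → ell k' n' (circlePoint (endpt k (n' + d + 1) e)) < 0 := by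
      intro e he
      refine ell_neg fun j => ?_
      have hj := hj j
      rw [h1, h2, abs_mul, abs_of_pos (rad_pos _), mul_lt_mul_iff_left₀ (rad_pos _), ← Int.cast_abs,
        Int.cast_lt, lt_abs]
      rw [le_abs] at hj
      omega
    exact mul_pos_of_neg_of_neg (key _ (.inr rfl)) (key _ (.inl rfl))

lemma ell_congr {k k' j : ℤ} {n : ℕ} (h : 2 * k = 2 * k' + j * 2 ^ n) : ell k n = ell k' n := by
  have h' : (2 * k / 2 ^ n : ℝ) = 2 * k' / 2 ^ n + j := by
    have : (2 * k : ℝ) = 2 * k' + j * 2 ^ n := by exact_mod_cast h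
    rw [this]; field_simp
  funext z
  rw [ell, ell, h', mul_add, mul_comm (2 * Real.pi) (j : ℝ), Real.cos_add_int_mul_two_pi,
    Real.sin_add_int_mul_two_pi]

lemma arc_congr {k k' j : ℤ} {n : ℕ} (h : 2 * k = 2 * k' + j * 2 ^ n) : arc k n = arc k' n := by
  have h' : (2 * k : ℝ) = 2 * k' + j * 2 ^ n := by exact_mod_cast h
  rw [arc, arc]
  congr 1 <;> rw [coe_eq_coe_iff] <;> refine ⟨j, ?_⟩ <;> field_simp <;> linarith

/-- Distinct arcs of the lamination do not cross and have no common endpoints. -/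
lemma ell_mul_pos {k k' : ℤ} {n n' : ℕ} (h : arc k n ≠ arc k' n') :
    0 < ell k' n' (circlePoint (endpt k n (-1))) * ell k' n' (circlePoint (endpt k n 1)) := by
  rcases lt_trichotomy n n' with hn | rfl | hn
  · exact mul_pos_of_neg_of_neg (ell_neg_of_lt hn (.inr rfl)) (ell_neg_of_lt hn (.inl rfl))
  · have : ∀ j : ℤ, 2 * k ≠ 2 * k' + j * 2 ^ n := fun j hj => h (arc_congr hj)
    exact mul_pos_of_neg_of_neg (ell_neg_of_eq this (.inr rfl)) (ell_neg_of_eq this (.inl rfl))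
  · exact ell_mul_pos_of_lt hn

lemma ell_congr_of_arc {k k' : ℤ} {n n' : ℕ} (h : arc k n = arc k' n') : ell k n = ell k' n' := by
  have hz : ell k' n' (circlePoint (endpt k n 1)) = 0 := by
    rw [arc_eq, arc_eq, Sym2.eq_iff] at h
    rcases h with ⟨-, h⟩ | ⟨-, h⟩ <;> rw [h]
    exacts [ell_endpt _ _ (.inl rfl), ell_endpt _ _ (.inr rfl)]
  have hz' : ell k n (circlePoint (endpt k' n' 1)) = 0 := by
    rw [arc_eq, arc_eq, Sym2.eq_iff] at h
    rcases h with ⟨-, h⟩ | ⟨h, -⟩ <;> rw [← h]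
    exacts [ell_endpt _ _ (.inl rfl), ell_endpt _ _ (.inr rfl)]
  rcases lt_trichotomy n n' with hn | rfl | hn
  · exact absurd hz (ell_neg_of_lt hn (.inl rfl)).ne
  · by_contra hne
    exact absurd hz (ell_neg_of_eq (fun j hj => hne (ell_congr hj)) (.inl rfl)).ne
  · exact absurd hz' (ell_neg_of_lt hn (.inl rfl)).ne

lemma leaf_arc (k : ℤ) (n : ℕ) : leaf (arc k n) =
    openSegment ℝ (circlePoint (endpt k n (-1))) (circlePoint (endpt k n 1)) := by
  rw [arc_eq]
  rfl

lemma ell_of_mem_leaf {k : ℤ} {n : ℕ} {z : ℂ} (h : z ∈ leaf (arc k n)) : ell k n z = 0 := by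
  rw [leaf_arc] at h
  obtain ⟨a, b, -, -, hab, rfl⟩ := h
  rw [ell_comb _ _ hab, ell_endpt _ _ (.inl rfl), ell_endpt _ _ (.inr rfl)]
  ring

lemma mem_leaf_of_ell {k : ℤ} {n : ℕ} {z : ℂ} (hz : ‖z‖ < 1) (h : ell k n z = 0) :
    z ∈ leaf (arc k n) := by
  have hr := rad_pos n
  have hr' : (1 : ℝ) / (3 * 2 ^ n) < 1 / 2 := by
    have : (1 : ℝ) ≤ 2 ^ n := one_le_pow₀ (by norm_num)
    rw [div_lt_div_iff₀ (by positivity) (by norm_num)]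
    linarith
  have e1 : ∀ e : ℤ, 2 * Real.pi * endpt k n e =
      2 * Real.pi * (2 * k / 2 ^ n) + e * (2 * Real.pi * (1 / (3 * 2 ^ n))) := by
    intro e; rw [endpt]; field_simp; ring
  rw [leaf_arc, circlePoint_coe, circlePoint_coe, e1, e1]
  rw [ell] at h
  have hS : 0 < Real.sin (2 * Real.pi * (1 / (3 * 2 ^ n))) := by
    have := Real.pi_pos
    refine Real.sin_pos_of_pos_of_lt_pi (by positivity) ?_
    nlinarith
  generalize 2 * Real.pi * (2 * k / 2 ^ n) = c at *
  generalize 2 * Real.pi * (1 / (3 * 2 ^ n)) = r at *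
  push_cast
  simp only [neg_one_mul, one_mul, Real.cos_add, Real.sin_add, Real.cos_neg, Real.sin_neg]
  have hn : z.re ^ 2 + z.im ^ 2 < 1 := by
    have := Complex.normSq_apply z
    rw [Complex.normSq_eq_norm_sq] at this
    nlinarith [norm_nonneg z]
  have hc := Real.sin_sq_add_cos_sq c
  have hr := Real.sin_sq_add_cos_sq r
  generalize Real.cos c = C at *
  generalize Real.sin c = T at *
  generalize Real.cos r = R at *
  generalize Real.sin r = S at *
  set b := z.im * C - z.re * T with hb
  have hb2 : b ^ 2 < S ^ 2 := by
    have : b ^ 2 + R ^ 2 = z.re ^ 2 + z.im ^ 2 := by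
      rw [show R = z.re * C + z.im * T by linarith, hb]
      linear_combination (z.re ^ 2 + z.im ^ 2) * hc
    linarith
  have hb3 := abs_lt_of_sq_lt_sq hb2 hS.le
  rw [abs_lt] at hb3
  have hre : z.re = R * C - b * T := by
    rw [show R = z.re * C + z.im * T by linarith, hb]
    linear_combination (-z.re) * hc
  have him : z.im = R * T + b * C := by
    rw [show R = z.re * C + z.im * T by linarith, hb]
    linear_combination (-z.im) * hc
  refine ⟨(1 - b / S) / 2, (1 + b / S) / 2, ?_, ?_, by ring, ?_⟩
  · have : b / S < 1 := by rw [div_lt_one hS]; exact hb3.2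
    linarith
  · have : -1 < b / S := by rw [lt_div_iff₀ hS]; linarith
    linarith
  · apply Complex.ext
    · simp only [Complex.add_re, Complex.real_smul, Complex.mul_re, Complex.ofReal_re,
        Complex.ofReal_im]
      rw [hre]; field_simp; ring
    · simp only [Complex.add_im, Complex.real_smul, Complex.mul_im, Complex.ofReal_re,
        Complex.ofReal_im]
      rw [him]; field_simp; ring

/-! ### Gaps as intersections of half-planes -/

/-- The points of the open disk that are not separated from `z` by any leaf. -/
def cell (z : ℂ) : Set ℂ := {w | ‖w‖ < 1 ∧ ∀ k n, 0 < ell k n z * ell k n w}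

lemma mem_cutDisk {z : ℂ} : z ∈ cutDisk ↔ ‖z‖ < 1 ∧ ∀ k n, ell k n z ≠ 0 := by
  simp only [cutDisk, mem_sdiff, mem_ball_zero_iff, mem_iUnion, not_exists]
  refine and_congr_right fun hz => ⟨fun h k n h0 => ?_, fun h s hs hz' => ?_⟩
  · exact h _ (arc_mem k n) (mem_leaf_of_ell hz h0)
  · obtain ⟨k, n, rfl⟩ := hs
    exact h k n (ell_of_mem_leaf hz')

lemma mul_comb_pos {u v w a b : ℝ} (ha : 0 < a) (hb : 0 ≤ b) (h1 : 0 < u * v) (h2 : 0 ≤ u * w) :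
    0 < u * (a * v + b * w) := by
  have := mul_pos ha h1
  have := mul_nonneg hb h2
  linarith

lemma convex_cell (z : ℂ) : Convex ℝ (cell z) := by
  rintro x ⟨hx, hx'⟩ y ⟨hy, hy'⟩ a b ha hb hab
  refine ⟨?_, fun k n => ?_⟩
  · have := convex_ball (0 : ℂ) 1 (mem_ball_zero_iff.2 hx) (mem_ball_zero_iff.2 hy) ha hb hab
    exact mem_ball_zero_iff.1 this
  · rw [ell_comb _ _ hab]
    rcases eq_or_lt_of_le ha with rfl | ha
    · rw [zero_add] at hab
      simpa [hab] using hy' k n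
    · exact mul_comb_pos ha hb (hx' k n) (hy' k n).le

lemma mem_cell_self {z : ℂ} (hz : z ∈ cutDisk) : z ∈ cell z := by
  rw [mem_cutDisk] at hz
  exact ⟨hz.1, fun k n => mul_self_pos.2 (hz.2 k n)⟩

lemma cell_subset_cutDisk (z : ℂ) : cell z ⊆ cutDisk := fun w hw =>
  mem_cutDisk.2 ⟨hw.1, fun k n h => by simpa [h] using hw.2 k n⟩

/-- A continuous function without zeros has constant sign on a preconnected set. -/
lemma mul_pos_of_isPreconnected {X : Type*} [TopologicalSpace X] {s : Set X}
    (hs : IsPreconnected s) {g : X → ℝ} (hg : ContinuousOn g s) (h0 : ∀ x ∈ s, g x ≠ 0) {x y : X}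
    (hx : x ∈ s) (hy : y ∈ s) : 0 < g x * g y := by
  rcases lt_or_gt_of_ne (h0 x hx) with h | h <;> rcases lt_or_gt_of_ne (h0 y hy) with h' | h'
  · exact mul_pos_of_neg_of_neg h h'
  · obtain ⟨w, hw, e⟩ := hs.intermediate_value hx hy hg ⟨h.le, h'.le⟩
    exact absurd e (h0 w hw)
  · obtain ⟨w, hw, e⟩ := hs.intermediate_value hy hx hg ⟨h'.le, h.le⟩
    exact absurd e (h0 w hw)
  · exact mul_pos h h'

lemma connectedComponentIn_cutDisk {z : ℂ} (hz : z ∈ cutDisk) :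
    connectedComponentIn cutDisk z = cell z := by
  apply subset_antisymm
  · intro w hw
    have hsub := connectedComponentIn_subset cutDisk z
    refine ⟨(mem_cutDisk.1 (hsub hw)).1, fun k n => ?_⟩
    exact mul_pos_of_isPreconnected isPreconnected_connectedComponentIn
      (continuous_ell k n).continuousOn (fun x hx => (mem_cutDisk.1 (hsub hx)).2 k n)
      (mem_connectedComponentIn hz) hw
  · exact (convex_cell z).isPreconnected.subset_connectedComponentIn (mem_cell_self hz)
      (cell_subset_cutDisk z)

lemma mem_closure_cell {z : ℂ} (hz : z ∈ cutDisk) {w : ℂ} :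
    w ∈ closure (cell z) ↔ ‖w‖ ≤ 1 ∧ ∀ k n, 0 ≤ ell k n z * ell k n w := by
  constructor
  · intro hw
    have hc : IsClosed {w : ℂ | ‖w‖ ≤ 1 ∧ ∀ k n, 0 ≤ ell k n z * ell k n w} := by
      simp only [ofPred_and, ofPred_forall]
      refine (isClosed_le continuous_norm continuous_const).inter ?_
      refine isClosed_iInter fun k => isClosed_iInter fun n => ?_
      exact isClosed_le continuous_const (continuous_const.mul (continuous_ell k n))
    have hs : cell z ⊆ {w : ℂ | ‖w‖ ≤ 1 ∧ ∀ k n, 0 ≤ ell k n z * ell k n w} :=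
      fun x hx => ⟨hx.1.le, fun k n => (hx.2 k n).le⟩
    exact closure_minimal hs hc hw
  · rintro ⟨h1, h2⟩
    have hz' := mem_cell_self hz
    have : openSegment ℝ z w ⊆ cell z := by
      rintro _ ⟨a, b, ha, hb, hab, rfl⟩
      refine ⟨?_, fun k n => ?_⟩
      · calc ‖a • z + b • w‖ ≤ ‖a • z‖ + ‖b • w‖ := norm_add_le _ _
          _ = a * ‖z‖ + b * ‖w‖ := by
            rw [norm_smul, norm_smul, Real.norm_of_nonneg ha.le, Real.norm_of_nonneg hb.le]
          _ < 1 := by nlinarith [hz'.1]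
      · rw [ell_comb _ _ hab]
        exact mul_comb_pos ha hb.le (hz'.2 k n) (h2 k n)
    exact closure_mono this (segment_subset_closure_openSegment (right_mem_segment ℝ z w))

/-! ### Finiteness -/

lemma ell_le (k : ℤ) (n : ℕ) (z : ℂ) :
    ell k n z ≤ ‖z‖ - Real.cos (2 * Real.pi * (1 / (3 * 2 ^ n))) := by
  rw [ell]
  generalize 2 * Real.pi * (2 * k / 2 ^ n) = c
  have h := Complex.normSq_apply z
  rw [Complex.normSq_eq_norm_sq] at h
  have hc := Real.sin_sq_add_cos_sq c
  have : z.re * Real.cos c + z.im * Real.sin c ≤ ‖z‖ := by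
    refine le_of_sq_le_sq ?_ (norm_nonneg z)
    have e : (z.re * Real.cos c + z.im * Real.sin c) ^ 2 +
        (z.re * Real.sin c - z.im * Real.cos c) ^ 2 = ‖z‖ ^ 2 := by
      linear_combination (z.re ^ 2 + z.im ^ 2) * hc - h
    nlinarith [sq_nonneg (z.re * Real.sin c - z.im * Real.cos c)]
  linarith

/-- Only arcs of large radius come close to the center of the disk. -/
lemma exists_forall_ell_neg {ρ : ℝ} (hρ : ρ < 1) :
    ∃ N, ∀ n ≥ N, ∀ k, ∀ w : ℂ, ‖w‖ ≤ ρ → ell k n w < 0 := by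
  have h1 : Filter.Tendsto (fun n : ℕ => Real.cos (2 * Real.pi * (1 / (3 * 2 ^ n)))) Filter.atTop
      (nhds 1) := by
    have h2 : Filter.Tendsto (fun n : ℕ => 2 * Real.pi * (1 / (3 * 2 ^ n) : ℝ)) Filter.atTop
        (nhds (2 * Real.pi * (1 / 3 * 0))) := by
      have := tendsto_pow_atTop_nhds_zero_of_lt_one (r := (1 / 2 : ℝ)) (by norm_num) (by norm_num)
      refine ((this.const_mul (1 / 3)).const_mul (2 * Real.pi)).congr fun n => ?_
      rw [div_pow, one_pow]
      field_simp
    rw [mul_zero, mul_zero] at h2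
    have := (Real.continuous_cos.tendsto 0).comp h2
    rwa [Real.cos_zero] at this
  obtain ⟨N, hN⟩ := Filter.eventually_atTop.1 (h1.eventually (lt_mem_nhds hρ))
  refine ⟨N, fun n hn k w hw => ?_⟩
  have := ell_le k n w
  have := hN n hn
  linarith

/-- Indices for the arcs of the lamination. -/
def indices : Set (ℤ × ℕ) := {p | 0 ≤ p.1 ∧ p.1 < 2 ^ p.2}

lemma exists_index (k : ℤ) (n : ℕ) : ∃ k', (k', n) ∈ indices ∧ arc k n = arc k' n ∧
    ell k n = ell k' n := by
  have h : 2 * k = 2 * (k % 2 ^ n) + (2 * (k / 2 ^ n)) * 2 ^ n := by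
    have := Int.mul_ediv_add_emod k (2 ^ n)
    linear_combination -2 * this
  exact ⟨k % 2 ^ n, ⟨Int.emod_nonneg _ (by positivity), Int.emod_lt_of_pos _ (by positivity)⟩,
    arc_congr h, ell_congr h⟩

lemma indices_finite (N : ℕ) : {p ∈ indices | p.2 < N}.Finite := by
  refine ((Set.finite_Icc (0 : ℤ) (2 ^ N)).prod (Set.finite_Iio N)).subset ?_
  rintro ⟨k, n⟩ ⟨⟨h0, h1⟩, h2⟩
  refine ⟨⟨h0, h1.le.trans ?_⟩, h2⟩
  exact pow_le_pow_right₀ (by norm_num) h2.le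

lemma isOpen_cell {z : ℂ} (hz : ‖z‖ < 1) : IsOpen (cell z) := by
  rw [isOpen_iff_mem_nhds]
  intro w hw
  obtain ⟨ρ, hρ, hρ1⟩ := exists_between (max_lt hz hw.1)
  obtain ⟨N, hN⟩ := exists_forall_ell_neg hρ1
  have h1 : ∀ᶠ x in nhds w, ∀ p ∈ {p ∈ indices | p.2 < N}, 0 < ell p.1 p.2 z * ell p.1 p.2 x := by
    rw [Filter.eventually_all_finite (indices_finite N)]
    rintro p -
    exact (continuous_const.mul (continuous_ell p.1 p.2)).tendsto w |>.eventually
      (lt_mem_nhds (hw.2 p.1 p.2))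
  have h2 : ∀ᶠ x : ℂ in nhds w, ‖x‖ < ρ :=
    continuous_norm.tendsto w |>.eventually (gt_mem_nhds ((le_max_right _ _).trans_lt hρ))
  filter_upwards [h1, h2] with x hx1 hx2
  refine ⟨hx2.trans hρ1, fun k n => ?_⟩
  rcases lt_or_ge n N with hn | hn
  · obtain ⟨k', hk', -, e⟩ := exists_index k n
    rw [e]
    exact hx1 (k', n) ⟨hk', hn⟩
  · exact mul_pos_of_neg_of_neg (hN n hn k z ((le_max_left _ _).trans hρ.le)) (hN n hn k x hx2.le)

/-! ### Points of gaps -/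

/-- The gap that contains a given point. -/
def gapOf (z : ℂ) (hz : z ∈ cutDisk) : Gap :=
  ⟨cell z, z, hz, (connectedComponentIn_cutDisk hz).symm⟩

/-- A point of a gap. -/
def Gap.pt (G : Gap) : ℂ := G.2.choose

lemma Gap.pt_mem (G : Gap) : G.pt ∈ cutDisk := G.2.choose_spec.1

lemma Gap.eq_cell (G : Gap) : G.1 = cell G.pt := by
  rw [← connectedComponentIn_cutDisk G.pt_mem]
  exact G.2.choose_spec.2

lemma Gap.norm_pt (G : Gap) : ‖G.pt‖ < 1 := (mem_cutDisk.1 G.pt_mem).1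

lemma Gap.ell_ne (G : Gap) (k : ℤ) (n : ℕ) : ell k n G.pt ≠ 0 := (mem_cutDisk.1 G.pt_mem).2 k n

lemma mul_pos_trans {a b c : ℝ} (h : 0 < a * b) (h' : 0 < b * c) : 0 < a * c := by
  have hb : b ≠ 0 := by rintro rfl; simp at h
  have : 0 < b ^ 2 * (a * c) := by nlinarith [mul_pos h h']
  exact pos_of_mul_pos_right this (sq_nonneg b)

lemma Gap.ext_of_ell {G H : Gap} (h : ∀ k n, 0 < ell k n G.pt * ell k n H.pt) : G = H := by
  apply Subtype.ext
  rw [G.eq_cell, H.eq_cell]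
  ext w
  refine and_congr_right fun _ => forall_congr' fun k => forall_congr' fun n => ?_
  have h1 := h k n
  exact ⟨fun h2 => mul_pos_trans (by rwa [mul_comm]) h2, fun h2 => mul_pos_trans h1 h2⟩

lemma ell_gapOf {z : ℂ} (hz : z ∈ cutDisk) (k : ℤ) (n : ℕ) :
    0 < ell k n z * ell k n (gapOf z hz).pt := by
  have : z ∈ (gapOf z hz).1 := mem_cell_self hz
  rw [Gap.eq_cell] at this
  rw [mul_comm]
  exact this.2 k n

lemma Gap.mem_idealBoundary {G : Gap} {x : UnitAddCircle} :
    x ∈ G.idealBoundary ↔ ∀ k n, 0 ≤ ell k n G.pt * ell k n (circlePoint x) := by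
  rw [Gap.idealBoundary, mem_ofPred_eq, Gap.eq_cell, mem_closure_cell G.pt_mem]
  exact and_iff_right (norm_circlePoint x).le

lemma leaf_subset_closure_iff {G : Gap} {k : ℤ} {n : ℕ} : leaf (arc k n) ⊆ closure G.1 ↔
    (endpt k n (-1) : UnitAddCircle) ∈ G.idealBoundary ∧
      (endpt k n 1 : UnitAddCircle) ∈ G.idealBoundary := by
  rw [leaf_arc]
  constructor
  · intro h
    have h' := (segment_subset_closure_openSegment).trans (closure_minimal h isClosed_closure)
    exact ⟨h' (left_mem_segment ℝ _ _), h' (right_mem_segment ℝ _ _)⟩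
  · rintro ⟨h1, h2⟩
    have : Convex ℝ (closure G.1) := by
      rw [G.eq_cell]; exact (convex_cell _).closure
    exact this.openSegment_subset h1 h2

/-- Leaves are disjoint from each other. -/
lemma ell_leaf {k k' : ℤ} {n n' : ℕ} (h : arc k n ≠ arc k' n') {x : ℂ} (hx : x ∈ leaf (arc k n))
    {e : ℤ} (he : e = 1 ∨ e = -1) : 0 < ell k' n' x * ell k' n' (circlePoint (endpt k n e)) := by
  have h1 := ell_mul_pos h
  rw [leaf_arc] at hx
  obtain ⟨a, b, ha, hb, hab, rfl⟩ := hx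
  rw [ell_comb _ _ hab]
  rcases he with rfl | rfl
  · rw [mul_comm, add_comm]
    exact mul_comb_pos hb ha.le (mul_self_pos.2 (right_ne_zero_of_mul h1.ne'))
      (by rw [mul_comm]; exact h1.le)
  · rw [mul_comm]
    exact mul_comb_pos ha hb.le (mul_self_pos.2 (left_ne_zero_of_mul h1.ne')) h1.le

/-! ### The boundary of a gap on the circle -/

lemma exists_circlePoint {z : ℂ} (hz : ‖z‖ = 1) : ∃ x, circlePoint x = z := by
  obtain ⟨x, hx⟩ := (AddCircle.homeomorphCircle (T := 1) one_ne_zero).surjective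
    ⟨z, mem_sphere_zero_iff_norm.2 hz⟩
  refine ⟨x, ?_⟩
  rw [AddCircle.homeomorphCircle_apply] at hx
  rw [circlePoint, hx]

lemma norm_eq_one_of_extreme {z : ℂ} (hz : z ∈ cutDisk) {x : ℂ}
    (hx : x ∈ (closure (cell z)).extremePoints ℝ) : ‖x‖ = 1 := by
  rw [mem_extremePoints] at hx
  obtain ⟨hx, hext⟩ := hx
  obtain ⟨h1, h2⟩ := (mem_closure_cell hz).1 hx
  by_contra hne
  have hlt := lt_of_le_of_ne h1 hne
  by_cases h : ∃ k n, ell k n x = 0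
  · obtain ⟨k, n, h⟩ := h
    have hl := mem_leaf_of_ell hlt h
    have hm : ∀ e : ℤ, e = 1 ∨ e = -1 → circlePoint (endpt k n e) ∈ closure (cell z) := by
      intro e he
      refine (mem_closure_cell hz).2 ⟨(norm_circlePoint _).le, fun k' n' => ?_⟩
      by_cases ha : arc k n = arc k' n'
      · rw [← ell_congr_of_arc ha, ell_endpt _ _ he, mul_zero]
      · have h3 := ell_leaf ha hl he
        have h4 := (mem_cutDisk.1 hz).2 k' n'
        have h5 : 0 < ell k' n' z * ell k' n' x :=
          lt_of_le_of_ne (h2 k' n') (mul_ne_zero h4 (left_ne_zero_of_mul h3.ne')).symm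
        exact (mul_pos_trans h5 h3).le
    rw [leaf_arc] at hl
    have := (hext _ (hm (-1) (.inr rfl)) _ (hm 1 (.inl rfl)) hl).1
    rw [← this, norm_circlePoint] at hlt
    exact lt_irrefl _ hlt
  · push Not at h
    have hc : x ∈ cell z := ⟨hlt, fun k n =>
      lt_of_le_of_ne (h2 k n) (mul_ne_zero ((mem_cutDisk.1 hz).2 k n) (h k n)).symm⟩
    obtain ⟨ε, hε, hb⟩ := Metric.isOpen_iff.1 (isOpen_cell (mem_cutDisk.1 hz).1) x hc
    have hm : ∀ e : ℝ, |e| < ε → x + e ∈ closure (cell z) := by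
      intro e he
      refine subset_closure (hb ?_)
      rw [mem_ball_iff_norm, add_sub_cancel_left, Complex.norm_real]
      exact he
    have := (hext _ (hm (ε / 2) (by rw [abs_of_pos (by positivity)]; linarith)) _
      (hm (-(ε / 2)) (by rw [abs_neg, abs_of_pos (by positivity)]; linarith))
      ⟨1 / 2, 1 / 2, by norm_num, by norm_num, by norm_num, by
        simp only [Complex.real_smul]; push_cast; ring⟩).1
    rw [add_eq_left, Complex.ofReal_eq_zero] at this
    linarith

lemma not_cell_subset_segment {z : ℂ} (hz : z ∈ cutDisk) (p q : ℂ) : ¬ cell z ⊆ segment ℝ p q := by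
  intro h
  obtain ⟨ε, hε, hb⟩ := Metric.isOpen_iff.1 (isOpen_cell (mem_cutDisk.1 hz).1) z (mem_cell_self hz)
  have hm : ∀ e : ℂ, ‖e‖ < ε → ∃ b : ℝ, z + e = p + b * (q - p) := by
    intro e he
    have : z + e ∈ segment ℝ p q := by
      refine h (hb ?_)
      rw [mem_ball_iff_norm, add_sub_cancel_left]
      exact he
    obtain ⟨a, b, -, -, hab, e'⟩ := this
    refine ⟨b, ?_⟩
    rw [← e', Complex.real_smul, Complex.real_smul, show a = 1 - b by linarith]
    push_cast
    ring
  have h2 : ‖((ε / 2 : ℝ) : ℂ)‖ < ε := by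
    rw [Complex.norm_real, Real.norm_of_nonneg (by positivity)]; linarith
  obtain ⟨b₀, h₀⟩ := hm 0 (by simpa)
  obtain ⟨b₁, h₁⟩ := hm ((ε / 2 : ℝ) : ℂ) h2
  obtain ⟨b₂, h₂⟩ := hm (((ε / 2 : ℝ) : ℂ) * Complex.I) (by simpa using h2)
  have e : ((ε / 2 : ℝ) : ℂ) * (b₂ - b₀) = ((ε / 2 : ℝ) : ℂ) * Complex.I * (b₁ - b₀) := by
    linear_combination (b₂ - b₀ : ℂ) * (h₁ - h₀) - (b₁ - b₀ : ℂ) * (h₂ - h₀)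
  have er := congrArg Complex.re e
  simp at er
  rcases er with er | er
  · exact hε.ne' er
  · have e3 : ((ε / 2 : ℝ) : ℂ) * Complex.I = 0 := by
      have : (b₂ : ℂ) = b₀ := by rw [sub_eq_zero.1 er]
      rw [this] at h₂
      linear_combination h₂ - h₀
    have := congrArg Complex.im e3
    simp at this
    exact hε.ne' this

/-- The boundary of a gap contains at least three points. -/
lemma Gap.exists_three (G : Gap) : ∃ p ∈ G.idealBoundary, ∃ q ∈ G.idealBoundary,
    ∃ r ∈ G.idealBoundary, p ≠ q ∧ p ≠ r ∧ q ≠ r := by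
  have hz := G.pt_mem
  have hcomp : IsCompact (closure (cell G.pt)) := by
    refine (isCompact_closedBall (0 : ℂ) 1).of_isClosed_subset isClosed_closure fun w hw => ?_
    exact mem_closedBall_zero_iff.2 ((mem_closure_cell hz).1 hw).1
  have hKM := closure_convexHull_extremePoints hcomp (convex_cell _).closure
  have key : ∀ p q : UnitAddCircle, ∃ r ∈ G.idealBoundary, r ≠ p ∧ r ≠ q := by
    intro p q
    by_contra! hcon
    refine not_cell_subset_segment hz (circlePoint p) (circlePoint q) ?_
    have h1 : (closure (cell G.pt)).extremePoints ℝ ⊆ segment ℝ (circlePoint p) (circlePoint q) := by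
      intro x hx
      obtain ⟨r, rfl⟩ := exists_circlePoint (norm_eq_one_of_extreme hz hx)
      have hr : r ∈ G.idealBoundary := by
        rw [Gap.idealBoundary, mem_ofPred_eq, G.eq_cell]
        exact hx.1
      by_cases hp : r = p
      · rw [hp]; exact left_mem_segment ℝ _ _
      · rw [hcon r hr hp]; exact right_mem_segment ℝ _ _
    have hcl : IsClosed (segment ℝ (circlePoint p) (circlePoint q)) := by
      rw [← convexHull_pair]
      exact (Set.toFinite _).isClosed_convexHull ℝ
    have h2 := closure_minimal (convexHull_min h1 (convex_segment _ _)) hcl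
    rw [hKM] at h2
    exact subset_closure.trans h2
  obtain ⟨p, hp, -⟩ := key 0 0
  obtain ⟨q, hq, hqp, -⟩ := key p p
  obtain ⟨r, hr, hrp, hrq⟩ := key p q
  exact ⟨p, hp, q, hq, r, hr, hqp.symm, hrp.symm, hrq.symm⟩

/-- The circle points on the line of an arc are its endpoints. -/
lemma eq_endpt_of_ell {k : ℤ} {n : ℕ} {x : UnitAddCircle} (h : ell k n (circlePoint x) = 0) :
    x = endpt k n (-1) ∨ x = endpt k n 1 := by
  induction x using QuotientAddGroup.induction_on with
  | H x =>
    by_cases hneg : ∀ j : ℤ, 1 / (3 * 2 ^ n) < |x - 2 * k / 2 ^ n - j|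
    · exact absurd h (ell_neg hneg).ne
    push Not at hneg
    obtain ⟨j, hj⟩ := hneg
    rcases lt_or_eq_of_le hj with hj | hj
    · exact absurd h (ell_pos j hj).ne'
    have e1 : ∀ e : ℤ, endpt k n e = 2 * k / 2 ^ n + e * (1 / (3 * 2 ^ n)) := by
      intro e; rw [endpt]; field_simp; ring
    rcases (abs_eq (rad_pos n).le).1 hj with hj | hj
    · right
      refine coe_eq_coe_iff.2 ⟨j, ?_⟩
      rw [e1]; push_cast; linarith
    · left
      refine coe_eq_coe_iff.2 ⟨j, ?_⟩
      rw [e1]; push_cast; linarith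

/-- Of three distinct circle points, one is not on a given line. -/
lemma exists_ell_ne {p q r : UnitAddCircle} (hpq : p ≠ q) (hpr : p ≠ r) (hqr : q ≠ r) (k : ℤ)
    (n : ℕ) : ell k n (circlePoint p) ≠ 0 ∨ ell k n (circlePoint q) ≠ 0 ∨
      ell k n (circlePoint r) ≠ 0 := by
  by_contra! h
  obtain ⟨h1, h2, h3⟩ := h
  rcases eq_endpt_of_ell h1 with rfl | rfl <;> rcases eq_endpt_of_ell h2 with rfl | rfl <;>
    rcases eq_endpt_of_ell h3 with rfl | rfl <;> simp_all

/-- Gaps with three common boundary points agree. -/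
lemma Gap.eq_of_three {G H : Gap} {p q r : UnitAddCircle} (hpq : p ≠ q) (hpr : p ≠ r) (hqr : q ≠ r)
    (hp : p ∈ G.idealBoundary ∧ p ∈ H.idealBoundary)
    (hq : q ∈ G.idealBoundary ∧ q ∈ H.idealBoundary)
    (hr : r ∈ G.idealBoundary ∧ r ∈ H.idealBoundary) : G = H := by
  refine Gap.ext_of_ell fun k n => ?_
  have key : ∀ x, x ∈ G.idealBoundary ∧ x ∈ H.idealBoundary → ell k n (circlePoint x) ≠ 0 →
      0 < ell k n G.pt * ell k n H.pt := by
    rintro x ⟨h1, h2⟩ h0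
    have h1 := lt_of_le_of_ne (Gap.mem_idealBoundary.1 h1 k n) (mul_ne_zero (G.ell_ne k n) h0).symm
    have h2 := lt_of_le_of_ne (Gap.mem_idealBoundary.1 h2 k n) (mul_ne_zero (H.ell_ne k n) h0).symm
    rw [mul_comm (ell k n H.pt)] at h2
    exact mul_pos_trans h1 h2
  rcases exists_ell_ne hpq hpr hqr k n with h | h | h
  exacts [key _ hp h, key _ hq h, key _ hr h]

lemma Gap.eq_of_idealBoundary_subset {G H : Gap} (h : G.idealBoundary ⊆ H.idealBoundary) :
    G = H := by
  obtain ⟨p, hp, q, hq, r, hr, h1, h2, h3⟩ := G.exists_three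
  exact Gap.eq_of_three h1 h2 h3 ⟨hp, h hp⟩ ⟨hq, h hq⟩ ⟨hr, h hr⟩

/-! ### The action of the group on the gaps -/

lemma isPreconnected_ell_pos (k : ℤ) (n : ℕ) :
    IsPreconnected {x : UnitAddCircle | 0 < ell k n (circlePoint x)} := by
  have : {x : UnitAddCircle | 0 < ell k n (circlePoint x)} = (fun x : ℝ => (x : UnitAddCircle)) ''
      Ioo (2 * k / 2 ^ n - 1 / (3 * 2 ^ n)) (2 * k / 2 ^ n + 1 / (3 * 2 ^ n)) := by
    ext x
    constructor
    · induction x using QuotientAddGroup.induction_on with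
      | H x =>
        intro hx
        by_cases hneg : ∀ j : ℤ, 1 / (3 * 2 ^ n) < |x - 2 * k / 2 ^ n - j|
        · exact absurd hx (ell_neg hneg).not_gt
        push Not at hneg
        obtain ⟨j, hj⟩ := hneg
        rcases lt_or_eq_of_le hj with hj | hj
        · rw [abs_lt] at hj
          refine ⟨x - j, ⟨by linarith, by linarith⟩, coe_eq_coe_iff.2 ⟨-j, ?_⟩⟩
          push_cast; ring
        · exact absurd hx (ell_eq_zero j hj).not_gt
    · rintro ⟨t, ht, rfl⟩
      refine ell_pos 0 ?_
      rw [abs_lt]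
      push_cast
      constructor <;> linarith [ht.1, ht.2]
  rw [this]
  exact isPreconnected_Ioo.image _ (AddCircle.continuous_mk' 1).continuousOn

lemma isPreconnected_ell_neg (k : ℤ) (n : ℕ) :
    IsPreconnected {x : UnitAddCircle | ell k n (circlePoint x) < 0} := by
  have hr := rad_pos n
  have : {x : UnitAddCircle | ell k n (circlePoint x) < 0} = (fun x : ℝ => (x : UnitAddCircle)) ''
      Ioo (2 * k / 2 ^ n + 1 / (3 * 2 ^ n)) (2 * k / 2 ^ n + 1 - 1 / (3 * 2 ^ n)) := by
    ext x
    constructor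
    · induction x using QuotientAddGroup.induction_on with
      | H x =>
        intro hx
        have hneg : ∀ j : ℤ, 1 / (3 * 2 ^ n) < |x - 2 * k / 2 ^ n - j| := by
          intro j
          by_contra! hj
          rcases lt_or_eq_of_le hj with hj | hj
          · exact absurd hx (ell_pos j hj).not_gt
          · exact absurd hx (ell_eq_zero j hj).not_lt
        have h0 := Int.floor_le (x - 2 * k / 2 ^ n)
        have h1 := Int.lt_floor_add_one (x - 2 * k / 2 ^ n)
        set j := ⌊x - 2 * k / 2 ^ n⌋
        have h2 := hneg j
        have h3 := hneg (j + 1)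
        rw [abs_of_nonneg (by linarith)] at h2
        rw [abs_of_nonpos (by push_cast; linarith)] at h3
        push_cast at h3
        refine ⟨x - j, ⟨by linarith, by linarith⟩, coe_eq_coe_iff.2 ⟨-j, ?_⟩⟩
        push_cast; ring
    · rintro ⟨t, ⟨ht, ht'⟩, rfl⟩
      refine ell_neg fun j => ?_
      rcases le_or_gt j 0 with hj | hj
      · have : (j : ℝ) ≤ 0 := by exact_mod_cast hj
        exact lt_of_lt_of_le (by linarith) (le_abs_self _)
      · have : (1 : ℝ) ≤ j := by exact_mod_cast hj
        exact lt_of_lt_of_le (by linarith) (neg_le_abs _)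
  rw [this]
  exact isPreconnected_Ioo.image _ (AddCircle.continuous_mk' 1).continuousOn

lemma ell_map_eq_zero {f : UnitAddCircle ≃ₜ UnitAddCircle} {k k' : ℤ} {n n' : ℕ}
    (h : Sym2.map f (arc k n) = arc k' n') {x : UnitAddCircle} :
    ell k' n' (circlePoint (f x)) = 0 ↔ ell k n (circlePoint x) = 0 := by
  have mem : ∀ (k : ℤ) (n : ℕ) (y : UnitAddCircle), ell k n (circlePoint y) = 0 ↔ y ∈ arc k n := by
    intro k n y
    rw [arc_eq, Sym2.mem_iff]
    refine ⟨eq_endpt_of_ell, ?_⟩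
    rintro (rfl | rfl)
    exacts [ell_endpt _ _ (.inr rfl), ell_endpt _ _ (.inl rfl)]
  rw [mem, mem, ← h, Sym2.mem_map]
  constructor
  · rintro ⟨y, hy, e⟩
    rwa [← f.injective e]
  · exact fun hx => ⟨x, hx, rfl⟩

lemma ell_map_pos {f : UnitAddCircle ≃ₜ UnitAddCircle} {k k' : ℤ} {n n' : ℕ}
    (h : Sym2.map f (arc k n) = arc k' n') {x y : UnitAddCircle}
    (hxy : 0 < ell k n (circlePoint x) * ell k n (circlePoint y)) :
    0 < ell k' n' (circlePoint (f x)) * ell k' n' (circlePoint (f y)) := by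
  have main : ∀ s : Set UnitAddCircle, IsPreconnected s → (∀ x ∈ s, ell k n (circlePoint x) ≠ 0) →
      x ∈ s → y ∈ s → 0 < ell k' n' (circlePoint (f x)) * ell k' n' (circlePoint (f y)) := by
    intro s hs h0 hx hy
    refine mul_pos_of_isPreconnected (g := fun x => ell k' n' (circlePoint (f x))) hs ?_ ?_ hx hy
    · exact ((continuous_ell k' n').comp (continuous_circlePoint.comp f.continuous)).continuousOn
    · intro x hx e
      exact h0 x hx ((ell_map_eq_zero h).1 e)
  rcases pos_and_pos_or_neg_and_neg_of_mul_pos hxy with ⟨h1, h2⟩ | ⟨h1, h2⟩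
  · exact main _ (isPreconnected_ell_pos k n) (fun x hx => (ne_of_gt hx)) h1 h2
  · exact main _ (isPreconnected_ell_neg k n) (fun x hx => (ne_of_lt hx)) h1 h2

lemma exists_map_arc (f : TB) (k : ℤ) (n : ℕ) : ∃ k' n', Sym2.map f.1 (arc k' n') = arc k n := by
  obtain ⟨k', n', h⟩ := TB.map_mem_lamination f⁻¹ (arc_mem k n)
  refine ⟨k', n', ?_⟩
  rw [arc, ← h, Sym2.map_map]
  have e : (f.1 : UnitAddCircle → UnitAddCircle) ∘ (f⁻¹ : TB).1 = id := by
    funext x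
    exact f.1.apply_symm_apply x
  rw [e, Sym2.map_id, id]

lemma exists_image_subset (f : TB) (G : Gap) : ∃ H : Gap, f.1 '' G.idealBoundary ⊆ H.idealBoundary := by
  obtain ⟨p, hp, q, hq, r, hr, hpq, hpr, hqr⟩ := G.exists_three
  have key : ∀ k n, ∃ u : ℝ, u ≠ 0 ∧
      (∀ x ∈ G.idealBoundary, 0 ≤ u * ell k n (circlePoint (f.1 x))) ∧
      (0 < u * ell k n (circlePoint (f.1 p)) ∨ 0 < u * ell k n (circlePoint (f.1 q)) ∨
        0 < u * ell k n (circlePoint (f.1 r))) := by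
    intro k n
    obtain ⟨k', n', h⟩ := exists_map_arc f k n
    have main : ∀ y ∈ G.idealBoundary, ell k' n' (circlePoint y) ≠ 0 →
        ell k n (circlePoint (f.1 y)) ≠ 0 ∧ ∀ x ∈ G.idealBoundary,
          0 ≤ ell k n (circlePoint (f.1 y)) * ell k n (circlePoint (f.1 x)) := by
      intro y hy h0
      refine ⟨fun e => h0 ((ell_map_eq_zero h).1 e), fun x hx => ?_⟩
      by_cases hx0 : ell k' n' (circlePoint x) = 0
      · rw [(ell_map_eq_zero h).2 hx0, mul_zero]
      have h1 := lt_of_le_of_ne (Gap.mem_idealBoundary.1 hy k' n')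
        (mul_ne_zero (G.ell_ne k' n') h0).symm
      have h2 := lt_of_le_of_ne (Gap.mem_idealBoundary.1 hx k' n')
        (mul_ne_zero (G.ell_ne k' n') hx0).symm
      rw [mul_comm] at h1
      exact (ell_map_pos h (mul_pos_trans h1 h2)).le
    rcases exists_ell_ne hpq hpr hqr k' n' with h | h | h
    · obtain ⟨h1, h2⟩ := main p hp h
      exact ⟨_, h1, h2, .inl (mul_self_pos.2 h1)⟩
    · obtain ⟨h1, h2⟩ := main q hq h
      exact ⟨_, h1, h2, .inr (.inl (mul_self_pos.2 h1))⟩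
    · obtain ⟨h1, h2⟩ := main r hr h
      exact ⟨_, h1, h2, .inr (.inr (mul_self_pos.2 h1))⟩
  set w : ℂ := (1 / 2 : ℝ) • ((1 / 2 : ℝ) • circlePoint (f.1 p) + (1 / 2 : ℝ) • circlePoint (f.1 q)) +
    (1 / 2 : ℝ) • circlePoint (f.1 r) with hw
  have hell : ∀ k n, ell k n w = 1 / 2 * (1 / 2 * ell k n (circlePoint (f.1 p)) +
      1 / 2 * ell k n (circlePoint (f.1 q))) + 1 / 2 * ell k n (circlePoint (f.1 r)) := by
    intro k n
    rw [hw, ell_comb _ _ (by norm_num), ell_comb _ _ (by norm_num)]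
  have hwpos : ∀ k n, ∃ u : ℝ, 0 < u * ell k n w ∧
      ∀ x ∈ G.idealBoundary, 0 ≤ u * ell k n (circlePoint (f.1 x)) := by
    intro k n
    obtain ⟨u, -, h1, h2⟩ := key k n
    refine ⟨u, ?_, h1⟩
    have hp' := h1 p hp
    have hq' := h1 q hq
    have hr' := h1 r hr
    rw [hell]
    rcases h2 with h2 | h2 | h2 <;> linarith
  have hwd : w ∈ cutDisk := by
    refine mem_cutDisk.2 ⟨?_, fun k n h0 => ?_⟩
    · have h1 : ‖(1 / 2 : ℝ) • circlePoint (f.1 p) + (1 / 2 : ℝ) • circlePoint (f.1 q)‖ < 1 := by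
        refine norm_combo_lt_of_ne (norm_circlePoint _).le (norm_circlePoint _).le ?_ (by norm_num)
          (by norm_num) (by norm_num)
        exact fun h => hpq (f.1.injective (circlePoint_injective h))
      calc ‖w‖ ≤ _ := norm_add_le _ _
        _ = 1 / 2 * ‖(1 / 2 : ℝ) • circlePoint (f.1 p) + (1 / 2 : ℝ) • circlePoint (f.1 q)‖ +
            1 / 2 * 1 := by
          rw [norm_smul, norm_smul _ (circlePoint _), norm_circlePoint,
            Real.norm_of_nonneg (by norm_num)]
        _ < 1 := by linarith
    · obtain ⟨u, hu, -⟩ := hwpos k n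
      rw [h0, mul_zero] at hu
      exact lt_irrefl _ hu
  refine ⟨gapOf w hwd, ?_⟩
  rintro _ ⟨x, hx, rfl⟩
  refine Gap.mem_idealBoundary.2 fun k n => ?_
  obtain ⟨u, hu, hx'⟩ := hwpos k n
  have h1 := mul_pos_trans hu (ell_gapOf hwd k n)
  have h2 := hx' x hx
  have hu0 : u ≠ 0 := left_ne_zero_of_mul hu.ne'
  have h3 := mul_nonneg h1.le h2
  have h4 : 0 < u ^ 2 := by positivity
  have h5 : 0 ≤ u ^ 2 * (ell k n (gapOf w hwd).pt * ell k n (circlePoint (f.1 x))) := by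
    linarith
  exact nonneg_of_mul_nonneg_right h5 h4

/-- Every dyadic rearrangement permutes the gaps. -/
lemma exists_carriesGap (f : TB) (G : Gap) : ∃ H : Gap, CarriesGap f.1 G H := by
  obtain ⟨H, hH⟩ := exists_image_subset f G
  obtain ⟨G', hG'⟩ := exists_image_subset f⁻¹ H
  have hinv : ∀ x, (f⁻¹ : TB).1 (f.1 x) = x := fun x => f.1.symm_apply_apply x
  have hinv' : ∀ x, f.1 ((f⁻¹ : TB).1 x) = x := fun x => f.1.apply_symm_apply x
  have : G = G' := by
    refine Gap.eq_of_idealBoundary_subset fun x hx => ?_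
    rw [← hinv x]
    exact hG' (mem_image_of_mem _ (hH (mem_image_of_mem _ hx)))
  subst this
  refine ⟨H, subset_antisymm hH fun x hx => ⟨(f⁻¹ : TB).1 x, hG' (mem_image_of_mem _ hx), hinv' x⟩⟩

lemma CarriesGap.unique {f : UnitAddCircle ≃ₜ UnitAddCircle} {G H H' : Gap}
    (h : CarriesGap f G H) (h' : CarriesGap f G H') : H = H' := by
  refine Gap.eq_of_idealBoundary_subset ?_
  rw [← h, ← h']

/-- The permutation of the gaps that is induced by a dyadic rearrangement. -/
def gapMap (f : TB) (G : Gap) : Gap := (exists_carriesGap f G).choose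

lemma carriesGap_gapMap (f : TB) (G : Gap) : CarriesGap f.1 G (gapMap f G) :=
  (exists_carriesGap f G).choose_spec

lemma gapMap_mul (f g : TB) (G : Gap) : gapMap (f * g) G = gapMap f (gapMap g G) := by
  refine (carriesGap_gapMap (f * g) G).unique ?_
  have h1 := carriesGap_gapMap g G
  have h2 := carriesGap_gapMap f (gapMap g G)
  rw [CarriesGap] at *
  rw [← h2, ← h1, image_image]
  rfl

lemma gapMap_injective (f : TB) : Function.Injective (gapMap f) := by
  intro G H h
  have h1 := carriesGap_gapMap f G
  have h2 := carriesGap_gapMap f H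
  rw [CarriesGap] at h1 h2
  refine Gap.eq_of_idealBoundary_subset ?_
  rw [← image_subset_image_iff f.1.injective, h1, h2, h]

lemma gapGraph_adj {G H : Gap} : gapGraph.Adj G H ↔ G ≠ H ∧ ∃ s ∈ lamination, ∀ x ∈ s,
    x ∈ G.idealBoundary ∧ x ∈ H.idealBoundary := by
  refine and_congr_right fun _ => exists_congr fun s => and_congr_right ?_
  rintro ⟨k, n, rfl⟩
  change leaf (arc k n) ⊆ _ ↔ ∀ x ∈ arc k n, _
  rw [subset_inter_iff, leaf_subset_closure_iff, leaf_subset_closure_iff, arc_eq]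
  simp only [Sym2.mem_iff, forall_eq_or_imp, forall_eq]
  tauto

lemma gapMap_adj (f : TB) {G H : Gap} (h : gapGraph.Adj G H) :
    gapGraph.Adj (gapMap f G) (gapMap f H) := by
  rw [gapGraph_adj] at h ⊢
  obtain ⟨hne, s, hs, hx⟩ := h
  refine ⟨fun e => hne (gapMap_injective f e), Sym2.map f.1 s, TB.map_mem_lamination f hs, ?_⟩
  intro y hy
  obtain ⟨x, hxs, rfl⟩ := Sym2.mem_map.1 hy
  rw [← carriesGap_gapMap f G, ← carriesGap_gapMap f H]
  exact ⟨mem_image_of_mem _ (hx x hxs).1, mem_image_of_mem _ (hx x hxs).2⟩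

/-! ### Separation by leaves -/

/-- The arcs of the lamination whose leaves separate two points. -/
def sep (z w : ℂ) : Set (Sym2 UnitAddCircle) := {s | ∃ k n, s = arc k n ∧ ell k n z * ell k n w < 0}

lemma arc_mem_sep {k : ℤ} {n : ℕ} {z w : ℂ} : arc k n ∈ sep z w ↔ ell k n z * ell k n w < 0 := by
  refine ⟨?_, fun h => ⟨k, n, rfl, h⟩⟩
  rintro ⟨k', n', h, h'⟩
  rwa [ell_congr_of_arc h]

/-- The indices of the arcs of the lamination whose leaves separate two points. -/
def sepIndices (z w : ℂ) : Set (ℤ × ℕ) := {p ∈ indices | ell p.1 p.2 z * ell p.1 p.2 w < 0}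

lemma sepIndices_finite {z w : ℂ} (hz : ‖z‖ < 1) (hw : ‖w‖ < 1) : (sepIndices z w).Finite := by
  obtain ⟨N, hN⟩ := exists_forall_ell_neg (max_lt hz hw)
  refine (indices_finite N).subset ?_
  rintro ⟨k, n⟩ ⟨h1, h2⟩
  refine ⟨h1, ?_⟩
  by_contra! hn
  exact absurd h2 (mul_pos_of_neg_of_neg (hN n hn k z (le_max_left _ _))
    (hN n hn k w (le_max_right _ _))).not_gt

lemma sep_eq_image (z w : ℂ) : sep z w = (fun p : ℤ × ℕ => arc p.1 p.2) '' sepIndices z w := by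
  ext s
  constructor
  · rintro ⟨k, n, rfl, h⟩
    obtain ⟨k', hk, h1, h2⟩ := exists_index k n
    exact ⟨(k', n), ⟨hk, by rwa [h2] at h⟩, h1.symm⟩
  · rintro ⟨p, hp, rfl⟩
    exact ⟨_, _, rfl, hp.2⟩

lemma sep_finite {z w : ℂ} (hz : ‖z‖ < 1) (hw : ‖w‖ < 1) : (sep z w).Finite := by
  rw [sep_eq_image]
  exact (sepIndices_finite hz hw).image _

lemma Adj.sep {G H : Gap} (h : gapGraph.Adj G H) : ∃ k n, ell k n G.pt * ell k n H.pt < 0 ∧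
    ∀ k' n', arc k n ≠ arc k' n' → 0 < ell k' n' G.pt * ell k' n' H.pt := by
  rw [gapGraph_adj] at h
  obtain ⟨hne, _, ⟨k, n, rfl⟩, hx⟩ := h
  have key : ∀ k' n', arc k n ≠ arc k' n' → 0 < ell k' n' G.pt * ell k' n' H.pt := by
    intro k' n' ha
    have h1 := hx (endpt k n 1) (by change _ ∈ arc k n; rw [arc_eq]; simp)
    have h0 : ell k' n' (circlePoint (endpt k n 1)) ≠ 0 :=
      right_ne_zero_of_mul (ell_mul_pos ha).ne'
    have h2 := lt_of_le_of_ne (Gap.mem_idealBoundary.1 h1.1 k' n')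
      (mul_ne_zero (G.ell_ne k' n') h0).symm
    have h3 := lt_of_le_of_ne (Gap.mem_idealBoundary.1 h1.2 k' n')
      (mul_ne_zero (H.ell_ne k' n') h0).symm
    rw [mul_comm (ell k' n' H.pt)] at h3
    exact mul_pos_trans h2 h3
  refine ⟨k, n, ?_, key⟩
  by_contra! hcon
  refine hne (Gap.ext_of_ell fun k' n' => ?_)
  by_cases ha : arc k n = arc k' n'
  · rw [← ell_congr_of_arc ha]
    exact lt_of_le_of_ne hcon (mul_ne_zero (G.ell_ne k n) (H.ell_ne k n)).symm
  · exact key _ _ ha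

lemma ell_zero_pos (k : ℤ) : 0 < ell k 0 0 := by
  rw [ell, Complex.zero_re, Complex.zero_im,
    show 2 * Real.pi * (1 / (3 * 2 ^ 0)) = Real.pi - Real.pi / 3 by ring, Real.cos_pi_sub,
    Real.cos_pi_div_three]
  norm_num

lemma ell_zero_neg (k : ℤ) {n : ℕ} (hn : n ≠ 0) : ell k n 0 < 0 := by
  obtain ⟨n, rfl⟩ := Nat.exists_eq_add_one_of_ne_zero hn
  rw [ell, Complex.zero_re, Complex.zero_im, zero_mul, zero_mul, add_zero, zero_sub, neg_lt_zero]
  have := Real.pi_pos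
  refine Real.cos_pos_of_mem_Ioo ⟨?_, ?_⟩
  · have : 0 < 2 * Real.pi * (1 / (3 * 2 ^ (n + 1))) := by positivity
    linarith
  · have h1 : (1 : ℝ) ≤ 2 ^ n := one_le_pow₀ (by norm_num)
    rw [pow_succ, ← mul_div_assoc, mul_one,
      div_lt_div_iff₀ (by positivity) (by norm_num)]
    nlinarith

lemma ell_zero_ne (k : ℤ) (n : ℕ) : ell k n 0 ≠ 0 := by
  rcases eq_or_ne n 0 with rfl | hn
  · exact (ell_zero_pos k).ne'
  · exact (ell_zero_neg k hn).ne

lemma zero_mem_cutDisk : (0 : ℂ) ∈ cutDisk := mem_cutDisk.2 ⟨by simp, ell_zero_ne⟩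

/-- The gap that contains the center of the disk. -/
def centralGap : Gap := gapOf 0 zero_mem_cutDisk

/-- The number of leaves that separate a gap from the center of the disk. -/
def depth (G : Gap) : ℕ := (sep G.pt 0).ncard

lemma mul_neg_iff_of_pos {a b c : ℝ} (h : 0 < a * b) : a * c < 0 ↔ b * c < 0 := by
  rcases pos_and_pos_or_neg_and_neg_of_mul_pos h with ⟨h1, h2⟩ | ⟨h1, h2⟩ <;>
    simp [mul_neg_iff, h1, h2, h1.not_gt, h2.not_gt]

lemma depth_of_adj {G H : Gap} {k : ℤ} {n : ℕ} (h : ell k n G.pt * ell k n H.pt < 0)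
    (h' : ∀ k' n', arc k n ≠ arc k' n' → 0 < ell k' n' G.pt * ell k' n' H.pt)
    (hG : ell k n G.pt * ell k n 0 < 0) : depth G = depth H + 1 := by
  have hH : arc k n ∉ sep H.pt 0 := by
    rw [arc_mem_sep]
    intro h1
    have := mul_pos_of_neg_of_neg h h1
    have h2 := mul_neg_of_neg_of_pos hG (mul_self_pos.2 (H.ell_ne k n))
    linarith
  have : sep G.pt 0 = insert (arc k n) (sep H.pt 0) := by
    ext s
    rw [mem_insert_iff]
    constructor
    · rintro ⟨k', n', rfl, hs⟩
      by_cases ha : arc k n = arc k' n'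
      · exact .inl ha.symm
      · right
        rw [arc_mem_sep]
        exact (mul_neg_iff_of_pos (h' k' n' ha)).1 hs
    · rintro (rfl | ⟨k', n', rfl, hs⟩)
      · exact arc_mem_sep.2 hG
      · rw [arc_mem_sep]
        have ha : arc k n ≠ arc k' n' := by
          intro ha
          rw [ha, arc_mem_sep] at hH
          exact hH hs
        exact (mul_neg_iff_of_pos (h' k' n' ha)).2 hs
  rw [depth, depth, this, ncard_insert_of_notMem hH (sep_finite H.norm_pt (by simp))]

lemma depth_adj {G H : Gap} (h : gapGraph.Adj G H) : depth G = depth H + 1 ∨ depth H = depth G + 1 := by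
  obtain ⟨k, n, h1, h2⟩ := Adj.sep h
  rcases lt_or_gt_of_ne (mul_ne_zero (G.ell_ne k n) (ell_zero_ne k n)) with h3 | h3
  · exact .inl (depth_of_adj h1 h2 h3)
  · right
    refine depth_of_adj (k := k) (n := n) (by rwa [mul_comm])
      (fun k' n' ha => by rw [mul_comm]; exact h2 k' n' ha) ?_
    rw [mul_comm] at h1 h3
    have h4 : ell k n 0 * ell k n H.pt < 0 := by
      rcases pos_and_pos_or_neg_and_neg_of_mul_pos h3 with ⟨h5, h6⟩ | ⟨h5, h6⟩
      · exact mul_neg_of_pos_of_neg h5 (by nlinarith)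
      · exact mul_neg_of_neg_of_pos h5 (by nlinarith)
    rwa [mul_comm]

/-- The two-coloring of the gaps by the parity of the depth. -/
def parityColoring : gapGraph.Coloring Bool :=
  SimpleGraph.Coloring.mk (fun G => decide (Even (depth G))) (by
    intro G H h
    have key : Even (depth G) ↔ ¬ Even (depth H) := by
      rcases depth_adj h with h | h
      · rw [h, Nat.even_add_one]
      · rw [h, Nat.even_add_one, not_not]
    by_cases h1 : Even (depth H) <;> simp [key, h1])

/-- The point of the unit interval at which the affine interpolation from `v` to `u` vanishes. -/
def crossing (u v : ℝ) : ℝ := v / (v - u)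

lemma interp_eq {u v : ℝ} (h : u * v < 0) (t : ℝ) :
    t * u + (1 - t) * v = (t - crossing u v) * (u - v) := by
  have : v - u ≠ 0 := by
    intro e
    rw [sub_eq_zero] at e
    subst e
    exact (mul_self_nonneg v).not_gt h
  rw [crossing]
  field_simp
  ring

lemma crossing_mem {u v : ℝ} (h : u * v < 0) : 0 < crossing u v ∧ crossing u v < 1 := by
  rw [crossing]
  rcases mul_neg_iff.1 h with ⟨h1, h2⟩ | ⟨h1, h2⟩
  · exact ⟨div_pos_of_neg_of_neg h2 (by linarith), by rw [div_lt_one_of_neg (by linarith)]; linarith⟩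
  · exact ⟨div_pos h2 (by linarith), by rw [div_lt_one (by linarith)]; linarith⟩

lemma mul_interp_pos {u v t : ℝ} (h : u * v < 0) (ht : crossing u v < t) :
    0 < u * (t * u + (1 - t) * v) := by
  rw [interp_eq h]
  have h1 : 0 < u * (u - v) := by nlinarith [mul_self_nonneg u]
  have h2 := mul_pos (sub_pos.2 ht) h1
  linarith

lemma mul_interp_neg {u v t : ℝ} (h : u * v < 0) (ht : t < crossing u v) :
    u * (t * u + (1 - t) * v) < 0 := by
  rw [interp_eq h]
  have h1 : 0 < u * (u - v) := by nlinarith [mul_self_nonneg u]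
  have h2 := mul_pos (sub_pos.2 ht) h1
  linarith

lemma ell_smul (k : ℤ) (n : ℕ) (t : ℝ) (z : ℂ) :
    ell k n (t • z) = t * ell k n z + (1 - t) * ell k n 0 := by
  rw [← ell_comb k n (by ring : t + (1 - t) = 1), smul_zero, add_zero]

lemma exists_adj_depth {G : Gap} (hG : (sep G.pt 0).Nonempty) :
    ∃ H, gapGraph.Adj G H ∧ depth G = depth H + 1 := by
  have hS := sepIndices_finite G.norm_pt (w := 0) (by simp)
  rw [sep_eq_image, image_nonempty] at hG
  set z := G.pt with hz
  let T : ℤ × ℕ → ℝ := fun q => crossing (ell q.1 q.2 z) (ell q.1 q.2 0)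
  obtain ⟨p, hp, hmax⟩ := exists_max_image _ T hS hG
  have hT := crossing_mem hp.2
  have hnorm : ∀ t : ℝ, 0 < t → t < 1 → ‖t • z‖ < 1 := by
    intro t h0 h1
    rw [norm_smul, Real.norm_of_nonneg h0.le]
    nlinarith [G.norm_pt, norm_nonneg z]
  have hx0 : T p • z ∈ leaf (arc p.1 p.2) := by
    refine mem_leaf_of_ell (hnorm _ hT.1 hT.2) ?_
    rw [ell_smul, interp_eq hp.2, sub_self, zero_mul]
  have hlt : ∀ q ∈ sepIndices z 0, arc p.1 p.2 ≠ arc q.1 q.2 → T q < T p := by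
    intro q hq hne
    refine lt_of_le_of_ne (hmax q hq) fun e => ?_
    have h := ell_leaf hne hx0 (.inl rfl)
    rw [← e, ell_smul, interp_eq hq.2, sub_self, zero_mul, zero_mul] at h
    exact lt_irrefl _ h
  have hpos : ∀ t, 0 < t → t < 1 → (∀ q ∈ sepIndices z 0, arc p.1 p.2 ≠ arc q.1 q.2 → T q < t) →
      ∀ k n, arc p.1 p.2 ≠ arc k n → 0 < ell k n z * ell k n (t • z) := by
    intro t h0 h1 ht k n hne
    obtain ⟨k', hk, ha, he⟩ := exists_index k n
    rw [ha] at hne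
    rw [he, ell_smul]
    rcases lt_or_gt_of_ne (mul_ne_zero (G.ell_ne k' n) (ell_zero_ne k' n)) with h | h
    · exact mul_interp_pos h (ht (k', n) ⟨hk, h⟩ hne)
    · exact mul_comb_pos h0 (by linarith) (mul_self_pos.2 (G.ell_ne k' n)) h.le
  obtain ⟨t, ⟨ht0, htT⟩, ht⟩ : ∃ t, t ∈ Ioo 0 (T p) ∧
      ∀ q ∈ sepIndices z 0, arc p.1 p.2 ≠ arc q.1 q.2 → T q < t := by
    have h1 : ∀ᶠ t in nhdsWithin (T p) (Iio (T p)), t ∈ Ioo 0 (T p) := Ioo_mem_nhdsLT hT.1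
    have h2 : ∀ᶠ t in nhdsWithin (T p) (Iio (T p)),
        ∀ q ∈ sepIndices z 0, arc p.1 p.2 ≠ arc q.1 q.2 → T q < t := by
      rw [Filter.eventually_all_finite hS]
      intro q hq
      by_cases hne : arc p.1 p.2 ≠ arc q.1 q.2
      · filter_upwards [Ioo_mem_nhdsLT (hlt q hq hne)] with t ht _ using ht.1
      · exact .of_forall fun t h => absurd h hne
    exact (h1.and h2).exists
  have ht1 : t < 1 := htT.trans hT.2
  have hneg : ell p.1 p.2 z * ell p.1 p.2 (t • z) < 0 := by
    rw [ell_smul]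
    exact mul_interp_neg hp.2 htT
  have hcut : t • z ∈ cutDisk := by
    refine mem_cutDisk.2 ⟨hnorm t ht0 ht1, fun k n => ?_⟩
    by_cases hne : arc p.1 p.2 = arc k n
    · rw [← ell_congr_of_arc hne]
      exact right_ne_zero_of_mul hneg.ne
    · exact right_ne_zero_of_mul (hpos t ht0 ht1 ht k n hne).ne'
  set H := gapOf (t • z) hcut with hH
  have hHpos : ∀ k n, arc p.1 p.2 ≠ arc k n → 0 < ell k n z * ell k n H.pt := fun k n hne =>
    mul_pos_trans (hpos t ht0 ht1 ht k n hne) (ell_gapOf hcut k n)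
  have hHneg : ell p.1 p.2 z * ell p.1 p.2 H.pt < 0 := by
    have h := (mul_neg_iff_of_pos (ell_gapOf hcut p.1 p.2)).1 (by rwa [mul_comm])
    rwa [mul_comm]
  refine ⟨H, gapGraph_adj.2 ⟨?_, arc p.1 p.2, arc_mem _ _, ?_⟩, depth_of_adj hHneg hHpos hp.2⟩
  · intro e
    rw [← e] at hHneg
    exact (mul_self_nonneg _).not_gt hHneg
  · have key : ∀ e : ℤ, e = 1 ∨ e = -1 → (endpt p.1 p.2 e : UnitAddCircle) ∈ G.idealBoundary ∧
        (endpt p.1 p.2 e : UnitAddCircle) ∈ H.idealBoundary := by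
      intro e he
      have main : ∀ k n, arc p.1 p.2 ≠ arc k n →
          0 < ell k n z * ell k n (circlePoint (endpt p.1 p.2 e)) := fun k n hne =>
        mul_pos_trans (hpos (T p) hT.1 hT.2 hlt k n hne) (ell_leaf hne hx0 he)
      constructor <;> refine Gap.mem_idealBoundary.2 fun k n => ?_ <;>
        by_cases hne : arc p.1 p.2 = arc k n
      · rw [← ell_congr_of_arc hne, ell_endpt _ _ he, mul_zero]
      · exact (main k n hne).le
      · rw [← ell_congr_of_arc hne, ell_endpt _ _ he, mul_zero]
      · have h := hHpos k n hne
        rw [mul_comm] at h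
        exact (mul_pos_trans h (main k n hne)).le
    intro x hx
    rw [arc_eq, Sym2.mem_iff] at hx
    rcases hx with rfl | rfl
    exacts [key _ (.inr rfl), key _ (.inl rfl)]

lemma eq_centralGap {G : Gap} (h : ¬ (sep G.pt 0).Nonempty) : G = centralGap := by
  refine Gap.ext_of_ell fun k n => mul_pos_trans ?_ (ell_gapOf zero_mem_cutDisk k n)
  by_contra! h'
  exact h ⟨_, arc_mem_sep.2 (lt_of_le_of_ne h' (mul_ne_zero (G.ell_ne k n) (ell_zero_ne k n)))⟩

lemma coloring_adj (c : gapGraph.Coloring Bool) {G H : Gap} (h : gapGraph.Adj G H) :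
    c G = !(c H) := by
  have := c.valid h
  revert this
  cases c G <;> cases c H <;> simp

/-- A two-coloring of the gaps is determined by the color of the central gap. -/
lemma coloring_eq (c c' : gapGraph.Coloring Bool) (b : Bool)
    (h : c' centralGap = xor b (c centralGap)) (G : Gap) : c' G = xor b (c G) := by
  induction hd : depth G generalizing G with
  | zero =>
    by_cases hG : (sep G.pt 0).Nonempty
    · obtain ⟨H, -, h⟩ := exists_adj_depth hG
      omega
    · rw [eq_centralGap hG, h]
  | succ m ih =>
    by_cases hG : (sep G.pt 0).Nonempty
    · obtain ⟨H, hadj, h⟩ := exists_adj_depth hG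
      rw [coloring_adj c hadj, coloring_adj c' hadj, ih H (by omega), Bool.xor_not]
    · rw [eq_centralGap hG, h]

/-- The two-coloring of the gaps is unique up to exchanging the colors. -/
lemma coloring_unique (c c' : gapGraph.Coloring Bool) :
    (∀ G, c' G = c G) ∨ (∀ G, c' G = !(c G)) := by
  by_cases h : c' centralGap = c centralGap
  · left
    intro G
    simpa using coloring_eq c c' false (by simpa using h) G
  · right
    intro G
    simpa using coloring_eq c c' true (by rw [Bool.true_xor]; exact Bool.eq_not_of_ne h) G

/-- The pullback of a two-coloring under a dyadic rearrangement. -/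
def pullback (c : gapGraph.Coloring Bool) (f : TB) : gapGraph.Coloring Bool :=
  SimpleGraph.Coloring.mk (fun G => c (gapMap f G)) fun h => c.valid (gapMap_adj f h)

/-- Whether a dyadic rearrangement exchanges the two colors. -/
def exchanges (c : gapGraph.Coloring Bool) (f : TB) : Bool :=
  xor (c (gapMap f centralGap)) (c centralGap)

lemma coloring_gapMap (c : gapGraph.Coloring Bool) (f : TB) (G : Gap) :
    c (gapMap f G) = xor (exchanges c f) (c G) := by
  refine coloring_eq c (pullback c f) (exchanges c f) ?_ G
  change c (gapMap f centralGap) = _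
  rw [exchanges, Bool.xor_assoc, Bool.xor_self, Bool.xor_false]

lemma exchanges_mul (c : gapGraph.Coloring Bool) (f g : TB) :
    exchanges c (f * g) = xor (exchanges c f) (exchanges c g) := by
  rw [exchanges, gapMap_mul, coloring_gapMap, coloring_gapMap, Bool.xor_assoc, Bool.xor_assoc,
    Bool.xor_self, Bool.xor_false]

lemma exchanges_one (c : gapGraph.Coloring Bool) : exchanges c 1 = false := by
  have h := exchanges_mul c 1 1
  rw [mul_one, Bool.xor_self] at h
  exact h

lemma exchanges_inv (c : gapGraph.Coloring Bool) (f : TB) :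
    exchanges c f⁻¹ = exchanges c f := by
  have h := exchanges_mul c f f⁻¹
  rw [mul_inv_cancel, exchanges_one] at h
  revert h
  cases exchanges c f <;> cases exchanges c f⁻¹ <;> simp

/-- The subgroup of the rearrangements that do not exchange the two colors. -/
def colorPreserving (c : gapGraph.Coloring Bool) : Subgroup TB where
  carrier := {f | exchanges c f = false}
  mul_mem' {f g} hf hg := by
    rw [mem_ofPred_eq] at *
    rw [exchanges_mul, hf, hg, Bool.xor_self]
  one_mem' := exchanges_one c
  inv_mem' {f} hf := (exchanges_inv c f).trans hf

lemma mem_colorPreserving {c : gapGraph.Coloring Bool} {f : TB} :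
    f ∈ colorPreserving c ↔ exchanges c f = false := Iff.rfl

lemma commutator_le_colorPreserving (c : gapGraph.Coloring Bool) :
    commutator TB ≤ colorPreserving c := by
  rw [commutator_def, Subgroup.commutator_le]
  intro f _ g _
  rw [mem_colorPreserving, commutatorElement_def, exchanges_mul, exchanges_mul, exchanges_mul,
    exchanges_inv, exchanges_inv]
  cases exchanges c f <;> cases exchanges c g <;> rfl

lemma preservesColoring_iff {c : gapGraph.Coloring Bool} {f : TB} :
    PreservesColoring f.1 c ↔ f ∈ colorPreserving c := by
  rw [mem_colorPreserving]
  constructor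
  · intro h
    rw [exchanges, ← h _ _ (carriesGap_gapMap f _), Bool.xor_self]
  · intro h G H hGH
    rw [← (carriesGap_gapMap f G).unique hGH, coloring_gapMap, h, Bool.false_xor]

/-! ### The generator `α` exchanges the colors -/

lemma mem_idealBoundary_centralGap {x : UnitAddCircle} :
    x ∈ centralGap.idealBoundary ↔ ∀ k n, 0 ≤ ell k n 0 * ell k n (circlePoint x) := by
  rw [Gap.mem_idealBoundary]
  refine forall_congr' fun k => forall_congr' fun n => ?_
  rw [← not_lt, ← not_lt, mul_neg_iff_of_pos (ell_gapOf zero_mem_cutDisk k n)]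
  rfl

lemma endpt_zero_zero_mem {e : ℤ} (he : e = 1 ∨ e = -1) :
    (endpt 0 0 e : UnitAddCircle) ∈ centralGap.idealBoundary := by
  rw [mem_idealBoundary_centralGap]
  intro k n
  rcases n.eq_zero_or_pos with rfl | hn
  · rw [ell_congr (k' := 0) (j := 2 * k) (by ring), ell_endpt _ _ he, mul_zero]
  · exact (mul_pos_of_neg_of_neg (ell_zero_neg k hn.ne') (ell_neg_of_lt hn he)).le

lemma endpt_zero_one_mem {e : ℤ} (he : e = 1 ∨ e = -1) :
    (endpt 0 1 e : UnitAddCircle) ∈ centralGap.idealBoundary := by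
  rw [mem_idealBoundary_centralGap]
  intro k n
  rcases lt_trichotomy n 1 with hn | rfl | hn
  · obtain rfl : n = 0 := by omega
    refine (mul_pos (ell_zero_pos k) (ell_pos (-2 * k) ?_)).le
    rw [endpt]
    rcases he with rfl | rfl <;> rw [abs_lt] <;> push_cast <;> constructor <;> linarith
  · rw [ell_congr (k' := 0) (j := k) (by ring), ell_endpt _ _ he, mul_zero]
  · exact (mul_pos_of_neg_of_neg (ell_zero_neg k (by omega)) (ell_neg_of_lt hn he)).le

lemma α_endpt (e : ℤ) (he : e = 1 ∨ e = -1) :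
    α.1 (endpt 0 0 e : UnitAddCircle) = (endpt 0 1 e : UnitAddCircle) := by
  change alphaHomeo _ = _
  rcases he with rfl | rfl
  · rw [show endpt 0 0 1 = 1 / 3 by norm_num [endpt], alpha_apply _ (by norm_num)]
    congr 1
    norm_num [endpt, alphaFun]
  · rw [show endpt 0 0 (-1) = -1 / 3 by norm_num [endpt],
      ← coe_sub_one (2 / 3) (-1 / 3) (by norm_num), alpha_apply _ (by norm_num)]
    refine coe_sub_one _ _ ?_
    norm_num [endpt, alphaFun]

lemma gapMap_α_ne : gapMap α centralGap ≠ centralGap := by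
  intro h
  have h1 := mem_image_of_mem α.1 (endpt_zero_one_mem (.inl rfl))
  rw [carriesGap_gapMap α centralGap, h] at h1
  have e : α.1 (endpt 0 1 1 : UnitAddCircle) = ((1 / 12 : ℝ) : UnitAddCircle) := by
    change alphaHomeo _ = _
    rw [show endpt 0 1 1 = 1 / 6 by norm_num [endpt], alpha_apply _ (by norm_num)]
    congr 1
    norm_num [alphaFun]
  rw [e] at h1
  have h2 := mem_idealBoundary_centralGap.1 h1 0 1
  have h3 : 0 < ell 0 1 (circlePoint ((1 / 12 : ℝ) : UnitAddCircle)) :=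
    ell_pos 0 (by norm_num [abs_lt])
  exact h2.not_gt (mul_neg_of_neg_of_pos (ell_zero_neg 0 one_ne_zero) h3)

lemma exchanges_α (c : gapGraph.Coloring Bool) : exchanges c α = true := by
  have key : ∀ e : ℤ, e = 1 ∨ e = -1 → (endpt 0 1 e : UnitAddCircle) ∈
      (gapMap α centralGap).idealBoundary ∧
      (endpt 0 1 e : UnitAddCircle) ∈ centralGap.idealBoundary := by
    refine fun e he => ⟨?_, endpt_zero_one_mem he⟩
    rw [← carriesGap_gapMap α centralGap, ← α_endpt e he]
    exact mem_image_of_mem _ (endpt_zero_zero_mem he)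
  have hadj : gapGraph.Adj (gapMap α centralGap) centralGap := by
    refine gapGraph_adj.2 ⟨gapMap_α_ne, arc 0 1, arc_mem _ _, fun x hx => ?_⟩
    rw [arc_eq, Sym2.mem_iff] at hx
    rcases hx with rfl | rfl
    exacts [key _ (.inr rfl), key _ (.inl rfl)]
  rw [exchanges, coloring_adj c hadj]
  cases c centralGap <;> rfl

lemma colorPreserving_le_evenGroup (c : gapGraph.Coloring Bool) :
    colorPreserving c ≤ evenGroup := by
  intro f hf
  rcases mem_or_mem_of_closure (mem_genGroup f) with h | h
  · exact h
  · have h1 := commutator_le_colorPreserving c (evenGroup_le_commutator h)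
    rw [mem_colorPreserving] at hf h1
    rw [exchanges_mul, exchanges_α, hf] at h1
    exact absurd h1 (by decide)

lemma commutator_eq_evenGroup : commutator TB = evenGroup :=
  le_antisymm ((commutator_le_colorPreserving parityColoring).trans
    (colorPreserving_le_evenGroup _)) evenGroup_le_commutator

lemma commutator_eq_colorPreserving (c : gapGraph.Coloring Bool) :
    commutator TB = colorPreserving c :=
  le_antisymm (commutator_le_colorPreserving c)
    ((colorPreserving_le_evenGroup c).trans evenGroup_le_commutator)

lemma index_colorPreserving (c : gapGraph.Coloring Bool) : (colorPreserving c).index = 2 := by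
  rw [Subgroup.index_eq_two_iff]
  refine ⟨α, fun f => ?_⟩
  rw [mem_colorPreserving, mem_colorPreserving, exchanges_mul, exchanges_α]
  cases exchanges c f <;> simp

end Basilica

end

/-- The gaps of the Basilica lamination have a proper two-coloring `c`, unique up to exchanging the
colors; the commutator subgroup of `T_B` consists of the elements that preserve it, has index two,
and is generated by `β, γ, δ` and their conjugates `β^α, γ^α, δ^α`, where `g^α = α⁻¹ g α`. -/
theorem mainTheorem3 :
    ∃ c : Basilica.gapGraph.Coloring Bool,
      (∀ c' : Basilica.gapGraph.Coloring Bool, (∀ G, c' G = c G) ∨ (∀ G, c' G = !(c G))) ∧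
      (∀ f : Basilica.TB, f ∈ commutator Basilica.TB ↔
        Basilica.PreservesColoring (f : UnitAddCircle ≃ₜ UnitAddCircle) c) ∧
      (commutator Basilica.TB).index = 2 ∧
      commutator Basilica.TB = Subgroup.closure
        {Basilica.β, Basilica.γ, Basilica.δ,
          Basilica.α⁻¹ * Basilica.β * Basilica.α,
          Basilica.α⁻¹ * Basilica.γ * Basilica.α,
          Basilica.α⁻¹ * Basilica.δ * Basilica.α} := by
  refine ⟨Basilica.parityColoring, Basilica.coloring_unique _, fun f => ?_, ?_,
    Basilica.commutator_eq_evenGroup⟩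
  · rw [Basilica.preservesColoring_iff, Basilica.commutator_eq_colorPreserving]
  · rw [Basilica.commutator_eq_colorPreserving Basilica.parityColoring,
      Basilica.index_colorPreserving]
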